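/- **Theorem (dynamic subset sum with offline access).** In dynamic subset sum, a value $t_{\max}\in\mathbb{N}$ is given, the multiset of items is initially empty, and each of a sequence of $\mathsf{oprs}\ge 1$ operations either inserts an item with a given non-negative integer weight, or asks, for a given integer $0\le t\le t_{\max}$, whether some subset of the items inserted so far has total weight exactly $t$. With offline access, $t_{\max}$ and the whole operation sequence are given to the algorithm before it starts, and it must output the answers to the queries in their order. The amortized processing time is the total running time divided by $\mathsf{oprs}$. There is a randomized algorithm for dynamic subset sum with offline access whose amortized processing time is $$\tilde O\!\left(1+\frac{t_{\max}\cdot\min\{\sqrt{\mathsf{oprs}},\sqrt{t_{\max}}\}}{\mathsf{oprs}}\right)$$ and which answers all queries correctly with high probability. Precisely: for every $d\in\mathbb{N}$ there are a randomized word-RAM program and constants $c,k\in\mathbb{N}$, $C\in\mathbb{R}$ such that the following holds for every $t_{\max}$, every sequence of $\mathsf{oprs}\ge1$ operations as above, and every word length $w$ with $2^w\ge(t_{\max}+\mathsf{oprs}+2)^c$ and $2^w$ larger than every inserted weight. On this input, with words of $w$ bits, the program halts for every outcome of its random choices, with running time $T$ satisfying $$\frac{T}{\mathsf{oprs}}\le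 C\left(1+\frac{t_{\max}\min\{\sqrt{\mathsf{oprs}},\sqrt{t_{\max}}\}}{\mathsf{oprs}}\right)\bigl(\log(t_{\max}+\mathsf{oprs}+2)\bigr)^{k},$$ and with probability at least $1-(t_{\max}+\mathsf{oprs})^{-d}$ its output is the list of correct answers to all queries. Here the word RAM has a fixed number of registers and of arrays of $2^w$ words. Its unit-cost instructions are constants, array access, $+$ and $\times$ modulo $2^w$, truncated subtraction, integer division and remainder, comparisons, bitwise operations and shifts, branching and loops, output, and drawing a uniformly random word. -/

import Mathlib

open MeasureTheory

/-! ### A randomized word RAM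

Programs are structured (while-)programs over machine words of `w` bits, represented as natural
numbers below `2 ^ w`.  A program is a fixed finite object that does not depend on the input or on
`w`.  It uses finitely many registers and finitely many arrays of `2 ^ w` words, indexed by words.
Every evaluated node of an expression and every executed command or test costs one time unit. -/

namespace WordRAM

/-- The binary word instructions. -/
inductive BinOp where
  | add | sub | mul | div | mod | lt | eq | and | or | xor | shl | shr

/-- Result of a binary instruction on words of `w` bits: addition, multiplication and left shift
are modulo `2 ^ w`, subtraction is proper subtraction, division rounds down (`x / 0 = 0`,
`x % 0 = x`), and comparisons return `1` or `0`. -/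
def BinOp.eval (w : ℕ) : BinOp → ℕ → ℕ → ℕ
  | .add, x, y => (x + y) % 2 ^ w
  | .sub, x, y => x - y
  | .mul, x, y => (x * y) % 2 ^ w
  | .div, x, y => x / y
  | .mod, x, y => x % y
  | .lt,  x, y => if x < y then 1 else 0
  | .eq,  x, y => if x = y then 1 else 0
  | .and, x, y => x &&& y
  | .or,  x, y => x ||| y
  | .xor, x, y => x ^^^ y
  | .shl, x, y => (x <<< y) % 2 ^ w
  | .shr, x, y => x >>> y

/-- Expressions: constants, registers, array accesses `load a i` (cell `i` of array `a`), and
binary instructions. -/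
inductive Expr where
  | const (n : ℕ)
  | reg (r : ℕ)
  | load (a : ℕ) (i : Expr)
  | bin (o : BinOp) (x y : Expr)

/-- The number of nodes of an expression, which is the time needed to evaluate it. -/
def Expr.size : Expr → ℕ
  | .const _ => 1
  | .reg _ => 1
  | .load _ i => i.size + 1
  | .bin _ x y => x.size + y.size + 1

/-- Machine states: the registers, the arrays, the number of random words drawn so far, and the
sequence of words output so far. -/
structure State where
  reg : ℕ → ℕ
  mem : ℕ → ℕ → ℕ
  drawn : ℕ
  out : List ℕ

/-- Value of an expression in a state. -/
def Expr.eval (w : ℕ) (s : State) : Expr → ℕ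
  | .const n => n % 2 ^ w
  | .reg r => s.reg r
  | .load a i => s.mem a (i.eval w s)
  | .bin o x y => o.eval w (x.eval w s) (y.eval w s)

/-- Programs. -/
inductive Prog where
  | skip
  /-- `r := e` -/
  | assign (r : ℕ) (e : Expr)
  /-- `a[i] := e` -/
  | store (a : ℕ) (i e : Expr)
  /-- put a fresh uniformly random word into register `r` -/
  | rand (r : ℕ)
  /-- append the value of `e` to the output -/
  | out (e : Expr)
  | seq (p q : Prog)
  /-- run `p` if `e` is nonzero, and `q` otherwise -/
  | ite (e : Expr) (p q : Prog)
  /-- run `p` as long as `e` is nonzero -/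
  | loop (e : Expr) (p : Prog)

/-- `Exec w ω p s s' t`: on words of `w` bits and with the sequence of random words `ω`, the
program `p` started in the state `s` halts in the state `s'` after exactly `t` time units. -/
inductive Exec (w : ℕ) (ω : ℕ → Fin (2 ^ w)) : Prog → State → State → ℕ → Prop where
  | skip (s : State) : Exec w ω .skip s s 1
  | assign (r : ℕ) (e : Expr) (s : State) :
      Exec w ω (.assign r e) s
        { s with reg := Function.update s.reg r (e.eval w s) } (e.size + 1)
  | store (a : ℕ) (i e : Expr) (s : State) :
      Exec w ω (.store a i e) s
        { s with mem := Function.update s.mem a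
                  (Function.update (s.mem a) (i.eval w s) (e.eval w s)) }
        (i.size + e.size + 1)
  | rand (r : ℕ) (s : State) :
      Exec w ω (.rand r) s
        { s with reg := Function.update s.reg r (ω s.drawn : ℕ), drawn := s.drawn + 1 } 1
  | out (e : Expr) (s : State) :
      Exec w ω (.out e) s { s with out := s.out ++ [e.eval w s] } (e.size + 1)
  | seq {p q : Prog} {s₁ s₂ s₃ : State} {t₁ t₂ : ℕ} :
      Exec w ω p s₁ s₂ t₁ → Exec w ω q s₂ s₃ t₂ → Exec w ω (.seq p q) s₁ s₃ (t₁ + t₂)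
  | iteTrue {e : Expr} {p q : Prog} {s s' : State} {t : ℕ} :
      e.eval w s ≠ 0 → Exec w ω p s s' t → Exec w ω (.ite e p q) s s' (e.size + 1 + t)
  | iteFalse {e : Expr} {p q : Prog} {s s' : State} {t : ℕ} :
      e.eval w s = 0 → Exec w ω q s s' t → Exec w ω (.ite e p q) s s' (e.size + 1 + t)
  | loopTrue {e : Expr} {p : Prog} {s₁ s₂ s₃ : State} {t₁ t₂ : ℕ} :
      e.eval w s₁ ≠ 0 → Exec w ω p s₁ s₂ t₁ → Exec w ω (.loop e p) s₂ s₃ t₂ →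
      Exec w ω (.loop e p) s₁ s₃ (e.size + 1 + t₁ + t₂)
  | loopFalse {e : Expr} {p : Prog} {s : State} :
      e.eval w s = 0 → Exec w ω (.loop e p) s s (e.size + 1)

/-- Execution is deterministic once the random words are fixed. -/
theorem Exec.deterministic {w : ℕ} {ω : ℕ → Fin (2 ^ w)} {p : Prog} {s s₁ : State} {t₁ : ℕ}
    (h : Exec w ω p s s₁ t₁) :
    ∀ {s₂ : State} {t₂ : ℕ}, Exec w ω p s s₂ t₂ → s₁ = s₂ ∧ t₁ = t₂ := by
  induction h with
  | skip | assign | store | rand | out =>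
    intro s₂ t₂ h'
    cases h'
    exact ⟨rfl, rfl⟩
  | seq _ _ ih₁ ih₂ =>
    intro s₂ t₂ h'
    cases h' with
    | seq h₁ h₂ =>
      obtain ⟨rfl, rfl⟩ := ih₁ h₁
      obtain ⟨rfl, rfl⟩ := ih₂ h₂
      exact ⟨rfl, rfl⟩
  | iteTrue he _ ih =>
    intro s₂ t₂ h'
    cases h' with
    | iteTrue _ h₁ =>
      obtain ⟨rfl, rfl⟩ := ih h₁
      exact ⟨rfl, rfl⟩
    | iteFalse he' _ => exact absurd he' he
  | iteFalse he _ ih =>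
    intro s₂ t₂ h'
    cases h' with
    | iteTrue he' _ => exact absurd he he'
    | iteFalse _ h₁ =>
      obtain ⟨rfl, rfl⟩ := ih h₁
      exact ⟨rfl, rfl⟩
  | loopTrue he _ _ ih₁ ih₂ =>
    intro s₂ t₂ h'
    cases h' with
    | loopTrue _ h₁ h₂ =>
      obtain ⟨rfl, rfl⟩ := ih₁ h₁
      obtain ⟨rfl, rfl⟩ := ih₂ h₂
      exact ⟨rfl, rfl⟩
    | loopFalse he' => exact absurd he' he
  | loopFalse he =>
    intro s₂ t₂ h'
    cases h' with
    | loopTrue he' _ _ => exact absurd he he'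
    | loopFalse _ => exact ⟨rfl, rfl⟩

/-- The law of a sequence of independent uniformly random words of `w` bits. -/
noncomputable def coins (w : ℕ) : Measure (ℕ → Fin (2 ^ w)) :=
  Measure.infinitePi fun _ : ℕ => (PMF.uniformOfFintype (Fin (2 ^ w))).toMeasure

end WordRAM

/-! ### Dynamic subset sum with offline access -/

namespace DynSubsetSum

/-- An operation: insert an item of a given weight, or ask whether some subset of the items
present has total weight equal to a given target. -/
inductive Op where
  | insert (weight : ℕ)
  | query (target : ℕ)

/-- The number carried by an operation. -/
def Op.value : Op → ℕ
  | .insert x => x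
  | .query t => t

/-- `0` for an insertion, `1` for a query. -/
def Op.kind : Op → ℕ
  | .insert _ => 0
  | .query _ => 1

open Classical in
/-- The correct answers (`1` for yes, `0` for no) to the queries of a sequence of operations, in
their order, when the multiset of weights of the items already present is `W`. -/
noncomputable def answersFrom : Multiset ℕ → List Op → List ℕ
  | _, [] => []
  | W, .insert x :: ops => answersFrom (x ::ₘ W) ops
  | W, .query t :: ops => (if ∃ S ≤ W, S.sum = t then 1 else 0) :: answersFrom W ops

/-- The correct answers to the queries when there are no items at the beginning. -/
noncomputable def answers (ops : List Op) : List ℕ :=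
  answersFrom 0 ops

/-- Offline access: the whole sequence of operations is in the memory at the start.  Register `0`
holds `tmax`, register `1` holds the number of operations, cell `i` of the arrays `0` and `1` holds
the kind and the number of the operation with index `i` (counted from `0`); everything else
is `0`. -/
def input (tmax : ℕ) (ops : List Op) : WordRAM.State where
  reg r := if r = 0 then tmax else if r = 1 then ops.length else 0
  mem a i :=
    if a = 0 then (ops[i]?.map Op.kind).getD 0
    else if a = 1 then (ops[i]?.map Op.value).getD 0
    else 0
  drawn := 0
  out := []

end DynSubsetSum

/-! Write `T` for `tmax`, `n` for the number of operations, and `l` for the least exponent with `T +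
n + 2 ≤ 2 ^ l`.

Reduction. A sum of value at most `T` uses at most `T / x` items of weight `x > 0`, so further
copies are discarded, as are items of weight `0` or above `T`. The number `m` of kept items is at
most `n`, and by a harmonic sum at most `l * T` (`length_kept_le_mul`). For `t ≤ T` let `f t` be the
least number of kept items, in order of insertion, that make `t` attainable. A query for `t` is
answered by comparing `f t` with the number of items kept so far (`IsFirst.answer`), so it suffices
to compute `f`.

Square root decomposition. The kept items are cut into at most `b` blocks of length `b ≈ √m`. For
each prefix made of whole blocks, a static solver finds all sums up to `T` in time `Õ(T)`; this
tells in which block `f t` lies. Then `t` runs upwards and only the `b` items of that block are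
scanned: the item of index `J` and weight `x` makes `t` attainable exactly if `f (t - x) ≤ J`, and
`f (t - x)` is already known because `x ≥ 1`. The total is `Õ(T * √m)`, which gives the bound with
`min (√n) (√T)`.

Static solver. Over `ZMod p`, with `p > T` prime, let `P` be the product of the factors `∑ j ≤ c, r
^ j * X ^ (x * j)` over the weights `x` with multiplicities `c` and random markers `r`. The
coefficient of `X ^ t` is a polynomial of degree at most `t` in the markers. It is the zero
polynomial exactly if `t` is not attainable, since different ways give different monomials; so
errors are one-sided, and by Schwartz–Zippel an attainable sum is missed with probability at most
`1/2` (`card_roots_le`). Repeating `(d + 2) * l` times with fresh words makes all runs succeed with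
the required probability (`le_coins_of_allFound`).

Computing `P`. From `X * P' = P * G`, where `G` is `X` times the logarithmic derivative, follows `t
* P t = ∑ a < t, P a * G (t - a)` (`gen_recurrence`). The coefficients of `G` cost a harmonic sum.
The recurrence is an online convolution: in round `t`, with `L` the lowest set bit of `t`, the
contributions of the last `L` coefficients to the next `L` sums are added by one multiplication of
length `O(L)` (`Partial.step`), and the lowest bits sum to `O(T * l)`.

Multiplication. `ZMod p` need not contain roots of unity, so products modulo `X ^ (2 ^ k) + 1` use
the Schönhage–Nussbaumer recursion: a polynomial is cut into about the square root of its length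
many pieces, the pieces are read in a ring in which the variable itself is a root of unity, and a
Fourier transform there needs only rotations and additions (`blk_combine`). Halving `2` is possible
since `p` is odd.

Every subprogram is specified by a state predicate and a time bound that hold for all random words;
only the final correctness claim is conditional on the event `AllFound`. -/

namespace WordRAM

/-! ### Notation for expressions and programs -/

instance (n : ℕ) : OfNat Expr n := ⟨.const n⟩
instance : Add Expr := ⟨.bin .add⟩
instance : Sub Expr := ⟨.bin .sub⟩
instance : Mul Expr := ⟨.bin .mul⟩
instance : Div Expr := ⟨.bin .div⟩
instance : Mod Expr := ⟨.bin .mod⟩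

infixr:60 " ;; " => Prog.seq

/-- Change of one register. -/
def State.setR (s : State) (r v : ℕ) : State :=
  { s with reg := Function.update s.reg r v }

/-- Change of one memory cell. -/
def State.setM (s : State) (a i v : ℕ) : State :=
  { s with mem := Function.update s.mem a (Function.update (s.mem a) i v) }

section simp_lemmas
variable (w : ℕ) (s : State) (x y : Expr) (n r r' v a i a' : ℕ)

@[simp] theorem eval_lit : Expr.eval w s (no_index (OfNat.ofNat n : Expr)) = n % 2 ^ w := rfl
@[simp] theorem eval_const : Expr.eval w s (.const n) = n % 2 ^ w := rfl
@[simp] theorem eval_reg : Expr.eval w s (.reg r) = s.reg r := rfl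
@[simp] theorem eval_load : Expr.eval w s (.load a x) = s.mem a (x.eval w s) := rfl
@[simp] theorem eval_add : Expr.eval w s (x + y) = (x.eval w s + y.eval w s) % 2 ^ w := rfl
@[simp] theorem eval_sub : Expr.eval w s (x - y) = x.eval w s - y.eval w s := rfl
@[simp] theorem eval_mul : Expr.eval w s (x * y) = (x.eval w s * y.eval w s) % 2 ^ w := rfl
@[simp] theorem eval_div : Expr.eval w s (x / y) = x.eval w s / y.eval w s := rfl
@[simp] theorem eval_mod : Expr.eval w s (x % y) = x.eval w s % y.eval w s := rfl
@[simp] theorem eval_lt :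
    Expr.eval w s (.bin .lt x y) = if x.eval w s < y.eval w s then 1 else 0 := rfl
@[simp] theorem eval_eq :
    Expr.eval w s (.bin .eq x y) = if x.eval w s = y.eval w s then 1 else 0 := rfl
@[simp] theorem eval_shl :
    Expr.eval w s (.bin .shl x y) = (x.eval w s <<< y.eval w s) % 2 ^ w := rfl
@[simp] theorem eval_shr :
    Expr.eval w s (.bin .shr x y) = x.eval w s >>> y.eval w s := rfl

@[simp] theorem size_lit : Expr.size (no_index (OfNat.ofNat n : Expr)) = 1 := rfl
@[simp] theorem size_const : Expr.size (.const n) = 1 := rfl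
@[simp] theorem size_reg : Expr.size (.reg r) = 1 := rfl
@[simp] theorem size_load : Expr.size (.load a x) = x.size + 1 := rfl
@[simp] theorem size_add : Expr.size (x + y) = x.size + y.size + 1 := rfl
@[simp] theorem size_sub : Expr.size (x - y) = x.size + y.size + 1 := rfl
@[simp] theorem size_mul : Expr.size (x * y) = x.size + y.size + 1 := rfl
@[simp] theorem size_div : Expr.size (x / y) = x.size + y.size + 1 := rfl
@[simp] theorem size_mod : Expr.size (x % y) = x.size + y.size + 1 := rfl
@[simp] theorem size_bin (o : BinOp) : Expr.size (.bin o x y) = x.size + y.size + 1 := rfl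

@[simp] theorem reg_setR : (s.setR r v).reg r' = if r' = r then v else s.reg r' := by
  simp [State.setR, Function.update_apply]
@[simp] theorem mem_setR : (s.setR r v).mem = s.mem := rfl
@[simp] theorem drawn_setR : (s.setR r v).drawn = s.drawn := rfl
@[simp] theorem out_setR : (s.setR r v).out = s.out := rfl
@[simp] theorem reg_setM : (s.setM a i v).reg = s.reg := rfl
theorem mem_setM :
    (s.setM a i v).mem a' = if a' = a then Function.update (s.mem a) i v else s.mem a' := by
  simp only [State.setM, Function.update_apply]
@[simp] theorem mem_setM_self : (s.setM a i v).mem a = Function.update (s.mem a) i v := by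
  simp [mem_setM]
theorem mem_setM_of_ne (h : a' ≠ a) : (s.setM a i v).mem a' = s.mem a' := by
  simp [mem_setM, h]

end simp_lemmas

theorem mod_word {a w : ℕ} (h : a < 2 ^ w) : a % 2 ^ w = a := Nat.mod_eq_of_lt h

/-! ### What a program leaves unchanged -/

/-- Does the program assign to the register `x`? -/
def Prog.wr : Prog → ℕ → Bool
  | .assign r _, x => r == x
  | .rand r, x => r == x
  | .seq p q, x => p.wr x || q.wr x
  | .ite _ p q, x => p.wr x || q.wr x
  | .loop _ p, x => p.wr x
  | _, _ => false

/-- Does the program store into the array `x`? -/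
def Prog.wm : Prog → ℕ → Bool
  | .store a _ _, x => a == x
  | .seq p q, x => p.wm x || q.wm x
  | .ite _ p q, x => p.wm x || q.wm x
  | .loop _ p, x => p.wm x
  | _, _ => false

/-- Does the program draw random words? -/
def Prog.dr : Prog → Bool
  | .rand _ => true
  | .seq p q => p.dr || q.dr
  | .ite _ p q => p.dr || q.dr
  | .loop _ p => p.dr
  | _ => false

/-- Does the program output anything? -/
def Prog.ou : Prog → Bool
  | .out _ => true
  | .seq p q => p.ou || q.ou
  | .ite _ p q => p.ou || q.ou
  | .loop _ p => p.ou
  | _ => false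

/-- The states `s` and `s'` agree on everything that `P` does not touch. -/
structure Same (P : Prog) (s s' : State) : Prop where
  reg : ∀ r, P.wr r = false → s'.reg r = s.reg r
  mem : ∀ a, P.wm a = false → s'.mem a = s.mem a
  drawn : P.dr = false → s'.drawn = s.drawn
  out : P.ou = false → s'.out = s.out

theorem Same.refl (P : Prog) (s : State) : Same P s s :=
  ⟨fun _ _ => rfl, fun _ _ => rfl, fun _ => rfl, fun _ => rfl⟩

theorem Same.trans {P : Prog} {s s' s'' : State} (h : Same P s s') (h' : Same P s' s'') :
    Same P s s'' :=
  ⟨fun r hr => (h'.reg r hr).trans (h.reg r hr), fun r hr => (h'.mem r hr).trans (h.mem r hr),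
    fun hr => (h'.drawn hr).trans (h.drawn hr), fun hr => (h'.out hr).trans (h.out hr)⟩

theorem Same.mono {P Q : Prog} {s s' : State} (h : Same P s s')
    (h1 : ∀ r, Q.wr r = false → P.wr r = false) (h2 : ∀ r, Q.wm r = false → P.wm r = false)
    (h3 : Q.dr = false → P.dr = false) (h4 : Q.ou = false → P.ou = false) : Same Q s s' :=
  ⟨fun r hr => h.reg r (h1 r hr), fun r hr => h.mem r (h2 r hr), fun hr => h.drawn (h3 hr),
    fun hr => h.out (h4 hr)⟩

theorem Same.left {P Q : Prog} {s s' : State} (h : Same P s s') : Same (P ;; Q) s s' := by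
  refine h.mono ?_ ?_ ?_ ?_ <;> simp +contextual [Prog.wr, Prog.wm, Prog.dr, Prog.ou]

theorem Same.right {P Q : Prog} {s s' : State} (h : Same Q s s') : Same (P ;; Q) s s' := by
  refine h.mono ?_ ?_ ?_ ?_ <;> simp +contextual [Prog.wr, Prog.wm, Prog.dr, Prog.ou]

theorem Same.loop {e : Expr} {P : Prog} {s s' : State} (h : Same P s s') :
    Same (.loop e P) s s' := by
  refine h.mono ?_ ?_ ?_ ?_ <;> simp +contextual [Prog.wr, Prog.wm, Prog.dr, Prog.ou]

theorem Same.assign (s : State) (r v : ℕ) (e : Expr) : Same (.assign r e) s (s.setR r v) := by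
  refine ⟨fun x hx => ?_, fun _ _ => rfl, fun _ => rfl, fun _ => rfl⟩
  have : x ≠ r := by rintro rfl; simp [Prog.wr] at hx
  simp [this]

/-- This is the frame rule. The footprint functions are Boolean and computable, so for a concrete
program each use of it has a side condition that holds by `rfl`. -/
theorem Exec.same {w : ℕ} {ω : ℕ → Fin (2 ^ w)} {P : Prog} {s s' : State} {t : ℕ}
    (h : Exec w ω P s s' t) : Same P s s' := by
  induction h with
  | skip s => exact Same.refl _ _
  | assign r e s => exact Same.assign s r _ e
  | store a i e s =>
    refine ⟨fun _ _ => rfl, fun x hx => ?_, fun _ => rfl, fun _ => rfl⟩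
    have : x ≠ a := by rintro rfl; simp [Prog.wm] at hx
    simp [this]
  | rand r s =>
    refine ⟨fun x hx => ?_, fun _ _ => rfl, fun h => ?_, fun _ => rfl⟩
    · have : x ≠ r := by rintro rfl; simp [Prog.wr] at hx
      simp [this]
    · simp [Prog.dr] at h
  | out e s =>
    refine ⟨fun _ _ => rfl, fun x hx => rfl, fun _ => rfl, fun h => ?_⟩
    simp [Prog.ou] at h
  | seq _ _ h1 h2 => exact h1.left.trans h2.right
  | iteTrue _ _ h1 =>
    refine h1.mono ?_ ?_ ?_ ?_ <;> simp +contextual [Prog.wr, Prog.wm, Prog.dr, Prog.ou]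
  | iteFalse _ _ h1 =>
    refine h1.mono ?_ ?_ ?_ ?_ <;> simp +contextual [Prog.wr, Prog.wm, Prog.dr, Prog.ou]
  | loopTrue _ _ _ h1 h2 => exact h1.loop.trans h2
  | loopFalse _ => exact Same.refl _ _

/-! ### Total correctness with a clock -/

/-- Started in `s` when the clock shows `t`, the program halts, and `Q` holds of the final state
and the final clock. -/
def WP (w : ℕ) (ω : ℕ → Fin (2 ^ w)) (P : Prog) (s : State) (t : ℕ) (Q : State → ℕ → Prop) :
    Prop :=
  ∃ s' t', Exec w ω P s s' t' ∧ Q s' (t + t')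

/-- Started in `s`, the program halts within time `B` in a state that satisfies `Q`. -/
def Runs (w : ℕ) (ω : ℕ → Fin (2 ^ w)) (P : Prog) (s : State) (B : ℕ) (Q : State → Prop) : Prop :=
  WP w ω P s 0 fun s' t => t ≤ B ∧ Q s'

section rules
variable {w : ℕ} {ω : ℕ → Fin (2 ^ w)} {P P' : Prog} {s : State} {t B : ℕ}
  {Q : State → ℕ → Prop} {R : State → Prop}

theorem WP.seq (h : WP w ω P s t fun s' t' => WP w ω P' s' t' Q) : WP w ω (P ;; P') s t Q := by
  obtain ⟨s1, t1, h1, s2, t2, h2, h3⟩ := h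
  exact ⟨s2, t1 + t2, .seq h1 h2, by rwa [← add_assoc]⟩

theorem WP.skip (h : Q s (t + 1)) : WP w ω .skip s t Q := ⟨s, 1, .skip s, h⟩

theorem WP.assign {r : ℕ} {e : Expr} (v : ℕ) (he : e.eval w s = v)
    (h : Q (s.setR r v) (t + (e.size + 1))) : WP w ω (.assign r e) s t Q := by
  subst he
  exact ⟨_, _, .assign r e s, h⟩

theorem WP.store {a : ℕ} {i e : Expr} (x v : ℕ) (hi : i.eval w s = x) (he : e.eval w s = v)
    (h : Q (s.setM a x v) (t + (i.size + e.size + 1))) : WP w ω (.store a i e) s t Q := by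
  subst he hi
  exact ⟨_, _, .store a i e s, h⟩

theorem WP.rand {r : ℕ}
    (h : Q { s.setR r (ω s.drawn) with drawn := s.drawn + 1 } (t + 1)) :
    WP w ω (.rand r) s t Q :=
  ⟨_, _, .rand r s, h⟩

theorem WP.out {e : Expr} (v : ℕ) (he : e.eval w s = v)
    (h : Q { s with out := s.out ++ [v] } (t + (e.size + 1))) : WP w ω (.out e) s t Q := by
  subst he
  exact ⟨_, _, .out e s, h⟩

theorem WP.ite {e : Expr} (c : Prop) [Decidable c] (he : e.eval w s = if c then 1 else 0)
    (h1 : c → WP w ω P s (t + (e.size + 1)) Q) (h2 : ¬ c → WP w ω P' s (t + (e.size + 1)) Q) :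
    WP w ω (.ite e P P') s t Q := by
  by_cases hc : c
  · obtain ⟨s1, t1, h, hQ⟩ := h1 hc
    exact ⟨s1, _, .iteTrue (by simp [he, hc]) h, by rwa [← add_assoc]⟩
  · obtain ⟨s1, t1, h, hQ⟩ := h2 hc
    exact ⟨s1, _, .iteFalse (by simp [he, hc]) h, by rwa [← add_assoc]⟩

/-- Both branches store the same mathematical value, so the continuation is proved once, for any
clock up to the larger cost. -/
theorem WP.ite_assign {e x y : Expr} {r : ℕ} (c : Prop) [Decidable c] (v : ℕ)
    (he : e.eval w s = if c then 1 else 0) (h1 : c → x.eval w s = v) (h2 : ¬ c → y.eval w s = v)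
    (h : ∀ t' ≤ t + (e.size + x.size + y.size + 2), Q (s.setR r v) t') :
    WP w ω (.ite e (.assign r x) (.assign r y)) s t Q :=
  WP.ite c he (fun hc => WP.assign v (h1 hc) (h _ (by omega)))
    (fun hc => WP.assign v (h2 hc) (h _ (by omega)))

theorem WP.ite_store {e i x y : Expr} {a : ℕ} (c : Prop) [Decidable c] (u v : ℕ)
    (he : e.eval w s = if c then 1 else 0) (hi : i.eval w s = u) (h1 : c → x.eval w s = v)
    (h2 : ¬ c → y.eval w s = v)
    (h : ∀ t' ≤ t + (e.size + i.size + x.size + y.size + 2), Q (s.setM a u v) t') :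
    WP w ω (.ite e (.store a i x) (.store a i y)) s t Q :=
  WP.ite c he (fun hc => WP.store u v hi (h1 hc) (h _ (by omega)))
    (fun hc => WP.store u v hi (h2 hc) (h _ (by omega)))

/-- A caller forgets how the subprogram ran: it keeps the time bound, the frame and the
postcondition. -/
theorem WP.call (h : Runs w ω P s B R)
    (hQ : ∀ s' t', t' ≤ t + B → Same P s s' → R s' → Q s' t') : WP w ω P s t Q := by
  obtain ⟨s1, t1, h, h1, h2⟩ := h
  exact ⟨s1, t1, h, hQ _ _ (by omega) h.same h2⟩

theorem WP.mono {Q' : State → ℕ → Prop} (h : WP w ω P s t Q)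
    (hQ : ∀ s' t', Same P s s' → Q s' t' → Q' s' t') : WP w ω P s t Q' := by
  obtain ⟨s1, t1, h, h1⟩ := h
  exact ⟨s1, t1, h, hQ _ _ h.same h1⟩

theorem Runs.mono {B' : ℕ} {R' : State → Prop} (h : Runs w ω P s B R) (hB : B ≤ B')
    (hQ : ∀ s', Same P s s' → R s' → R' s') : Runs w ω P s B' R' :=
  WP.mono h fun s' _ hs h => ⟨h.1.trans hB, hQ s' hs h.2⟩

theorem Runs.seq {B' : ℕ} {R' : State → Prop} (h : Runs w ω P s B R)
    (h' : ∀ s', Same P s s' → R s' → Runs w ω P' s' B' R') :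
    Runs w ω (P ;; P') s (B + B') R' := by
  refine WP.seq (WP.call h fun s' t' ht hs hR => WP.call (h' s' hs hR) fun s'' t'' ht' _ h => ?_)
  exact ⟨by omega, h⟩

end rules

/-! ### Counting loops -/

/-- Run `body` with the register `i` equal to `0, 1, …, n - 1`, for the number `n` in the
register `b`. -/
def forUp (i b : ℕ) (body : Prog) : Prog :=
  .assign i 0 ;;
    .loop (.bin .lt (.reg i) (.reg b)) (body ;; .assign i (.reg i + 1))

theorem Same.forUp {i b : ℕ} {body : Prog} {s s' : State} (h : Same body s s') :
    Same (forUp i b body) s s' := h.left.loop.right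

theorem Same.forUp_setR {i b v : ℕ} {body : Prog} {s : State} :
    Same (WordRAM.forUp i b body) s (s.setR i v) := (Same.assign s i v 0).left

/-- The invariant is stated for the state after the counter has been advanced. Each iteration pays
`8` for the test and the increment; the constant `6` covers the initialization and the last test. -/
theorem runs_forUp {w : ℕ} {ω : ℕ → Fin (2 ^ w)} {i b : ℕ} {body : Prog} {s : State}
    (n : ℕ) (I : ℕ → State → Prop) (c : ℕ → ℕ)
    (hi : body.wr i = false) (hb : (forUp i b body).wr b = false)
    (hn : s.reg b = n) (hw : n < 2 ^ w) (h0 : I 0 (s.setR i 0))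
    (hs : ∀ j s', j < n → s'.reg i = j → Same (forUp i b body) s s' → I j s' →
      Runs w ω body s' (c j) fun s'' => I (j + 1) (s''.setR i (j + 1))) :
    Runs w ω (forUp i b body) s (∑ j ∈ Finset.range n, c j + 8 * n + 6) (I n) := by
  have hib : i ≠ b := by
    rintro rfl
    simp [forUp, Prog.wr] at hb
  -- Induction on the number `k` of iterations that remain, because the loop rule peels off the
  -- first one.
  have key : ∀ k s', k ≤ n → s'.reg i = n - k → Same (forUp i b body) s s' → I (n - k) s' →
      Runs w ω (.loop (.bin .lt (.reg i) (.reg b)) (body ;; .assign i (.reg i + 1))) s'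
        (∑ j ∈ Finset.Ico (n - k) n, c j + 8 * k + 4) (I n) := by
    intro k
    induction k with
    | zero =>
      intro s' _ h1 h2 h3
      have hb' := (h2.reg b hb).trans hn
      exact ⟨s', _, .loopFalse (by simp [h1, hb']), by simp, by simpa using h3⟩
    | succ k ih =>
      intro s' hk h1 h2 h3
      have hb' := (h2.reg b hb).trans hn
      obtain ⟨s1, t1, e1, ht1, hI⟩ := hs (n - (k + 1)) s' (by omega) h1 h2 h3
      have hi1 : s1.reg i = n - (k + 1) := (e1.same.reg i hi).trans h1
      have hnk : n - (k + 1) + 1 = n - k := by omega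
      rw [hnk] at hI
      have e2 : Exec w ω (.assign i (.reg i + 1)) s1 (s1.setR i (n - k)) 4 := by
        have := Exec.assign (ω := ω) i (.reg i + 1) s1
        rwa [eval_add, eval_reg, eval_lit, hi1, mod_word (show 1 < 2 ^ w by omega), hnk,
          mod_word (by omega)] at this
      obtain ⟨s2, t2, e3, ht2, hI2⟩ := ih (s1.setR i (n - k)) (by omega) (by simp)
        ((h2.trans e1.same.forUp).trans Same.forUp_setR) hI
      refine ⟨s2, _, .loopTrue ?_ (.seq e1 e2) e3, ?_, hI2⟩
      · simp only [eval_lt, eval_reg, h1, hb']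
        rw [if_pos (by omega)]
        exact one_ne_zero
      · rw [Finset.sum_eq_sum_Ico_succ_bot (show n - (k + 1) < n by omega), hnk]
        simp only [size_bin, size_reg]
        omega
  refine WP.seq (WP.assign 0 (by simp) ?_)
  refine WP.call (key n (s.setR i 0) le_rfl (by simp) Same.forUp_setR (by simpa using h0))
    fun s' t' ht _ hI => ⟨?_, hI⟩
  simp at ht
  omega

/-- A counting loop with a uniform bound for the time of its body. -/
theorem runs_forUp_const {w : ℕ} {ω : ℕ → Fin (2 ^ w)} {i b : ℕ} {body : Prog} {s : State}
    (n : ℕ) (I : ℕ → State → Prop) (c : ℕ)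
    (hi : body.wr i = false) (hb : (forUp i b body).wr b = false)
    (hn : s.reg b = n) (hw : n < 2 ^ w) (h0 : I 0 (s.setR i 0))
    (hs : ∀ j s', j < n → s'.reg i = j → Same (forUp i b body) s s' → I j s' →
      Runs w ω body s' c fun s'' => I (j + 1) (s''.setR i (j + 1))) :
    Runs w ω (forUp i b body) s (n * (c + 8) + 6) (I n) := by
  refine (runs_forUp n I (fun _ => c) hi hb hn hw h0 hs).mono (le_of_eq ?_) fun _ _ h => h
  simp
  ring

/-- A counting loop whose body computes one cell of the array `o`. -/
theorem runs_map {w : ℕ} {ω : ℕ → Fin (2 ^ w)} {i b : ℕ} {body : Prog} {s : State}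
    (o n : ℕ) (val : ℕ → ℕ) (c : ℕ)
    (hi : body.wr i = false) (hb : (forUp i b body).wr b = false)
    (hn : s.reg b = n) (hw : n < 2 ^ w)
    (hs : ∀ j s', j < n → s'.reg i = j → Same (forUp i b body) s s' →
      Runs w ω body s' c fun s'' => s''.mem o = Function.update (s'.mem o) j (val j)) :
    Runs w ω (forUp i b body) s (n * (c + 8) + 6)
      fun s' => s'.mem o = fun j => if j < n then val j else s.mem o j := by
  refine runs_forUp_const n (fun k s' => s'.mem o = fun j => if j < k then val j else s.mem o j) c
    hi hb hn hw (by simp) fun j s' hj hji hS hI => ?_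
  refine (hs j s' hj hji hS).mono le_rfl fun s'' _ h => ?_
  simp only [mem_setR, h, hI]
  ext x
  rcases lt_trichotomy x j with h | h | h
  · simp [h.ne, h, h.trans (Nat.lt_succ_self j)]
  · simp [h]
  · have h2 : ¬ x < j + 1 := by omega
    simp [h.ne', h.not_gt, h2]

end WordRAM


/-! ### Negacyclic convolution -/

namespace Negacyclic

open Polynomial Finset

section CommRing
variable {R : Type*} [CommRing R]

/-- The coefficients of `X ^ e * ∑ b c * X ^ c` modulo `X ^ n + 1`. -/
def rot (n e : ℕ) (b : ℕ → R) (c : ℕ) : R :=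
  if e ≤ c then b (c - e) else -b (n + c - e)

/-- The coefficients of the product modulo `X ^ n + 1`. -/
def nega (n : ℕ) (f g : ℕ → R) (k : ℕ) : R :=
  ∑ a ∈ range n, f a * rot n a g k

/-- The coefficients that wrap around change sign, which is what `θ ^ n = -1` does to their powers.
-/
theorem sum_rot {n e : ℕ} (he : e ≤ n) (b : ℕ → R) {θ : R} (hθ : θ ^ n = -1) :
    ∑ k ∈ range n, rot n e b k * θ ^ k = θ ^ e * ∑ k ∈ range n, b k * θ ^ k := by
  obtain ⟨d, rfl⟩ := Nat.exists_eq_add_of_le he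
  rw [sum_range_add, add_comm e d, sum_range_add (fun k => b k * θ ^ k), mul_add, add_comm]
  congr 1
  · rw [mul_sum]
    refine sum_congr rfl fun k _ => ?_
    simp [rot, pow_add]
    ring
  · rw [mul_sum]
    refine sum_congr rfl fun k hk => ?_
    have hk' := mem_range.1 hk
    have h1 : d + e + k - e = d + k := by omega
    have h2 : θ ^ e * (b (d + k) * θ ^ (d + k)) = b (d + k) * (θ ^ (e + d) * θ ^ k) := by ring
    rw [rot, if_neg (by omega), h1, h2, hθ]
    ring

/-- Evaluation at a root of `X ^ n + 1` is multiplicative. This serves twice: for the pointwise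
products of the transform, and to recognize products in the quotient ring itself, where the class of
`X` is such a root. -/
theorem sum_nega {n : ℕ} (f g : ℕ → R) {θ : R} (hθ : θ ^ n = -1) :
    ∑ k ∈ range n, nega n f g k * θ ^ k =
      (∑ k ∈ range n, f k * θ ^ k) * ∑ k ∈ range n, g k * θ ^ k := by
  simp only [nega, sum_mul]
  rw [sum_comm]
  refine sum_congr rfl fun a ha => ?_
  have := sum_rot (mem_range.1 ha).le g hθ
  simp only [mul_assoc]
  rw [← mul_sum, this]

theorem map_nega {S : Type*} [CommRing S] (φ : R →+* S) (n : ℕ) (f g : ℕ → R) (k : ℕ) :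
    φ (nega n f g k) = nega n (fun a => φ (f a)) (fun a => φ (g a)) k := by
  simp only [nega, map_sum, map_mul]
  refine sum_congr rfl fun a _ => ?_
  simp only [rot]
  split_ifs <;> simp

theorem sum_range_two_mul {M : Type*} [AddCommMonoid M] (D : ℕ) (f : ℕ → M) :
    ∑ r ∈ range (2 * D), f r = ∑ r ∈ range D, (f (2 * r) + f (2 * r + 1)) := by
  induction D with
  | zero => simp
  | succ D ih => rw [sum_range_succ, ← ih, Nat.mul_succ, sum_range_succ, sum_range_succ, add_assoc]

/-- One pass of the transform on positions below `l`, with `D` roots before it. -/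
def pass (l D : ℕ) (z : ℕ → R) (V : ℕ → R) (pos : ℕ) : R :=
  if pos / D % 2 = 0 then
    V (pos / (2 * D) * D + pos % D) + z (pos % D) * V (pos / (2 * D) * D + pos % D + l / 2)
  else V (pos / (2 * D) * D + pos % D) - z (pos % D) * V (pos / (2 * D) * D + pos % D + l / 2)

theorem pass_even {l D i j : ℕ} (z V : ℕ → R) (hj : j < D) :
    pass l D z V (2 * i * D + j) = V (i * D + j) + z j * V (i * D + j + l / 2) := by
  have h1 : (2 * i * D + j) / D = 2 * i := by
    rw [mul_comm, Nat.mul_add_div (by omega), Nat.div_eq_of_lt hj, add_zero]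
  have h2 : (2 * i * D + j) / (2 * D) = i := by
    rw [mul_comm 2 D, ← Nat.div_div_eq_div_mul, h1]; omega
  have h3 : (2 * i * D + j) % D = j := by
    rw [Nat.mul_add_mod_of_lt hj]
  simp [pass, h1, h2, h3]

theorem pass_odd {l D i j : ℕ} (z V : ℕ → R) (hj : j < D) :
    pass l D z V ((2 * i + 1) * D + j) = V (i * D + j) - z j * V (i * D + j + l / 2) := by
  have h1 : ((2 * i + 1) * D + j) / D = 2 * i + 1 := by
    rw [mul_comm, Nat.mul_add_div (by omega), Nat.div_eq_of_lt hj, add_zero]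
  have h2 : ((2 * i + 1) * D + j) / (2 * D) = i := by
    rw [mul_comm 2 D, ← Nat.div_div_eq_div_mul, h1]; omega
  have h3 : ((2 * i + 1) * D + j) % D = j := by
    rw [Nat.mul_add_mod_of_lt hj]
  have h4 : (2 * i + 1) % 2 = 1 := by omega
  simp [pass, h1, h2, h3, h4]

/-- The inverse of a pass. -/
def ipass (l D : ℕ) (half : R) (z' : ℕ → R) (W : ℕ → R) (pos : ℕ) : R :=
  let q := pos % (l / 2)
  if pos < l / 2 then
    half * (W (2 * (q / D) * D + q % D) + W ((2 * (q / D) + 1) * D + q % D))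
  else half * (z' (q % D) * (W ((2 * (q / D) + 1) * D + q % D) - W (2 * (q / D) * D + q % D)))

/-- The sum and the difference of the two outputs of a butterfly are `2 * V a` and `2 * z * V (a +
l')`. The available multiplier `z'` is minus the inverse of `z`, so the difference is taken in the
opposite order. -/
theorem ipass_eq {l' D : ℕ} (hD : 0 < D) (hl : D ∣ l') {half : R} (hh : 2 * half = 1)
    {z z' V W : ℕ → R} (hz : ∀ j < D, z' j * z j = -1)
    (hW : ∀ x < 2 * l', W x = pass (2 * l') D z V x) {pos : ℕ} (hpos : pos < 2 * l') :
    ipass (2 * l') D half z' W pos = V pos := by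
  have hl2 : 2 * l' / 2 = l' := by omega
  have hq : pos % l' < l' := Nat.mod_lt _ (by omega)
  obtain ⟨k, rfl⟩ := hl
  have hj : pos % (D * k) % D < D := Nat.mod_lt _ hD
  have hi : pos % (D * k) / D < k := Nat.div_lt_of_lt_mul hq
  have hq' : pos % (D * k) / D * D + pos % (D * k) % D = pos % (D * k) := Nat.div_add_mod' _ _
  have hb : (2 * (pos % (D * k) / D) + 2) * D ≤ 2 * (D * k) :=
    (Nat.mul_le_mul_right D (show _ ≤ 2 * k by omega)).trans_eq (by ring)
  have hz' := hz _ hj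
  simp only [ipass, hl2]
  rw [hW _ (by linarith), hW _ (by linarith), pass_even _ _ hj, pass_odd _ _ hj, hq', hl2]
  split_ifs with h
  · rw [Nat.mod_eq_of_lt h]
    linear_combination V pos * hh
  · have h3 : pos % (D * k) + D * k = pos := by
      rw [Nat.mod_eq_sub_mod (by omega), Nat.mod_eq_of_lt (by omega)]
      omega
    rw [h3]
    linear_combination V pos * hh - 2 * half * V pos * hz'

/-- The first `d` passes. -/
def passes (l : ℕ) (z : ℕ → ℕ → R) (V : ℕ → R) : ℕ → ℕ → R
  | 0 => V
  | d + 1 => pass l (2 ^ d) (z d) (passes l z V d)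

/-- After `d` passes the array holds, for each residue `i` modulo `2 ^ (lam - d)`, the values of the
subsequence of that residue at the `2 ^ d` roots of level `d`. A further pass joins the even and the
odd powers of two such subsequences; the output order needs no bit reversal. -/
theorem passes_eq {lam : ℕ} {θ : ℕ → ℕ → R} (V : ℕ → R)
    (h1 : ∀ d j, d < lam → j < 2 ^ d → θ (d + 1) j ^ 2 = θ d j)
    (h2 : ∀ d j, d < lam → j < 2 ^ d → θ (d + 1) (2 ^ d + j) = -θ (d + 1) j) :
    ∀ d ≤ lam, ∀ i < 2 ^ (lam - d), ∀ j < 2 ^ d,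
      passes (2 ^ lam) (fun d => θ (d + 1)) V d (i * 2 ^ d + j) =
        ∑ r ∈ range (2 ^ d), V (i + r * 2 ^ (lam - d)) * θ d j ^ r := by
  intro d
  induction d with
  | zero =>
    intro _ i _ j hj
    obtain rfl : j = 0 := by simpa using hj
    simp [passes]
  | succ d ih =>
    intro hd i hi j hj
    have e1 : lam - d = lam - (d + 1) + 1 := by omega
    have e2 : 2 ^ lam / 2 = 2 ^ (lam - (d + 1)) * 2 ^ d := by
      rw [← pow_add, show lam - (d + 1) + d = lam - 1 by omega]
      rw [Nat.div_eq_iff_eq_mul_left (by norm_num) (dvd_pow_self 2 (by omega)), ← pow_succ,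
        show lam - 1 + 1 = lam by omega]
    have hp : 2 ^ (d + 1) = 2 * 2 ^ d := by ring
    have hlp : 2 ^ (lam - d) = 2 * 2 ^ (lam - (d + 1)) := by rw [e1]; ring
    -- The sign `s` is `1` for the first half of the roots and `-1` for the second; either way the
    -- square of the root is `θ d j'`.
    have key : ∀ (s : R) j', j' < 2 ^ d → θ (d + 1) j = s * θ (d + 1) j' → s * s = 1 →
        passes (2 ^ lam) (fun d => θ (d + 1)) V d (i * 2 ^ d + j') +
          s * (θ (d + 1) j' * passes (2 ^ lam) (fun d => θ (d + 1)) V d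
            (i * 2 ^ d + j' + 2 ^ lam / 2)) =
        ∑ r ∈ range (2 ^ (d + 1)), V (i + r * 2 ^ (lam - (d + 1))) * θ (d + 1) j ^ r := by
      intro s j' hj' hs hss
      rw [e2, show i * 2 ^ d + j' + 2 ^ (lam - (d + 1)) * 2 ^ d =
          (i + 2 ^ (lam - (d + 1))) * 2 ^ d + j' by ring,
        ih (by omega) i (by omega) j' hj', ih (by omega) _ (by omega) j' hj', hp,
        sum_range_two_mul, mul_sum, mul_sum, ← sum_add_distrib]
      refine sum_congr rfl fun r _ => ?_
      have h3 : θ (d + 1) j ^ 2 = θ d j' := by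
        rw [hs, mul_pow, sq s, hss, one_mul, h1 d j' (by omega) hj']
      rw [pow_succ (θ (d + 1) j), pow_mul, h3, hs, hlp,
        show i + 2 * r * 2 ^ (lam - (d + 1)) = i + r * (2 * 2 ^ (lam - (d + 1))) by ring,
        show i + (2 * r + 1) * 2 ^ (lam - (d + 1)) =
          i + 2 ^ (lam - (d + 1)) + r * (2 * 2 ^ (lam - (d + 1))) by ring]
      ring
    rcases lt_or_ge j (2 ^ d) with hj' | hj'
    · rw [← key 1 j hj' (by simp) (by simp), hp,
        show i * (2 * 2 ^ d) + j = 2 * i * 2 ^ d + j by ring, passes, pass_even _ _ hj', one_mul]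
    · obtain ⟨j', rfl⟩ := Nat.exists_eq_add_of_le hj'
      have hj'' : j' < 2 ^ d := by omega
      rw [← key (-1) j' hj'' (by rw [h2 d j' (by omega) hj'']; ring) (by simp), hp,
        show i * (2 * 2 ^ d) + (2 ^ d + j') = (2 * i + 1) * 2 ^ d + j' by ring, passes,
        pass_odd _ _ hj'']
      ring

end CommRing

end Negacyclic


/-! ### Blocks of an array as elements of the ring of polynomials modulo `X ^ n + 1` -/

namespace Negacyclic

open Polynomial Finset

section CommRing
variable {R : Type*} [CommRing R]

theorem pass_congr {l' D : ℕ} (hD : 0 < D) (hl : D ∣ l') {z V V' : ℕ → R}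
    (hV : ∀ x < 2 * l', V x = V' x) {pos : ℕ} (hpos : pos < 2 * l') :
    pass (2 * l') D z V pos = pass (2 * l') D z V' pos := by
  obtain ⟨k, rfl⟩ := hl
  have hj : pos % D < D := Nat.mod_lt _ hD
  have hi : pos / (2 * D) < k := Nat.div_lt_of_lt_mul (by linarith)
  have hb : (pos / (2 * D) + 1) * D ≤ D * k :=
    (Nat.mul_le_mul_right D hi).trans_eq (by ring)
  have h2 : 2 * (D * k) / 2 = D * k := by omega
  simp only [pass, h2]
  rw [hV _ (by linarith), hV _ (by linarith)]

theorem sum_range_mul (l m : ℕ) (f : ℕ → R) :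
    ∑ x ∈ range (l * m), f x = ∑ r ∈ range l, ∑ c ∈ range m, f (r * m + c) := by
  induction l with
  | zero => simp
  | succ l ih => rw [sum_range_succ, ← ih, Nat.succ_mul, sum_range_add]

end CommRing

variable {F : Type} [Field F]

/-- The polynomials modulo `X ^ n + 1`. -/
abbrev NegRing (F : Type) [Field F] (n : ℕ) := AdjoinRoot (X ^ n + 1 : F[X])

/-- The class of `X`. -/
noncomputable abbrev xi (F : Type) [Field F] (n : ℕ) : NegRing F n := AdjoinRoot.root _

theorem xi_pow (n : ℕ) : xi F n ^ n = -1 := by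
  have h : AdjoinRoot.mk (X ^ n + 1 : F[X]) (X ^ n + 1) = 0 := AdjoinRoot.mk_self
  rw [map_add, map_pow, AdjoinRoot.mk_X, map_one] at h
  exact eq_neg_of_add_eq_zero_left h

/-- The polynomial with the first `n` coefficients given by `a`. -/
noncomputable def poly (n : ℕ) (a : ℕ → F) : F[X] := ∑ c ∈ range n, C (a c) * X ^ c

theorem coeff_poly (n : ℕ) (a : ℕ → F) (k : ℕ) :
    (poly n a).coeff k = if k < n then a k else 0 := by
  simp [poly, coeff_X_pow]

theorem degree_poly_lt (n : ℕ) (a : ℕ → F) : (poly n a).degree < n := by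
  rw [degree_lt_iff_coeff_zero]
  intro m hm
  rw [coeff_poly, if_neg (by simpa using hm)]

/-- Representatives of degree below `n` are unique; this turns identities in the quotient ring back
into identities of coefficients. -/
theorem eq_of_mk_eq {n : ℕ} (hn : 0 < n) {f g : F[X]} (hf : f.degree < n) (hg : g.degree < n)
    (h : AdjoinRoot.mk (X ^ n + 1 : F[X]) f = AdjoinRoot.mk (X ^ n + 1 : F[X]) g) : f = g := by
  rw [AdjoinRoot.mk_eq_mk] at h
  have hd : (X ^ n + 1 : F[X]).degree = n := by
    simpa using degree_X_pow_add_C (R := F) hn 1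
  refine sub_eq_zero.1 (eq_zero_of_dvd_of_degree_lt h ?_)
  rw [hd]
  exact (degree_sub_le _ _).trans_lt (max_lt hf hg)

/-- The class of the polynomial whose coefficients are the block with number `P` of `a`. -/
noncomputable def blk (n : ℕ) (a : ℕ → F) (P : ℕ) : NegRing F n :=
  AdjoinRoot.mk _ (poly n fun c => a (P * n + c))

theorem mk_poly {n k : ℕ} (a : ℕ → F) :
    AdjoinRoot.mk (X ^ n + 1 : F[X]) (poly k a) =
      ∑ c ∈ range k, AdjoinRoot.of _ (a c) * xi F n ^ c := by
  simp [poly]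

theorem coeff_eq_of_blk {n : ℕ} (hn : 0 < n) {a b : ℕ → F} {P Q : ℕ}
    (h : blk n a P = blk n b Q) {c : ℕ} (hc : c < n) : a (P * n + c) = b (Q * n + c) := by
  have := congrArg (fun f => f.coeff c)
    (eq_of_mk_eq hn (degree_poly_lt _ _) (degree_poly_lt _ _) h)
  simpa [coeff_poly, hc] using this

theorem mk_rot {n e : ℕ} (he : e ≤ n) (b : ℕ → F) :
    AdjoinRoot.mk (X ^ n + 1 : F[X]) (poly n (rot n e b)) =
      xi F n ^ e * AdjoinRoot.mk _ (poly n b) := by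
  rw [mk_poly, mk_poly, ← sum_rot he _ (xi_pow n)]
  refine sum_congr rfl fun c _ => ?_
  simp only [rot]
  split_ifs <;> simp

theorem poly_add (n : ℕ) (a b : ℕ → F) : poly n (fun c => a c + b c) = poly n a + poly n b := by
  simp [poly, add_mul, sum_add_distrib]

theorem poly_sub (n : ℕ) (a b : ℕ → F) : poly n (fun c => a c - b c) = poly n a - poly n b := by
  simp [poly, sub_mul, sum_sub_distrib]

theorem poly_mul (n : ℕ) (x : F) (b : ℕ → F) : poly n (fun c => x * b c) = C x * poly n b := by
  simp [poly, mul_sum, mul_assoc]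

/-- One pass of the transform, for an array of blocks of length `M` in groups of `l` blocks. -/
def fwdPass (M l D : ℕ) (A : ℕ → F) (idx : ℕ) : F :=
  let pos := idx / M % l
  let src := idx / M / l * l + (pos / (2 * D) * D + pos % D)
  let r := rot M (M / (2 * D) * (1 + 2 * (pos % D))) (fun c => A ((src + l / 2) * M + c)) (idx % M)
  if pos / D % 2 = 0 then A (src * M + idx % M) + r else A (src * M + idx % M) - r

/-- One pass of the inverse transform. -/
def invPass (M l D : ℕ) (half : F) (A : ℕ → F) (idx : ℕ) : F :=
  let pos := idx / M % l
  let q := pos % (l / 2)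
  let x := idx / M / l * l + (2 * (q / D) * D + q % D)
  let y := idx / M / l * l + ((2 * (q / D) + 1) * D + q % D)
  if pos < l / 2 then half * (A (x * M + idx % M) + A (y * M + idx % M))
  else half * rot M (M - M / (2 * D) * (1 + 2 * (q % D)))
    (fun c => A (y * M + c) - A (x * M + c)) (idx % M)

/-- Split into blocks of length `m`, padded with `m` zeros. -/
def expand (m : ℕ) (A : ℕ → F) (idx : ℕ) : F :=
  if idx % (2 * m) < m then A (idx / (2 * m) * m + idx % (2 * m)) else 0

/-- Put blocks of length `2 * m` together, with overlaps of length `m`. -/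
def combine (m l : ℕ) (A : ℕ → F) (idx : ℕ) : F :=
  A (idx / m * (2 * m) + idx % m) +
    rot l 1 (fun r => A ((idx / m / l * l + r) * (2 * m) + (m + idx % m))) (idx / m % l)

/-- The root exponents of a pass. -/
def expo (M D j : ℕ) : ℕ := M / (2 * D) * (1 + 2 * j)

theorem expo_le {M D j : ℕ} (hj : j < D) : expo M D j ≤ M :=
  (Nat.mul_le_mul_left _ (show 1 + 2 * j ≤ 2 * D by omega)).trans (Nat.div_mul_le_self _ _)

theorem blk_index {P M c : ℕ} (hc : c < M) : (P * M + c) / M = P ∧ (P * M + c) % M = c := by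
  refine ⟨?_, Nat.mul_add_mod_of_lt hc⟩
  rw [mul_comm, Nat.mul_add_div (by omega), Nat.div_eq_of_lt hc, add_zero]

theorem poly_congr {n : ℕ} {a b : ℕ → F} (h : ∀ c < n, a c = b c) : poly n a = poly n b :=
  sum_congr rfl fun c hc => by rw [h c (mem_range.1 hc)]

/-- The roots are powers of the class of `X`, so multiplying a block by a root is a rotation with
sign and costs no multiplication in `F`. -/
theorem blk_fwdPass {M l D : ℕ} (hD : 0 < D) (A : ℕ → F) (P : ℕ) :
    blk M (fwdPass M l D A) P =
      pass l D (fun j => xi F M ^ expo M D j) (fun x => blk M A (P / l * l + x)) (P % l) := by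
  have hj : P % l % D < D := Nat.mod_lt _ hD
  simp only [blk, pass]
  rw [← mk_rot (expo_le hj)]
  split_ifs with h
  · rw [← map_add, ← poly_add]
    congr 1
    refine poly_congr fun c hc => ?_
    simp only [fwdPass, blk_index hc, if_pos h, expo, add_assoc]
  · rw [← map_sub, ← poly_sub]
    congr 1
    refine poly_congr fun c hc => ?_
    simp only [fwdPass, blk_index hc, if_neg h, expo, add_assoc]

theorem blk_invPass {M l D : ℕ} (half : F) (A : ℕ → F) (P : ℕ) :
    blk M (invPass M l D half A) P =
      ipass l D (AdjoinRoot.of _ half) (fun j => xi F M ^ (M - expo M D j))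
        (fun x => blk M A (P / l * l + x)) (P % l) := by
  simp only [blk, ipass]
  have hC : AdjoinRoot.of (X ^ M + 1 : F[X]) half = AdjoinRoot.mk _ (C half) := rfl
  split_ifs with h
  · rw [← map_add, ← poly_add, hC, ← map_mul, ← poly_mul]
    congr 1
    refine poly_congr fun c hc => ?_
    simp only [invPass, blk_index hc, if_pos h]
  · rw [← map_sub, ← poly_sub, ← mk_rot (Nat.sub_le _ _), hC, ← map_mul, ← poly_mul]
    congr 1
    refine poly_congr fun c hc => ?_
    simp only [invPass, blk_index hc, if_neg h, expo]

end Negacyclic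


/-! ### The Fourier transform over the quotient ring and one level of the recursion -/

namespace Negacyclic

open Polynomial Finset

variable {F : Type} [Field F]

/-- The first `d` passes of the transform. -/
def fwdIter (M l : ℕ) (A : ℕ → F) : ℕ → ℕ → F
  | 0 => A
  | d + 1 => fwdPass M l (2 ^ d) (fwdIter M l A d)

/-- The first `k` passes of the inverse transform with `lam` passes. -/
def invIter (M l lam : ℕ) (half : F) (A : ℕ → F) : ℕ → ℕ → F
  | 0 => A
  | k + 1 => invPass M l (2 ^ (lam - 1 - k)) half (invIter M l lam half A k)

theorem two_pow_eq {lam d : ℕ} (hd : d < lam) :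
    2 ^ lam = 2 * 2 ^ (lam - 1) ∧ 2 ^ d ∣ 2 ^ (lam - 1) :=
  ⟨by rw [← pow_succ', Nat.sub_add_cancel (by omega)], pow_dvd_pow _ (by omega)⟩

theorem blk_fwdIter {M lam : ℕ} (A : ℕ → F) (B : ℕ) :
    ∀ d ≤ lam, ∀ x < 2 ^ lam, blk M (fwdIter M (2 ^ lam) A d) (B * 2 ^ lam + x) =
      passes (2 ^ lam) (fun d j => xi F M ^ expo M (2 ^ d) j)
        (fun x => blk M A (B * 2 ^ lam + x)) d x := by
  intro d
  induction d with
  | zero => intro _ x _; rfl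
  | succ d ih =>
    intro hd x hx
    obtain ⟨h2, hdvd⟩ := two_pow_eq (show d < lam by omega)
    rw [fwdIter, blk_fwdPass (by positivity), (blk_index hx).1, (blk_index hx).2, passes]
    rw [h2] at hx ih ⊢
    exact pass_congr (by positivity) hdvd (ih (by omega)) hx

/-- The roots at which the transform evaluates. -/
noncomputable def theta (F : Type) [Field F] (mu d j : ℕ) : NegRing F (2 ^ mu) :=
  xi F (2 ^ mu) ^ (2 ^ (mu - d) * (1 + 2 * j))

theorem expo_eq {mu d j : ℕ} (hd : d < mu) :
    expo (2 ^ mu) (2 ^ d) j = 2 ^ (mu - (d + 1)) * (1 + 2 * j) := by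
  rw [expo, ← pow_succ', Nat.pow_div (by omega) (by norm_num)]

/-- The exponent becomes `2 ^ mu` times an odd number. Hence the transform evaluates at roots of `Y
^ (2 ^ d) + 1`, and pointwise products correspond to negacyclic ones. -/
theorem theta_pow {mu d j : ℕ} (hd : d ≤ mu) : theta F mu d j ^ 2 ^ d = -1 := by
  rw [theta, ← pow_mul, show 2 ^ (mu - d) * (1 + 2 * j) * 2 ^ d =
    2 ^ (mu - d) * 2 ^ d * (1 + 2 * j) by ring, ← pow_add, Nat.sub_add_cancel hd, pow_mul,
    xi_pow, pow_add, pow_mul]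
  simp

theorem transform_eq {mu lam : ℕ} (hl : lam ≤ mu) (V : ℕ → NegRing F (2 ^ mu)) {j : ℕ}
    (hj : j < 2 ^ lam) :
    passes (2 ^ lam) (fun d j => xi F (2 ^ mu) ^ expo (2 ^ mu) (2 ^ d) j) V lam j =
      ∑ r ∈ range (2 ^ lam), V r * theta F mu lam j ^ r := by
  have hcongr : ∀ d ≤ lam,
      passes (2 ^ lam) (fun d j => xi F (2 ^ mu) ^ expo (2 ^ mu) (2 ^ d) j) V d =
        passes (2 ^ lam) (fun d => theta F mu (d + 1)) V d := by
    intro d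
    induction d with
    | zero => intro _; rfl
    | succ d ih =>
      intro hd
      rw [passes, passes, ih (by omega)]
      congr 1
      ext j
      rw [expo_eq (by omega), theta]
  rw [hcongr lam le_rfl]
  have := passes_eq (lam := lam) (θ := theta F mu) V ?_ ?_ lam le_rfl 0 (by simp) j hj
  · simpa using this
  · intro d j hd _
    rw [theta, theta, ← pow_mul, show 2 ^ (mu - (d + 1)) * (1 + 2 * j) * 2 =
      2 ^ (mu - (d + 1) + 1) * (1 + 2 * j) by ring,
      show mu - (d + 1) + 1 = mu - d by omega]
  · intro d j hd _
    rw [theta, theta, show 2 ^ (mu - (d + 1)) * (1 + 2 * (2 ^ d + j)) =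
      2 ^ (mu - (d + 1)) * (1 + 2 * j) + 2 ^ (mu - (d + 1) + (d + 1)) by ring, pow_add,
      Nat.sub_add_cancel (by omega), xi_pow]
    ring

/-- One level of the recursive multiplication algorithm. -/
theorem blk_combine {mu lam : ℕ} (hl : lam ≤ mu) (hmu : 1 ≤ mu) {half : F} (hh : 2 * half = 1)
    {A Z : ℕ → F} {N : ℕ}
    (hZ : ∀ P < N * 2 ^ lam, blk (2 ^ mu) Z P =
      blk (2 ^ mu) (fwdIter (2 ^ mu) (2 ^ lam) (expand (2 ^ (mu - 1)) A) lam) P *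
      blk (2 ^ mu) (fwdIter (2 ^ mu) (2 ^ lam) (expand (2 ^ (mu - 1)) A) lam)
        (N * 2 ^ lam + P)) {Q : ℕ} (hQ : Q < N) :
    blk (2 ^ lam * 2 ^ (mu - 1))
      (combine (2 ^ (mu - 1)) (2 ^ lam) (invIter (2 ^ mu) (2 ^ lam) lam half Z lam)) Q =
    blk (2 ^ lam * 2 ^ (mu - 1)) A Q * blk (2 ^ lam * 2 ^ (mu - 1)) A (N + Q) := by
  set m := 2 ^ (mu - 1) with hm
  set l := 2 ^ lam with hldef
  have hl0 : 0 < l := by positivity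
  have hm0 : 0 < m := by positivity
  have hM : 2 ^ mu = 2 * m := by rw [hm, ← pow_succ', Nat.sub_add_cancel hmu]
  let G : ℕ → ℕ → F[X] := fun B r => poly m fun c => A ((B * l + r) * m + c)
  have hG : ∀ B r, blk (2 ^ mu) (expand m A) (B * l + r) = AdjoinRoot.mk _ (G B r) := by
    intro B r
    rw [blk]
    congr 1
    ext k
    rw [coeff_poly, coeff_poly]
    by_cases hk : k < m
    · have hk' : k < 2 ^ mu := by omega
      rw [if_pos hk, if_pos hk', expand, ← hM, (blk_index hk').1, (blk_index hk').2, if_pos hk]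
    · rw [if_neg hk]
      split_ifs with hk'
      · rw [expand, ← hM, (blk_index hk').2, if_neg hk]
      · rfl
  -- The coefficients of the product in the outer variable `Y`, as honest polynomials before any
  -- reduction modulo `X ^ (2 * m) + 1`.
  let H : ℕ → F[X] := nega l (G Q) (G (N + Q))
  let V : ℕ → NegRing F (2 ^ mu) := fun r => AdjoinRoot.mk _ (H r)
  have hB : ∀ B, ∀ x < l, blk (2 ^ mu) (fwdIter (2 ^ mu) l (expand m A) lam) (B * l + x) =
      ∑ r ∈ range l, AdjoinRoot.mk _ (G B r) * theta F mu lam x ^ r := by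
    intro B x hx
    rw [blk_fwdIter _ _ _ le_rfl _ hx, transform_eq hl _ hx]
    exact sum_congr rfl fun r _ => by rw [hG]
  -- The pointwise products are the transform of `V`, and each inverse pass undoes the last
  -- remaining forward pass.
  have hV : ∀ k ≤ lam, ∀ x < l, blk (2 ^ mu) (invIter (2 ^ mu) l lam half Z k) (Q * l + x) =
      passes l (fun d j => xi F (2 ^ mu) ^ expo (2 ^ mu) (2 ^ d) j) V (lam - k) x := by
    intro k
    induction k with
    | zero =>
      intro _ x hx
      have hx' : Q * l + x < N * l :=
        (show Q * l + x < (Q + 1) * l by rw [add_mul]; omega).trans_le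
          (Nat.mul_le_mul_right _ hQ)
      rw [invIter, hZ _ hx', ← add_assoc, ← add_mul, hB _ _ hx, hB _ _ hx, Nat.sub_zero,
        transform_eq hl _ hx, ← sum_nega _ _ (theta_pow hl)]
      exact sum_congr rfl fun r _ => by rw [← map_nega]
    | succ k ih =>
      intro hk x hx
      have hd : lam - 1 - k < lam := by omega
      obtain ⟨h2, hdvd⟩ := two_pow_eq hd
      rw [invIter, blk_invPass, (blk_index hx).1, (blk_index hx).2]
      have h3 : lam - k = (lam - 1 - k) + 1 := by omega
      have h4 : lam - (k + 1) = lam - 1 - k := by omega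
      rw [h3] at ih
      rw [h4]
      rw [← hldef] at h2
      rw [h2] at hx ih ⊢
      refine ipass_eq (by positivity) hdvd ?_ (fun j hj => ?_) (ih (by omega)) hx
      · rw [← map_ofNat (AdjoinRoot.of (X ^ 2 ^ mu + 1 : F[X])) 2, ← map_mul, hh, map_one]
      · rw [← pow_add, Nat.sub_add_cancel (expo_le hj), xi_pow]
  have hdeg : ∀ B r, (G B r).natDegree ≤ m - 1 := fun B r => by
    rw [natDegree_le_iff_coeff_eq_zero]
    intro k hk
    rw [coeff_poly, if_neg (by omega)]
  -- The pieces have degree below `m`, so their products fit below `2 * m`. This is why `expand`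
  -- pads with zeros: the class of `H r` determines `H r`.
  have hHdeg : ∀ r, (H r).degree < ((2 ^ mu : ℕ) : WithBot ℕ) := by
    intro r
    refine degree_le_natDegree.trans_lt ?_
    have : (H r).natDegree ≤ (m - 1) + (m - 1) := by
      refine natDegree_sum_le_of_forall_le _ _ fun a _ => natDegree_mul_le_of_le (hdeg _ _) ?_
      simp only [rot]
      split_ifs
      · exact hdeg _ _
      · rw [natDegree_neg]
        exact hdeg _ _
    exact_mod_cast (show (H r).natDegree < 2 ^ mu by omega)
  set W := invIter (2 ^ mu) l lam half Z lam with hW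
  have hpoly : ∀ r < l, poly (2 ^ mu) (fun c => W ((Q * l + r) * 2 ^ mu + c)) = H r := by
    intro r hr
    have := hV lam le_rfl r hr
    rw [Nat.sub_self, passes] at this
    exact eq_of_mk_eq (by positivity) (degree_poly_lt _ _) (hHdeg r) this
  let φ := AdjoinRoot.mk (X ^ (l * m) + 1 : F[X])
  -- Back in the large ring the outer variable `Y` is specialized to `X ^ m`, and `Y ^ l = -1` holds
  -- there.
  let η := xi F (l * m) ^ m
  have hη : η ^ l = -1 := by rw [← pow_mul, mul_comm m l, xi_pow]
  have hAB : ∀ B, blk (l * m) A B = ∑ r ∈ range l, φ (G B r) * η ^ r := by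
    intro B
    rw [blk, mk_poly, sum_range_mul]
    refine sum_congr rfl fun r _ => ?_
    simp only [φ, G, η]
    rw [mk_poly, sum_mul]
    refine sum_congr rfl fun c _ => ?_
    rw [← pow_mul, mul_assoc, ← pow_add (xi F (l * m)), show B * (l * m) + (r * m + c) = (B * l + r) * m + c by
      ring, show c + m * r = r * m + c by ring]
  rw [hAB, hAB, ← sum_nega _ _ hη]
  -- The upper half of `H r` carries an extra factor `X ^ m`, that is, one more power of `Y`. It
  -- therefore moves to the next piece, with a change of sign when it leaves the last one; this is
  -- the term `rot l 1` of `combine`.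
  have e1 : ∀ r ∈ range l, nega l (fun r => φ (G Q r)) (fun r => φ (G (N + Q) r)) r * η ^ r =
      (∑ c ∈ range m, AdjoinRoot.of _ (W ((Q * l + r) * (2 * m) + c)) * xi F (l * m) ^ c) * η ^ r +
      xi F (l * m) ^ m * ((∑ c ∈ range m,
        AdjoinRoot.of _ (W ((Q * l + r) * (2 * m) + (m + c))) * xi F (l * m) ^ c) * η ^ r) := by
    intro r hr
    have h5 : nega l (fun r => φ (G Q r)) (fun r => φ (G (N + Q) r)) r = φ (H r) :=
      (map_nega φ _ _ _ _).symm
    rw [h5, ← hpoly r (mem_range.1 hr), hM]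
    simp only [φ]
    rw [mk_poly, two_mul, sum_range_add, add_mul, ← two_mul, ← mul_assoc (xi F (l * m) ^ m), mul_sum]
    congr 2
    refine sum_congr rfl fun c _ => ?_
    rw [pow_add]
    ring
  rw [sum_congr rfl e1, sum_add_distrib, ← mul_sum,
    ← pow_one (xi F (l * m) ^ m), ← sum_rot (n := l) (e := 1) hl0 _ hη, ← sum_add_distrib,
    blk, mk_poly, sum_range_mul]
  refine sum_congr rfl fun r hr => ?_
  have hr' := mem_range.1 hr
  have e2 : ∀ c ∈ range m, combine m l W (Q * (l * m) + (r * m + c)) =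
      W ((Q * l + r) * (2 * m) + c) +
        rot l 1 (fun r => W ((Q * l + r) * (2 * m) + (m + c))) r := by
    intro c hc
    have hc' := mem_range.1 hc
    rw [show Q * (l * m) + (r * m + c) = (Q * l + r) * m + c by ring, combine,
      (blk_index hc').1, (blk_index hc').2, (blk_index hr').1, (blk_index hr').2]
  have e3 : ∀ f : ℕ → ℕ → F, rot l 1 (fun i => ∑ c ∈ range m,
      AdjoinRoot.of (X ^ (l * m) + 1 : F[X]) (f i c) * xi F (l * m) ^ c) r =
      ∑ c ∈ range m, AdjoinRoot.of _ (rot l 1 (fun i => f i c) r) * xi F (l * m) ^ c := by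
    intro f
    simp only [rot]
    split_ifs <;> simp
  rw [e3 fun i c => W ((Q * l + i) * (2 * m) + (m + c)), sum_mul, sum_mul, ← sum_add_distrib]
  refine sum_congr rfl fun c hc => ?_
  rw [e2 c hc, map_add, ← pow_mul, pow_add, mul_comm r m]
  ring

end Negacyclic


/-! ### Programs for one entry of each transform step -/

namespace WordRAM

open WordRAM.Expr WordRAM.Prog Negacyclic

/-- The first `n` cells of an array hold the residues `F 0, …, F (n - 1)`. -/
def Rep {p : ℕ} (a : ℕ → ℕ) (F : ℕ → ZMod p) (n : ℕ) : Prop := ∀ i < n, a i = (F i).val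

section val
variable {p : ℕ} (x y : ZMod p)

theorem val_add_mod [NeZero p] : (x.val + y.val) % p = (x + y).val := (ZMod.val_add x y).symm

theorem val_mul_mod : (x.val * y.val) % p = (x * y).val := (ZMod.val_mul x y).symm

theorem val_neg_mod [NeZero p] : (p - x.val) % p = (-x).val := by
  have hx : x.val ≤ p := (ZMod.val_lt x).le
  have h : ((p - x.val : ℕ) : ZMod p) = -x := by
    rw [Nat.cast_sub hx]; simp
  rw [← h, ZMod.val_natCast]

theorem val_sub_mod [NeZero p] : (x.val + (p - y.val)) % p = (x - y).val := by
  rw [sub_eq_add_neg, ZMod.val_add, ← val_neg_mod, Nat.add_mod_mod]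

end val

/-- Both blocks that a butterfly reads lie in the part of the array that is known to represent
residues, and their addresses do not overflow. The same purpose is served by `inv_src_lt` for the
inverse pass. -/
theorem src_lt {P l' D B : ℕ} (hD : 0 < D) (hl : D ∣ l') (hl0 : 0 < l') (hB : 2 * l' ∣ B)
    (hP : P < B) :
    P / (2 * l') * (2 * l') + (P % (2 * l') / (2 * D) * D + P % (2 * l') % D) + l' < B := by
  obtain ⟨k, rfl⟩ := hl
  obtain ⟨q, rfl⟩ := hB
  have h1 : P / (2 * (D * k)) < q := Nat.div_lt_of_lt_mul hP
  have h2 : P % (2 * (D * k)) / (2 * D) < k :=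
    Nat.div_lt_of_lt_mul ((Nat.mod_lt _ (by positivity)).trans_eq (by ring))
  have h3 : P % (2 * (D * k)) % D < D := Nat.mod_lt _ hD
  have h4 : (P / (2 * (D * k)) + 1) * (2 * (D * k)) ≤ 2 * (D * k) * q :=
    (Nat.mul_le_mul_right _ h1).trans_eq (mul_comm _ _)
  have h5 : (P % (2 * (D * k)) / (2 * D) + 1) * D ≤ D * k :=
    (Nat.mul_le_mul_right _ h2).trans_eq (mul_comm _ _)
  rw [add_mul] at h4 h5
  omega

/-- Registers: `10` the modulus, `24` the length `M` of a block, `25` the length `l` of a group,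
`28` the total length, `30` the number `D`. -/
def passBody : Prog :=
  .assign 32 (reg 31 / reg 24) ;;
  .assign 33 (reg 31 % reg 24) ;;
  .assign 34 (reg 32 % reg 25) ;;
  .assign 35 (reg 34 % reg 30) ;;
  .assign 36 (reg 32 / reg 25 * reg 25 + (reg 34 / (2 * reg 30) * reg 30 + reg 35)) ;;
  .assign 37 (reg 24 / (2 * reg 30) * (1 + 2 * reg 35)) ;;
  .assign 38 ((reg 36 + reg 25 / 2) * reg 24) ;;
  .ite (.bin .lt (reg 33) (reg 37))
    (.assign 39 ((reg 10 - load 10 (reg 38 + (reg 24 + reg 33 - reg 37))) % reg 10))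
    (.assign 39 (load 10 (reg 38 + (reg 33 - reg 37)))) ;;
  .ite (.bin .eq (reg 34 / reg 30 % 2) 0)
    (.store 11 (reg 31) ((load 10 (reg 36 * reg 24 + reg 33) + reg 39) % reg 10))
    (.store 11 (reg 31) ((load 10 (reg 36 * reg 24 + reg 33) + (reg 10 - reg 39)) % reg 10))

theorem runs_passBody {w : ℕ} {ω : ℕ → Fin (2 ^ w)} {s : State} {p : ℕ} [Fact p.Prime]
    {M l' D B idx : ℕ} {A : ℕ → ZMod p} (hp : 2 * p ≤ 2 ^ w) (hw : 4 * (B * M) ≤ 2 ^ w)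
    (hD : 0 < D) (hl : D ∣ l') (hl0 : 0 < l') (hB : 2 * l' ∣ B) (hidx : idx < B * M)
    (h10 : s.reg 10 = p) (h24 : s.reg 24 = M) (h25 : s.reg 25 = 2 * l') (h30 : s.reg 30 = D)
    (h31 : s.reg 31 = idx) (hA : Rep (s.mem 10) A (B * M)) :
    Runs w ω passBody s 150 fun s' =>
      s'.mem 11 = Function.update (s.mem 11) idx (fwdPass M (2 * l') D A idx).val := by
  have hM0 : 0 < M := Nat.pos_of_mul_pos_left (by omega : 0 < B * M)
  have hP : idx / M < B := Nat.div_lt_of_lt_mul (by linarith)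
  have hc : idx % M < M := Nat.mod_lt _ hM0
  have hsrc := src_lt hD hl hl0 hB hP
  have hBM : B ≤ B * M := Nat.le_mul_of_pos_right _ hM0
  have hMB : M ≤ B * M := Nat.le_mul_of_pos_left _ (by omega)
  have hDl : D ≤ l' := Nat.le_of_dvd hl0 hl
  have hl2 : 2 * l' / 2 = l' := by omega
  have hj : idx / M % (2 * l') % D < D := Nat.mod_lt _ hD
  have he : M / (2 * D) * (1 + 2 * (idx / M % (2 * l') % D)) ≤ M := expo_le hj
  have he' : M / (2 * D) ≤ M := Nat.div_le_self _ _
  unfold passBody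
  refine WP.seq (WP.assign (idx / M) (by simp [h24, h31]) ?_)
  refine WP.seq (WP.assign (idx % M) (by simp [h24, h31]) ?_)
  refine WP.seq (WP.assign (idx / M % (2 * l')) (by simp [h25]) ?_)
  refine WP.seq (WP.assign (idx / M % (2 * l') % D) (by simp [h30]) ?_)
  -- All bounds on these quotients and remainders have been recorded, so they can be treated as
  -- variables from here on.
  generalize hP' : idx / M = P at *
  generalize hc' : idx % M = c at *
  generalize hpos : P % (2 * l') = pos at *
  generalize hj' : pos % D = j at *
  refine WP.seq (WP.assign (P / (2 * l') * (2 * l') + (pos / (2 * D) * D + j)) ?_ ?_)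
  · simp (disch := omega) [h25, h30, mod_word]
  generalize hsrc' : P / (2 * l') * (2 * l') + (pos / (2 * D) * D + j) = src at *
  refine WP.seq (WP.assign (M / (2 * D) * (1 + 2 * j)) ?_ ?_)
  · simp (disch := omega) [h24, h30, mod_word]
  generalize he'' : M / (2 * D) * (1 + 2 * j) = e at *
  have hm1 : (src + l') * M + M ≤ B * M :=
    (Nat.succ_mul _ _).symm.trans_le (Nat.mul_le_mul_right _ hsrc)
  have hm2 : src * M ≤ (src + l') * M := Nat.mul_le_mul_right _ (by omega)
  refine WP.seq (WP.assign ((src + l') * M) ?_ ?_)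
  · simp (disch := omega) [h24, h25, hl2, mod_word]
  set r := rot M e (fun c => A ((src + l') * M + c)) c with hr
  refine WP.seq (WP.ite_assign (c < e) r.val (by simp) (fun h => ?_) (fun h => ?_)
    fun t1 ht1 => ?_)
  · have h1 := hA ((src + l') * M + (M + c - e)) (by omega)
    simp (disch := omega) [h10, h24, mod_word, h1]
    rw [val_neg_mod, hr, rot, if_neg (by omega)]
  · have h1 := hA ((src + l') * M + (c - e)) (by omega)
    simp (disch := omega) [mod_word, h1]
    rw [hr, rot, if_pos (by omega)]
  have hr1 := ZMod.val_lt r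
  have h1 := hA (src * M + c) (by omega)
  have h2 := ZMod.val_lt (A (src * M + c))
  refine WP.ite_store (pos / D % 2 = 0) idx (fwdPass M (2 * l') D A idx).val ?_ (by simp [h31])
    (fun h => ?_) (fun h => ?_) fun t2 ht2 => ?_
  · simp (disch := omega) [h30, mod_word]
  · simp (disch := omega) [h10, h24, mod_word, h1, val_add_mod]
    simp [fwdPass, hP', hc', hpos, hj', hsrc', he'', hl2, h, hr]
  · simp (disch := omega) [h10, h24, mod_word, h1, val_sub_mod]
    simp [fwdPass, hP', hc', hpos, hj', hsrc', he'', hl2, h, hr]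
  · simp at ht1 ht2
    refine ⟨by omega, by simp⟩

theorem inv_src_lt {P l' D B : ℕ} (hD : 0 < D) (hl : D ∣ l') (hl0 : 0 < l') (hB : 2 * l' ∣ B)
    (hP : P < B) :
    P / (2 * l') * (2 * l') +
      ((2 * (P % (2 * l') % l' / D) + 1) * D + P % (2 * l') % l' % D) < B := by
  obtain ⟨k, rfl⟩ := hl
  obtain ⟨q, rfl⟩ := hB
  have h1 : P / (2 * (D * k)) < q := Nat.div_lt_of_lt_mul hP
  have h2 : P % (2 * (D * k)) % (D * k) / D < k := Nat.div_lt_of_lt_mul (Nat.mod_lt _ hl0)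
  have h3 : P % (2 * (D * k)) % (D * k) % D < D := Nat.mod_lt _ hD
  have h4 : (P / (2 * (D * k)) + 1) * (2 * (D * k)) ≤ 2 * (D * k) * q :=
    (Nat.mul_le_mul_right _ h1).trans_eq (mul_comm _ _)
  have h5 : (2 * (P % (2 * (D * k)) % (D * k) / D) + 2) * D ≤ 2 * (D * k) :=
    (Nat.mul_le_mul_right D (show _ ≤ 2 * k by omega)).trans_eq (by ring)
  rw [add_mul] at h4 h5 ⊢
  omega

/-- Register `11` holds the inverse of `2`. -/
def invBody : Prog :=
  .assign 32 (reg 31 / reg 24) ;;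
  .assign 33 (reg 31 % reg 24) ;;
  .assign 34 (reg 32 % reg 25) ;;
  .assign 35 (reg 34 % (reg 25 / 2)) ;;
  .assign 36 (reg 35 % reg 30) ;;
  .assign 37 ((reg 32 / reg 25 * reg 25 + (2 * (reg 35 / reg 30) * reg 30 + reg 36)) * reg 24) ;;
  .assign 38 ((reg 32 / reg 25 * reg 25 + ((2 * (reg 35 / reg 30) + 1) * reg 30 + reg 36)) *
    reg 24) ;;
  .assign 39 (reg 24 - reg 24 / (2 * reg 30) * (1 + 2 * reg 36)) ;;
  .ite (.bin .lt (reg 33) (reg 39)) (.assign 41 (reg 24 + reg 33 - reg 39))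
    (.assign 41 (reg 33 - reg 39)) ;;
  .ite (.bin .lt (reg 33) (reg 39))
    (.assign 42 ((load 10 (reg 37 + reg 41) + (reg 10 - load 10 (reg 38 + reg 41))) % reg 10))
    (.assign 42 ((load 10 (reg 38 + reg 41) + (reg 10 - load 10 (reg 37 + reg 41))) % reg 10)) ;;
  .ite (.bin .lt (reg 34) (reg 25 / 2))
    (.store 11 (reg 31) (reg 11 * ((load 10 (reg 37 + reg 33) + load 10 (reg 38 + reg 33)) % reg 10)
      % reg 10))
    (.store 11 (reg 31) (reg 11 * reg 42 % reg 10))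

theorem runs_invBody {w : ℕ} {ω : ℕ → Fin (2 ^ w)} {s : State} {p : ℕ} [Fact p.Prime]
    {M l' D B idx : ℕ} {A : ℕ → ZMod p} {half : ZMod p} (hp : 2 * (p * p) ≤ 2 ^ w)
    (hw : 4 * (B * M) ≤ 2 ^ w)
    (hD : 0 < D) (hl : D ∣ l') (hl0 : 0 < l') (hB : 2 * l' ∣ B) (hidx : idx < B * M)
    (h10 : s.reg 10 = p) (h11 : s.reg 11 = half.val)
    (h24 : s.reg 24 = M) (h25 : s.reg 25 = 2 * l') (h30 : s.reg 30 = D)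
    (h31 : s.reg 31 = idx) (hA : Rep (s.mem 10) A (B * M)) :
    Runs w ω invBody s 200 fun s' =>
      s'.mem 11 = Function.update (s.mem 11) idx (invPass M (2 * l') D half A idx).val := by
  have hM0 : 0 < M := Nat.pos_of_mul_pos_left (by omega : 0 < B * M)
  have hP : idx / M < B := Nat.div_lt_of_lt_mul (by linarith)
  have hc : idx % M < M := Nat.mod_lt _ hM0
  have hy := inv_src_lt hD hl hl0 hB hP
  have hBM : B ≤ B * M := Nat.le_mul_of_pos_right _ hM0
  have hMB : M ≤ B * M := Nat.le_mul_of_pos_left _ (by omega)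
  have hDl : D ≤ l' := Nat.le_of_dvd hl0 hl
  have hl2 : 2 * l' / 2 = l' := by omega
  have hpp : p ≤ p * p := Nat.le_mul_self p
  have hj : idx / M % (2 * l') % l' % D < D := Nat.mod_lt _ hD
  have he : M / (2 * D) * (1 + 2 * (idx / M % (2 * l') % l' % D)) ≤ M := expo_le hj
  have he' : M / (2 * D) ≤ M := Nat.div_le_self _ _
  unfold invBody
  refine WP.seq (WP.assign (idx / M) (by simp [h24, h31]) ?_)
  refine WP.seq (WP.assign (idx % M) (by simp [h24, h31]) ?_)
  refine WP.seq (WP.assign (idx / M % (2 * l')) (by simp [h25]) ?_)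
  refine WP.seq (WP.assign (idx / M % (2 * l') % l') ?_ ?_)
  · simp (disch := omega) [h25, mod_word, hl2]
  refine WP.seq (WP.assign (idx / M % (2 * l') % l' % D) (by simp [h30]) ?_)
  generalize hP' : idx / M = P at *
  generalize hc' : idx % M = c at *
  generalize hpos : P % (2 * l') = pos at *
  generalize hq : pos % l' = q at *
  generalize hj' : q % D = j at *
  have hx : (2 * (q / D) + 1) * D = 2 * (q / D) * D + D := by ring
  have hqD : 2 * (q / D) ≤ 2 * (q / D) * D := Nat.le_mul_of_pos_right _ hD
  have hxy : P / (2 * l') * (2 * l') + (2 * (q / D) * D + j) ≤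
    P / (2 * l') * (2 * l') + ((2 * (q / D) + 1) * D + j) := by omega
  generalize hy' : P / (2 * l') * (2 * l') + ((2 * (q / D) + 1) * D + j) = y at *
  generalize hx' : P / (2 * l') * (2 * l') + (2 * (q / D) * D + j) = x at *
  have hm1 : y * M + M ≤ B * M :=
    (Nat.succ_mul _ _).symm.trans_le (Nat.mul_le_mul_right _ hy)
  have hm2 : x * M ≤ y * M := Nat.mul_le_mul_right _ (by omega)
  refine WP.seq (WP.assign (x * M) ?_ ?_)
  · simp (disch := omega) [h24, h25, h30, mod_word, hx']
  refine WP.seq (WP.assign (y * M) ?_ ?_)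
  · simp (disch := omega) [h24, h25, h30, mod_word, hy']
  refine WP.seq (WP.assign (M - M / (2 * D) * (1 + 2 * j)) ?_ ?_)
  · simp (disch := omega) [h24, h30, mod_word]
  generalize he'' : M - M / (2 * D) * (1 + 2 * j) = e at *
  have heM : e ≤ M := by omega
  refine WP.seq (WP.ite_assign (c < e) (if c < e then M + c - e else c - e) (by simp)
    (fun h => ?_) (fun h => ?_) fun t1 ht1 => ?_)
  · simp (disch := omega) [h24, mod_word, h]
  · simp [h]
  generalize hk : (if c < e then M + c - e else c - e) = k
  have hkM : k < M := by split_ifs at hk <;> omega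
  set r := rot M e (fun c => A (y * M + c) - A (x * M + c)) c with hr
  have hyk := hA (y * M + k) (by omega)
  have hxk := hA (x * M + k) (by omega)
  have hyc := hA (y * M + c) (by omega)
  have hxc := hA (x * M + c) (by omega)
  have hyk' := ZMod.val_lt (A (y * M + k))
  have hxk' := ZMod.val_lt (A (x * M + k))
  have hyc' := ZMod.val_lt (A (y * M + c))
  have hxc' := ZMod.val_lt (A (x * M + c))
  refine WP.seq (WP.ite_assign (c < e) r.val (by simp) (fun h => ?_) (fun h => ?_)
    fun t2 ht2 => ?_)
  · simp (disch := omega) [h10, mod_word, hyk, hxk]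
    rw [if_pos h] at hk
    rw [val_sub_mod, hr, rot, if_neg (by omega), hk, neg_sub]
  · simp (disch := omega) [h10, mod_word, hyk, hxk]
    rw [if_neg h] at hk
    rw [val_sub_mod, hr, rot, if_pos (by omega), hk]
  have hhalf : ∀ z : ZMod p, half.val * z.val < 2 ^ w := fun z => by
    have := Nat.mul_lt_mul'' (ZMod.val_lt half) (ZMod.val_lt z)
    omega
  refine WP.ite_store (pos < l') idx (invPass M (2 * l') D half A idx).val ?_ (by simp [h31])
    (fun h => ?_) (fun h => ?_) fun t3 ht3 => ?_
  · simp (disch := omega) [h25, mod_word, hl2]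
  · simp (disch := first | omega | exact hhalf _)
      [h10, h11, mod_word, hyc, hxc, val_add_mod, val_mul_mod]
    simp [invPass, hP', hc', hpos, hq, hj', hx', hy', hl2, h]
  · simp (disch := first | omega | exact hhalf _) [h10, h11, mod_word, val_mul_mod]
    simp [invPass, hP', hc', hpos, hq, hj', hx', hy', he'', hl2, h, hr]
  · simp at ht1 ht2 ht3
    exact ⟨by omega, by simp⟩

def expandBody : Prog :=
  .assign 33 (reg 31 % reg 24) ;;
  .ite (.bin .lt (reg 33) (reg 23))
    (.store 11 (reg 31) (load 10 (reg 31 / reg 24 * reg 23 + reg 33)))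
    (.store 11 (reg 31) 0)

theorem runs_expandBody {w : ℕ} {ω : ℕ → Fin (2 ^ w)} {s : State} {p : ℕ} [Fact p.Prime]
    {m B idx : ℕ} {A : ℕ → ZMod p} (hw : 4 * (B * m) ≤ 2 ^ w)
    (hidx : idx < B * (2 * m)) (h23 : s.reg 23 = m) (h24 : s.reg 24 = 2 * m)
    (h31 : s.reg 31 = idx) (hA : Rep (s.mem 10) A (B * m)) :
    Runs w ω expandBody s 40 fun s' =>
      s'.mem 11 = Function.update (s.mem 11) idx (expand m A idx).val := by
  have hP : idx / (2 * m) < B := Nat.div_lt_of_lt_mul (by linarith)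
  have hi : ∀ c < m, idx / (2 * m) * m + c < B * m := fun c hc => by
    have : (idx / (2 * m) + 1) * m ≤ B * m := Nat.mul_le_mul_right _ hP
    rw [add_mul] at this
    omega
  unfold expandBody
  refine WP.seq (WP.assign (idx % (2 * m)) (by simp [h24, h31]) ?_)
  refine WP.ite_store (idx % (2 * m) < m) idx (expand m A idx).val (by simp [h23]) (by simp [h31])
    (fun h => ?_) (fun h => ?_) fun t3 ht3 => ?_
  · have h1 := hi _ h
    simp (disch := omega) [h23, h24, h31, mod_word]
    rw [hA _ h1, expand, if_pos h]
  · simp [expand, h]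
  · simp at ht3
    exact ⟨by omega, by simp⟩

def combineBody : Prog :=
  .assign 32 (reg 31 / reg 23) ;;
  .assign 33 (reg 31 % reg 23) ;;
  .assign 34 (reg 32 % reg 25) ;;
  .assign 35 (reg 32 / reg 25 * reg 25) ;;
  .ite (.bin .lt (reg 34) 1)
    (.assign 36 ((reg 10 -
      load 10 ((reg 35 + (reg 25 + reg 34 - 1)) * reg 24 + (reg 23 + reg 33))) % reg 10))
    (.assign 36 (load 10 ((reg 35 + (reg 34 - 1)) * reg 24 + (reg 23 + reg 33)))) ;;
  .store 11 (reg 31) ((load 10 (reg 32 * reg 24 + reg 33) + reg 36) % reg 10)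

theorem runs_combineBody {w : ℕ} {ω : ℕ → Fin (2 ^ w)} {s : State} {p : ℕ} [Fact p.Prime]
    {m l N idx : ℕ} {A : ℕ → ZMod p} (hp : 2 * (p * p) ≤ 2 ^ w)
    (hw : 4 * (N * l * (2 * m)) ≤ 2 ^ w) (hidx : idx < N * l * m)
    (h10 : s.reg 10 = p) (h23 : s.reg 23 = m) (h24 : s.reg 24 = 2 * m) (h25 : s.reg 25 = l)
    (h31 : s.reg 31 = idx) (hA : Rep (s.mem 10) A (N * l * (2 * m))) :
    Runs w ω combineBody s 90 fun s' =>
      s'.mem 11 = Function.update (s.mem 11) idx (combine m l A idx).val := by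
  have hm0 : 0 < m := Nat.pos_of_mul_pos_left (by omega : 0 < N * l * m)
  have hNl : 0 < N * l := Nat.pos_of_mul_pos_right (by omega : 0 < N * l * m)
  have hl0 : 0 < l := Nat.pos_of_mul_pos_left hNl
  have hP : idx / m < N * l := Nat.div_lt_of_lt_mul (by linarith)
  have hc : idx % m < m := Nat.mod_lt _ hm0
  have hr : idx / m % l < l := Nat.mod_lt _ hl0
  have hQ : idx / m / l < N := Nat.div_lt_of_lt_mul (by linarith)
  have hQl : (idx / m / l + 1) * l ≤ N * l := Nat.mul_le_mul_right _ hQ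
  have hpp : p ≤ p * p := Nat.le_mul_self p
  have hNlm : N * l ≤ N * l * (2 * m) := Nat.le_mul_of_pos_right _ (by omega)
  have hmN : 2 * m ≤ N * l * (2 * m) := Nat.le_mul_of_pos_left _ (by omega)
  rw [add_mul, one_mul] at hQl
  have hi : ∀ x < N * l, x * (2 * m) + 2 * m ≤ N * l * (2 * m) := fun x hx => by
    have : (x + 1) * (2 * m) ≤ N * l * (2 * m) := Nat.mul_le_mul_right _ hx
    rw [add_mul] at this
    omega
  unfold combineBody
  refine WP.seq (WP.assign (idx / m) (by simp [h23, h31]) ?_)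
  refine WP.seq (WP.assign (idx % m) (by simp [h23, h31]) ?_)
  refine WP.seq (WP.assign (idx / m % l) (by simp [h25]) ?_)
  refine WP.seq (WP.assign (idx / m / l * l) ?_ ?_)
  · simp (disch := omega) [h25, mod_word]
  generalize hP' : idx / m = P at *
  generalize hc' : idx % m = c at *
  generalize hr' : P % l = r at *
  generalize hQ' : P / l * l = Q at *
  set v := rot l 1 (fun r => A ((Q + r) * (2 * m) + (m + c))) r with hv
  have hPi := hi P hP
  refine WP.seq (WP.ite_assign (r < 1) v.val ?_ (fun h => ?_) (fun h => ?_)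
    fun t1 ht1 => ?_)
  · simp (disch := omega) [mod_word]
  · have h1 := hi (Q + (l + r - 1)) (by omega)
    have h2 := hA ((Q + (l + r - 1)) * (2 * m) + (m + c)) (by omega)
    simp (disch := omega) [h10, h23, h24, h25, mod_word, h2]
    rw [val_neg_mod, hv, rot, if_neg (by omega)]
  · have h1 := hi (Q + (r - 1)) (by omega)
    have h2 := hA ((Q + (r - 1)) * (2 * m) + (m + c)) (by omega)
    simp (disch := omega) [h23, h24, mod_word, h2]
    rw [hv, rot, if_pos (by omega)]
  have h3 := hA (P * (2 * m) + c) (by omega)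
  have h4 := ZMod.val_lt (A (P * (2 * m) + c))
  have h5 := ZMod.val_lt v
  refine WP.store idx (combine m l A idx).val (by simp [h31]) ?_ ?_
  · simp (disch := omega) [h10, h24, mod_word, h3, val_add_mod]
    simp [combine, hP', hc', hr', hQ', hv]
  · simp at ht1
    refine ⟨by simp; omega, by simp⟩

end WordRAM


/-! ### The forward transforms of one recursion level -/

namespace WordRAM

open WordRAM.Expr WordRAM.Prog Negacyclic

def copyBody : Prog := .store 10 (reg 31) (load 11 (reg 31))

/-- Compute the new contents of the array `10` in the array `11`, and copy them back. -/
def stage (body : Prog) : Prog := forUp 31 28 body ;; forUp 31 28 copyBody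

theorem runs_stage {w : ℕ} {ω : ℕ → Fin (2 ^ w)} {body : Prog} {s : State} {p n : ℕ}
    (G : ℕ → ZMod p) (c : ℕ) (hi : body.wr 31 = false) (hb : (forUp 31 28 body).wr 28 = false)
    (h28 : s.reg 28 = n) (hn : n < 2 ^ w)
    (hs : ∀ j s', j < n → s'.reg 31 = j → Same (forUp 31 28 body) s s' →
      Runs w ω body s' c fun s'' => s''.mem 11 = Function.update (s'.mem 11) j (G j).val) :
    Runs w ω (stage body) s (n * (c + 20) + 12) fun s' => Rep (s'.mem 10) G n := by
  refine ((runs_map 11 n (fun j => (G j).val) c hi hb h28 hn hs).seq (fun s1 hs1 h1 => ?_)).mono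
    (B := n * (c + 8) + 6 + (n * (4 + 8) + 6)) (by ring_nf; rfl) fun _ _ h => h
  refine (runs_map 10 n (fun j => (G j).val) 4 rfl rfl ((hs1.reg 28 hb).trans h28) hn ?_).mono
    le_rfl fun s2 _ h => ?_
  · intro j s2 hj h31 hs2
    refine WP.store j (G j).val (by simp [h31]) ?_ ?_
    · simp [h31, hs2.mem 11 rfl, h1, hj]
    · simp
  · intro j hj
    simp [h, hj]

/-- Set the parameters of a level from the register `22`. -/
def setLevel : Prog :=
  .assign 26 (reg 22 - reg 22 / 2 + 1) ;;
  .assign 23 (.bin .shl 1 (reg 22 / 2 + 2)) ;;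
  .assign 24 (reg 23 + reg 23) ;;
  .assign 25 (.bin .shl 1 (reg 26))

theorem runs_setLevel {w : ℕ} {ω : ℕ → Fin (2 ^ w)} {s : State} {x : ℕ} (hx : s.reg 22 = x)
    (hw : 2 ^ (x + 3) < 2 ^ w) :
    Runs w ω setLevel s 30 fun s' => s'.reg 26 = x - x / 2 + 1 ∧ s'.reg 23 = 2 ^ (x / 2 + 2) ∧
      s'.reg 24 = 2 * 2 ^ (x / 2 + 2) ∧ s'.reg 25 = 2 ^ (x - x / 2 + 1) ∧ s'.reg 22 = x := by
  have h1 : x + 3 < 2 ^ (x + 3) := Nat.lt_two_pow_self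
  have h2 : 2 ^ (x / 2 + 2) ≤ 2 ^ (x + 3 - 1) := Nat.pow_le_pow_right (by norm_num) (by omega)
  have h3 : 2 ^ (x - x / 2 + 1) ≤ 2 ^ (x + 3) := Nat.pow_le_pow_right (by norm_num) (by omega)
  have h4 : 2 ^ (x + 3) = 2 * 2 ^ (x + 3 - 1) := by rw [← pow_succ', Nat.sub_add_cancel (by omega)]
  refine WP.seq (WP.assign (x - x / 2 + 1) ?_ ?_)
  · simp (disch := omega) [hx, mod_word]
  refine WP.seq (WP.assign (2 ^ (x / 2 + 2)) ?_ ?_)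
  · simp (disch := omega) [hx, mod_word, Nat.shiftLeft_eq]
  refine WP.seq (WP.assign (2 * 2 ^ (x / 2 + 2)) ?_ ?_)
  · simp (disch := omega) [mod_word]
    ring
  refine WP.assign (2 ^ (x - x / 2 + 1)) ?_ ?_
  · simp (disch := omega) [mod_word, Nat.shiftLeft_eq]
  · simp [hx]

/-- The transforms of one level. Register `12` holds the logarithm `u` of the size, register `20`
the level, register `27` the number of products. -/
def fwdLevel : Prog :=
  .assign 22 (.bin .shr (reg 12) (reg 20)) ;;
  .ite (.bin .lt 0 (reg 22))
    (setLevel ;;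
     .assign 27 (reg 27 * reg 25) ;;
     .assign 28 (2 * (reg 27 * reg 24)) ;;
     stage expandBody ;;
     forUp 29 26 (.assign 30 (.bin .shl 1 (reg 29)) ;; stage passBody))
    .skip

/-- The effect of the transforms of a level whose products have size `2 ^ (x + 3)`. -/
def fwdFn {F : Type} [Field F] (x : ℕ) (A : ℕ → F) : ℕ → F :=
  if 0 < x then fwdIter (2 * 2 ^ (x / 2 + 2)) (2 ^ (x - x / 2 + 1)) (expand (2 ^ (x / 2 + 2)) A)
    (x - x / 2 + 1) else A

/-- The number of products after a level. -/
def nextN (x N : ℕ) : ℕ := if 0 < x then N * 2 ^ (x - x / 2 + 1) else N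

/-- A product of length `2 ^ (x + 3)` is cut into `2 ^ (x - x / 2 + 1)` pieces of length `2 ^ (x / 2
+ 2)`. The padded pieces have length `2 ^ (x / 2 + 3)`, so the recursion replaces `x` by `x / 2`,
and that ring has enough roots because `x - x / 2 + 1 ≤ x / 2 + 3`. -/
theorem level_size {x : ℕ} :
    2 ^ (x - x / 2 + 1) * 2 ^ (x / 2 + 2) = 2 ^ (x + 3) := by
  rw [← pow_add]; congr 1; omega

theorem runs_fwdLevel {w : ℕ} {ω : ℕ → Fin (2 ^ w)} {s : State} {p : ℕ} [Fact p.Prime]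
    {u i x N : ℕ} {A : ℕ → ZMod p} (hp : 2 * (p * p) ≤ 2 ^ w)
    (hw : 16 * (N * 2 ^ (x + 3)) ≤ 2 ^ w) (hN : 0 < N) (hx : x = u / 2 ^ i)
    (h10 : s.reg 10 = p) (h12 : s.reg 12 = u) (h20 : s.reg 20 = i) (h27 : s.reg 27 = N)
    (hA : Rep (s.mem 10) A (2 * (N * 2 ^ (x + 3)))) :
    Runs w ω fwdLevel s (800 * (x + 2) * (N * 2 ^ (x + 3))) fun s' =>
      Rep (s'.mem 10) (fwdFn x A) (2 * (nextN x N * 2 ^ (x / 2 + 3))) ∧ s'.reg 27 = nextN x N := by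
  have hn8 : 8 ≤ N * 2 ^ (x + 3) := by
    have : 2 ^ 3 ≤ 2 ^ (x + 3) := Nat.pow_le_pow_right (by norm_num) (by omega)
    nlinarith
  have hxn : 2 ^ (x + 3) ≤ N * 2 ^ (x + 3) := Nat.le_mul_of_pos_left _ hN
  have hpp : p ≤ p * p := Nat.le_mul_self p
  unfold fwdLevel
  refine WP.seq (WP.assign x (by simp [h12, h20, hx, Nat.shiftRight_eq_div_pow]) ?_)
  refine WP.ite (0 < x) (by simp) (fun hx0 => ?_) (fun hx0 => ?_)
  swap
  · have : x = 0 := by omega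
    subst this
    refine WP.skip ⟨?_, ?_⟩
    · simp
      omega
    · simpa [fwdFn, nextN, h27] using hA
  refine WP.seq (WP.call (runs_setLevel (x := x) (by simp) (by omega)) ?_)
  rintro s1 t1 ht1 hs1 ⟨h26, h23, h24, h25, -⟩
  simp only [size_bin, size_reg, size_lit] at ht1
  have hsz := level_size (x := x)
  have hMl : N * 2 ^ (x - x / 2 + 1) * (2 * 2 ^ (x / 2 + 2)) = 2 * (N * 2 ^ (x + 3)) := by
    rw [← hsz]; ring
  generalize hm : 2 ^ (x / 2 + 2) = m at *
  have hlp : 2 ^ (x - x / 2 + 1) = 2 * 2 ^ (x - x / 2) := by ring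
  generalize hlam : x - x / 2 + 1 = lam at *
  have hm0 : 0 < m := by rw [← hm]; positivity
  have hNl : N * 2 ^ lam ≤ N * 2 ^ lam * (2 * m) := Nat.le_mul_of_pos_right _ (by omega)
  refine WP.seq (WP.assign (N * 2 ^ lam) ?_ ?_)
  · have := hs1.reg 27 rfl
    simp at this
    simp (disch := omega) [this, h27, h25, mod_word]
  refine WP.seq (WP.assign (2 * (N * 2 ^ lam * (2 * m))) ?_ ?_)
  · simp (disch := omega) [h24, mod_word]
  generalize hn : N * 2 ^ (x + 3) = n at *
  have hn1 : 2 * (N * 2 ^ lam) * m = 2 * n := by rw [← hn, ← hsz]; ring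
  have hn2 : 2 * (N * 2 ^ lam) * (2 * m) = 4 * n := by rw [← hn, ← hsz]; ring
  set s3 := (s1.setR 27 (N * 2 ^ lam)).setR 28 (2 * (N * 2 ^ lam * (2 * m))) with hs3
  have hA1 : Rep (s3.mem 10) A (2 * (N * 2 ^ lam) * m) := by
    rw [hn1]
    simpa [hs3, hs1.mem 10 rfl] using hA
  refine WP.seq (WP.call (runs_stage (n := 4 * n) (expand m A) 40 rfl rfl (by simp [hs3]; omega)
    (by omega) ?_) ?_)
  · intro j s' hj h31 hs'
    refine runs_expandBody (B := 2 * (N * 2 ^ lam)) (by omega) (by omega)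
      ((hs'.reg 23 rfl).trans (by simp [hs3, h23])) ((hs'.reg 24 rfl).trans (by simp [hs3, h24]))
      h31 ?_
    rw [hs'.mem 10 rfl]
    exact hA1
  intro s4 t4 ht4 hs4 hA4
  have hlam' : x < 2 ^ x := Nat.lt_two_pow_self
  refine WP.call (runs_forUp_const (n := lam) (fun d s' => Rep (s'.mem 10)
    (fwdIter (2 * m) (2 ^ lam) (expand m A) d) (4 * n)) (4 + (4 * n * (150 + 20) + 12)) rfl rfl
    ((hs4.reg 26 rfl).trans (by simp [hs3, h26])) ?_ ?_ ?_) ?_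
  · have : 2 ^ (x + 3) = 8 * 2 ^ x := by ring
    omega
  · simpa [fwdIter] using hA4
  · intro d s5 hd h29 hs5 hA5
    have hdw : 2 ^ d ≤ 2 ^ (x - x / 2) := Nat.pow_le_pow_right (by norm_num) (by omega)
    have hNl2 : 2 ^ lam ≤ N * 2 ^ lam := Nat.le_mul_of_pos_left _ hN
    refine Runs.seq (B := 4) (R := fun s' => s' = s5.setR 30 (2 ^ d))
      (WP.assign (2 ^ d) ?_ ?_) ?_
    · simp (disch := omega) [h29, mod_word, Nat.shiftLeft_eq]
    · simp
    rintro s6 hs6 rfl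
    refine (runs_stage (n := 4 * n) (fwdPass (2 * m) (2 ^ lam) (2 ^ d)
      (fwdIter (2 * m) (2 ^ lam) (expand m A) d)) 150 rfl rfl ?_ (by omega) ?_).mono le_rfl
      fun _ _ h => by simpa [fwdIter] using h
    · simp [hs5.reg 28 rfl, hs4.reg 28 rfl, hs3]; omega
    · intro j s7 hj h31 hs7
      have h10' : s7.reg 10 = p := by
        simp [hs7.reg 10 rfl, hs5.reg 10 rfl, hs4.reg 10 rfl, hs3, hs1.reg 10 rfl, h10]
      have h24' : s7.reg 24 = 2 * m := by
        simp [hs7.reg 24 rfl, hs5.reg 24 rfl, hs4.reg 24 rfl, hs3, h24]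
      have h25' : s7.reg 25 = 2 ^ lam := by
        simp [hs7.reg 25 rfl, hs5.reg 25 rfl, hs4.reg 25 rfl, hs3, h25]
      have h30' : s7.reg 30 = 2 ^ d := by simp [hs7.reg 30 rfl]
      rw [hlp] at h25' ⊢
      refine runs_passBody (B := 2 * (N * 2 ^ lam)) (by omega) (by omega) (by positivity)
        (pow_dvd_pow 2 (by omega)) (by positivity) ?_ (by omega) h10' h24' h25' h30' h31 ?_
      · exact ⟨N * 2, by rw [hlp]; ring⟩
      · rw [hs7.mem 10 rfl, hn2, ← hlp]
        exact hA5
  · intro s8 t8 ht8 hs8 hA8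
    refine ⟨?_, ?_, ?_⟩
    · simp at ht8 ht4
      have h9 : lam * (4 + (4 * n * (150 + 20) + 12) + 8) ≤ (x + 1) * (4 + (4 * n * (150 + 20) + 12) + 8) :=
        Nat.mul_le_mul_right _ (by omega)
      nlinarith
    · have : nextN x N * 2 ^ (x / 2 + 3) = 2 * n := by
        rw [nextN, if_pos hx0, hlam, ← hMl, ← hm]; ring
      rw [this]
      rw [fwdFn, if_pos hx0, hlam, hm, show 2 * (2 * n) = 4 * n by ring]
      exact hA8
    · rw [hs8.reg 27 rfl, hs4.reg 27 rfl, nextN, if_pos hx0, hlam]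
      simp [hs3]

end WordRAM


/-! ### The inverse transforms of one level, and the products of length eight -/

namespace WordRAM

open WordRAM.Expr WordRAM.Prog Negacyclic

/-- The inverse transforms of one level. -/
def bwdLevel : Prog :=
  .assign 22 (.bin .shr (reg 12) (reg 12 - 1 - reg 20)) ;;
  .ite (.bin .lt 0 (reg 22))
    (setLevel ;;
     .assign 28 (reg 27 * reg 24) ;;
     forUp 29 26 (.assign 30 (.bin .shl 1 (reg 26 - 1 - reg 29)) ;; stage invBody) ;;
     .assign 27 (reg 27 / reg 25) ;;
     .assign 28 (reg 27 * reg 25 * reg 23) ;;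
     stage combineBody)
    .skip

/-- The effect of the inverse transforms of a level whose products have size `2 ^ (x + 3)`. -/
def bwdFn {F : Type} [Field F] (x : ℕ) (half : F) (Z : ℕ → F) : ℕ → F :=
  if 0 < x then combine (2 ^ (x / 2 + 2)) (2 ^ (x - x / 2 + 1))
    (invIter (2 * 2 ^ (x / 2 + 2)) (2 ^ (x - x / 2 + 1)) (x - x / 2 + 1) half Z (x - x / 2 + 1))
  else Z

theorem runs_bwdLevel {w : ℕ} {ω : ℕ → Fin (2 ^ w)} {s : State} {p : ℕ} [Fact p.Prime]
    {u k x N : ℕ} {A : ℕ → ZMod p} {half : ZMod p} (hp : 2 * (p * p) ≤ 2 ^ w)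
    (hw : 16 * (N * 2 ^ (x + 3)) ≤ 2 ^ w) (hN : 0 < N) (hx : x = u / 2 ^ (u - 1 - k))
    (hu : u < 2 ^ w)
    (h10 : s.reg 10 = p) (h11 : s.reg 11 = half.val) (h12 : s.reg 12 = u) (h20 : s.reg 20 = k)
    (h27 : s.reg 27 = nextN x N) (hA : Rep (s.mem 10) A (nextN x N * 2 ^ (x / 2 + 3))) :
    Runs w ω bwdLevel s (800 * (x + 2) * (N * 2 ^ (x + 3))) fun s' =>
      Rep (s'.mem 10) (bwdFn x half A) (N * 2 ^ (x + 3)) ∧ s'.reg 27 = N := by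
  have hn8 : 8 ≤ N * 2 ^ (x + 3) := by
    have : 2 ^ 3 ≤ 2 ^ (x + 3) := Nat.pow_le_pow_right (by norm_num) (by omega)
    nlinarith
  have hxn : 2 ^ (x + 3) ≤ N * 2 ^ (x + 3) := Nat.le_mul_of_pos_left _ hN
  have hpp : p ≤ p * p := Nat.le_mul_self p
  unfold bwdLevel
  refine WP.seq (WP.assign x ?_ ?_)
  · simp (disch := omega) [h12, h20, hx, Nat.shiftRight_eq_div_pow, mod_word]
  refine WP.ite (0 < x) (by simp) (fun hx0 => ?_) (fun hx0 => ?_)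
  swap
  · have : x = 0 := by omega
    subst this
    refine WP.skip ⟨?_, ?_⟩
    · simp
      omega
    · simpa [bwdFn, nextN, h27] using hA
  refine WP.seq (WP.call (runs_setLevel (x := x) (by simp) (by omega)) ?_)
  rintro s1 t1 ht1 hs1 ⟨h26, h23, h24, h25, -⟩
  simp only [size_bin, size_reg, size_lit, size_sub] at ht1
  have hsz := level_size (x := x)
  have hMl : N * 2 ^ (x - x / 2 + 1) * (2 * 2 ^ (x / 2 + 2)) = 2 * (N * 2 ^ (x + 3)) := by
    rw [← hsz]; ring
  have hA' : Rep (s.mem 10) A (N * 2 ^ (x - x / 2 + 1) * (2 * 2 ^ (x / 2 + 2))) := by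
    rw [nextN, if_pos hx0] at hA
    convert hA using 2
    ring
  rw [nextN, if_pos hx0] at h27
  unfold bwdFn
  rw [if_pos hx0]
  have hlp : 2 ^ (x - x / 2 + 1) = 2 * 2 ^ (x - x / 2) := by ring
  generalize hm : 2 ^ (x / 2 + 2) = m at *
  generalize hlam : x - x / 2 + 1 = lam at *
  have hm0 : 0 < m := by rw [← hm]; positivity
  have hNl : N * 2 ^ lam ≤ N * 2 ^ lam * (2 * m) := Nat.le_mul_of_pos_right _ (by omega)
  have hNl2 : 2 ^ lam ≤ N * 2 ^ lam := Nat.le_mul_of_pos_left _ hN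
  have h27' : s1.reg 27 = N * 2 ^ lam := by
    have := hs1.reg 27 rfl
    simpa [h27] using this
  refine WP.seq (WP.assign (N * 2 ^ lam * (2 * m)) ?_ ?_)
  · simp (disch := omega) [h24, h27', mod_word]
  generalize hn : N * 2 ^ (x + 3) = n at *
  have hn1 : N * 2 ^ lam * m = n := by rw [← hn, ← hsz]; ring
  set s3 := s1.setR 28 (N * 2 ^ lam * (2 * m)) with hs3
  have hlam' : x < 2 ^ x := Nat.lt_two_pow_self
  refine WP.seq (WP.call (runs_forUp_const (n := lam) (fun d s' => Rep (s'.mem 10)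
    (invIter (2 * m) (2 ^ lam) lam half A d) (2 * n)) (8 + (2 * n * (200 + 20) + 12)) rfl rfl
    (by simp [hs3, h26]) ?_ ?_ ?_) ?_)
  · have : 2 ^ (x + 3) = 8 * 2 ^ x := by ring
    omega
  · rw [← hMl]
    simpa [hs3, hs1.mem 10 rfl, invIter] using hA'
  · intro d s5 hd h29 hs5 hA5
    have hdw : 2 ^ (lam - 1 - d) ≤ 2 ^ (x - x / 2) :=
      Nat.pow_le_pow_right (by norm_num) (by omega)
    refine Runs.seq (B := 8) (R := fun s' => s' = s5.setR 30 (2 ^ (lam - 1 - d)))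
      (WP.assign (2 ^ (lam - 1 - d)) ?_ ?_) ?_
    · have h26' : s5.reg 26 = lam := by simp [hs5.reg 26 rfl, hs3, h26]
      simp (disch := omega) [h29, h26', mod_word, Nat.shiftLeft_eq]
    · simp
    rintro s6 hs6 rfl
    refine (runs_stage (n := 2 * n) (invPass (2 * m) (2 ^ lam) (2 ^ (lam - 1 - d)) half
      (invIter (2 * m) (2 ^ lam) lam half A d)) 200 rfl rfl ?_ (by omega) ?_).mono le_rfl
      fun _ _ h => by simpa [invIter] using h
    · simp [hs5.reg 28 rfl, hs3]; omega
    · intro j s7 hj h31 hs7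
      have h10' : s7.reg 10 = p := by
        simp [hs7.reg 10 rfl, hs5.reg 10 rfl, hs3, hs1.reg 10 rfl, h10]
      have h11' : s7.reg 11 = half.val := by
        simp [hs7.reg 11 rfl, hs5.reg 11 rfl, hs3, hs1.reg 11 rfl, h11]
      have h24' : s7.reg 24 = 2 * m := by simp [hs7.reg 24 rfl, hs5.reg 24 rfl, hs3, h24]
      have h25' : s7.reg 25 = 2 ^ lam := by simp [hs7.reg 25 rfl, hs5.reg 25 rfl, hs3, h25]
      have h30' : s7.reg 30 = 2 ^ (lam - 1 - d) := by simp [hs7.reg 30 rfl]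
      rw [hlp] at h25' ⊢
      refine runs_invBody (B := N * 2 ^ lam) (by omega) (by omega) (by positivity)
        (pow_dvd_pow 2 (by omega)) (by positivity) ?_ (by omega) h10' h11' h24' h25' h30' h31 ?_
      · exact ⟨N, by rw [hlp]; ring⟩
      · rw [hs7.mem 10 rfl, hMl, ← hlp]
        exact hA5
  intro s8 t8 ht8 hs8 hA8
  refine WP.seq (WP.assign N ?_ ?_)
  · simp [hs8.reg 27 rfl, hs8.reg 25 rfl, hs3, h27', h25]
  refine WP.seq (WP.assign (N * 2 ^ lam * m) ?_ ?_)
  · simp (disch := omega) [hs8.reg 25 rfl, hs8.reg 23 rfl, hs3, h25, h23, mod_word]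
  refine WP.call (runs_stage (n := n) (combine m (2 ^ lam) (invIter (2 * m) (2 ^ lam) lam half A
    lam)) 90 rfl rfl (by simp [hn1]) (by omega) ?_) ?_
  · intro j s9 hj h31 hs9
    have h10' : s9.reg 10 = p := by
      simp [hs9.reg 10 rfl, hs8.reg 10 rfl, hs3, hs1.reg 10 rfl, h10]
    have h23' : s9.reg 23 = m := by simp [hs9.reg 23 rfl, hs8.reg 23 rfl, hs3, h23]
    have h24' : s9.reg 24 = 2 * m := by simp [hs9.reg 24 rfl, hs8.reg 24 rfl, hs3, h24]
    have h25' : s9.reg 25 = 2 ^ lam := by simp [hs9.reg 25 rfl, hs8.reg 25 rfl, hs3, h25]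
    refine runs_combineBody (N := N) hp (by omega) (by omega) h10' h23' h24' h25' h31 ?_
    rw [hs9.mem 10 rfl, hMl]
    exact hA8
  · intro s10 t10 ht10 hs10 hA10
    refine ⟨?_, hA10, by simp [hs10.reg 27 rfl]⟩
    simp at ht8 ht10
    have h9 : lam * (8 + (2 * n * (200 + 20) + 12) + 8) ≤
        (x + 1) * (8 + (2 * n * (200 + 20) + 12) + 8) :=
      Nat.mul_le_mul_right _ (by omega)
    nlinarith

/-- The schoolbook products of size `8`. -/
def baseFn {F : Type} [Field F] (N : ℕ) (A : ℕ → F) (idx : ℕ) : F :=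
  nega 8 (fun c => A (idx / 8 * 8 + c)) (fun c => A ((N + idx / 8) * 8 + c)) (idx % 8)

theorem blk_baseFn {F : Type} [Field F] (N : ℕ) (A : ℕ → F) (Q : ℕ) :
    blk 8 (baseFn N A) Q = blk 8 A Q * blk 8 A (N + Q) := by
  rw [blk, blk, blk, mk_poly, mk_poly, mk_poly, ← sum_nega _ _ (xi_pow 8)]
  refine Finset.sum_congr rfl fun c hc => ?_
  rw [baseFn, (blk_index (Finset.mem_range.1 hc)).1, (blk_index (Finset.mem_range.1 hc)).2,
    map_nega]

def baseBody : Prog :=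
  .assign 32 (reg 31 % 8) ;;
  .assign 33 (reg 31 / 8 * 8) ;;
  .assign 34 ((reg 27 + reg 31 / 8) * 8) ;;
  .assign 35 8 ;;
  .assign 36 0 ;;
  forUp 37 35
    (.ite (.bin .lt (reg 32) (reg 37))
      (.assign 38 ((reg 10 - load 10 (reg 34 + (8 + reg 32 - reg 37))) % reg 10))
      (.assign 38 (load 10 (reg 34 + (reg 32 - reg 37)))) ;;
     .assign 36 ((reg 36 + load 10 (reg 33 + reg 37) * reg 38) % reg 10)) ;;
  .store 11 (reg 31) (reg 36)

theorem runs_baseBody {w : ℕ} {ω : ℕ → Fin (2 ^ w)} {s : State} {p : ℕ} [Fact p.Prime]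
    {N idx : ℕ} {A : ℕ → ZMod p} (hp : 2 * (p * p) ≤ 2 ^ w)
    (hw : 32 * N ≤ 2 ^ w) (hidx : idx < N * 8)
    (h10 : s.reg 10 = p) (h27 : s.reg 27 = N) (h31 : s.reg 31 = idx)
    (hA : Rep (s.mem 10) A (2 * (N * 8))) :
    Runs w ω baseBody s 600 fun s' =>
      s'.mem 11 = Function.update (s.mem 11) idx (baseFn N A idx).val := by
  have hpp : p ≤ p * p := Nat.le_mul_self p
  have hq : idx / 8 < N := by omega
  have hc : idx % 8 < 8 := Nat.mod_lt _ (by norm_num)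
  unfold baseBody
  refine WP.seq (WP.assign (idx % 8) ?_ ?_)
  · simp (disch := omega) [h31, mod_word]
  refine WP.seq (WP.assign (idx / 8 * 8) ?_ ?_)
  · simp (disch := omega) [h31, mod_word]
  refine WP.seq (WP.assign ((N + idx / 8) * 8) ?_ ?_)
  · simp (disch := omega) [h31, h27, mod_word]
  refine WP.seq (WP.assign 8 ?_ ?_)
  · simp (disch := omega) [mod_word]
  refine WP.seq (WP.assign 0 (by simp) ?_)
  have hbase : baseFn N A idx = nega 8 (fun c => A (idx / 8 * 8 + c))
    (fun c => A ((N + idx / 8) * 8 + c)) (idx % 8) := rfl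
  generalize hq' : idx / 8 = q at *
  generalize hc' : idx % 8 = c at *
  let f : ℕ → ZMod p := fun c => A (q * 8 + c)
  let g : ℕ → ZMod p := fun c => A ((N + q) * 8 + c)
  refine WP.seq (WP.call (runs_forUp_const (n := 8) (fun k s' => s'.reg 36 =
    (∑ a ∈ Finset.range k, f a * rot 8 a g c).val) 40 rfl rfl (by simp) (by omega) (by simp) ?_) ?_)
  · intro a s1 ha h37 hs1 h36
    have h32' : s1.reg 32 = c := by simp [hs1.reg 32 rfl]
    have h33' : s1.reg 33 = q * 8 := by simp [hs1.reg 33 rfl]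
    have h34' : s1.reg 34 = (N + q) * 8 := by simp [hs1.reg 34 rfl]
    have h10' : s1.reg 10 = p := by simp [hs1.reg 10 rfl, h10]
    have hA' : Rep (s1.mem 10) A (2 * (N * 8)) := by rw [hs1.mem 10 rfl]; exact hA
    refine WP.seq (WP.ite_assign (c < a) (rot 8 a g c).val (by simp [h32', h37])
      (fun h => ?_) (fun h => ?_) fun t1 ht1 => ?_)
    · have h1 := hA' ((N + q) * 8 + (8 + c - a)) (by omega)
      simp (disch := omega) [h10', h32', h34', h37, mod_word, h1]
      rw [val_neg_mod, rot, if_neg (by omega)]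
    · have h1 := hA' ((N + q) * 8 + (c - a)) (by omega)
      simp (disch := omega) [h32', h34', h37, mod_word, h1]
      rw [rot, if_pos (by omega)]
    have h1 := hA' (q * 8 + a) (by omega)
    have h2 := ZMod.val_lt (∑ a ∈ Finset.range a, f a * rot 8 a g c)
    have h3 : (A (q * 8 + a)).val * (rot 8 a g c).val < p * p :=
      Nat.mul_lt_mul'' (ZMod.val_lt _) (ZMod.val_lt _)
    refine WP.assign (∑ a ∈ Finset.range (a + 1), f a * rot 8 a g c).val ?_ ?_
    · simp (disch := omega) [h10', h33', h37, h36, mod_word, h1]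
      rw [Finset.sum_range_succ, ← val_add_mod, ← val_mul_mod, Nat.add_mod_mod]
    · simp at ht1 ⊢
      omega
  · intro s2 t2 ht2 hs2 h36
    refine WP.store idx (baseFn N A idx).val (by simp [hs2.reg 31 rfl, h31]) ?_ ?_
    · simp [h36, hbase, nega, f, g]
    · simp at ht2
      refine ⟨by simp; omega, by simp [hs2.mem 11 rfl]⟩

end WordRAM


/-! ### The recursion as a whole: negacyclic convolution -/

namespace WordRAM

open WordRAM.Expr WordRAM.Prog Negacyclic

/-- The number of products before level `i`. -/
def numProd (u : ℕ) : ℕ → ℕ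
  | 0 => 1
  | i + 1 => nextN (u / 2 ^ i) (numProd u i)

/-- The array before level `i`. -/
def fwdArr {F : Type} [Field F] (u : ℕ) (A : ℕ → F) : ℕ → ℕ → F
  | 0 => A
  | i + 1 => fwdFn (u / 2 ^ i) (fwdArr u A i)

theorem numProd_pos (u i : ℕ) : 0 < numProd u i := by
  induction i with
  | zero => simp [numProd]
  | succ i ih =>
    rw [numProd, nextN]
    split_ifs <;> positivity

theorem div_two_pow_succ (u i : ℕ) : u / 2 ^ (i + 1) = u / 2 ^ i / 2 := by
  rw [pow_succ, Nat.div_div_eq_div_mul]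

theorem nextN_size {x N : ℕ} (hx : 0 < x) :
    nextN x N * 2 ^ (x / 2 + 3) = 2 * (N * 2 ^ (x + 3)) := by
  have := level_size (x := x)
  rw [nextN, if_pos hx, ← this]
  ring

/-- The zero padding doubles the total length at each level that does anything. -/
theorem numProd_size (u i : ℕ) : numProd u i * 2 ^ (u / 2 ^ i + 3) ≤ 2 ^ i * 2 ^ (u + 3) := by
  induction i with
  | zero => simp [numProd]
  | succ i ih =>
    rw [numProd, div_two_pow_succ]
    rcases Nat.eq_zero_or_pos (u / 2 ^ i) with h | h
    · rw [h] at ih ⊢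
      simp only [nextN, lt_irrefl, if_false, Nat.zero_div]
      refine ih.trans (Nat.mul_le_mul_right _ (Nat.pow_le_pow_right (by norm_num) (by omega)))
    · rw [nextN_size h, pow_succ' 2 i, mul_assoc]
      exact Nat.mul_le_mul_left _ ih

/-- The doubling stops once `u / 2 ^ i = 0`, so it has happened only while `2 ^ i ≤ u`; the total
padding is a factor linear in `u`, that is, logarithmic in the length. -/
theorem numProd_size_le (u i : ℕ) :
    numProd u i * 2 ^ (u / 2 ^ i + 3) ≤ (2 * u + 1) * 2 ^ (u + 3) := by
  induction i with
  | zero =>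
    simp only [numProd, pow_zero, Nat.div_one]
    exact Nat.mul_le_mul_right _ (by omega)
  | succ i ih =>
    rw [numProd, div_two_pow_succ]
    rcases Nat.eq_zero_or_pos (u / 2 ^ i) with h | h
    · rw [h] at ih ⊢
      simpa only [nextN, lt_irrefl, if_false, Nat.zero_div] using ih
    · rw [nextN_size h]
      have h1 : 2 ^ i ≤ u := by
        by_contra hc
        rw [Nat.div_eq_of_lt (by omega)] at h
        omega
      have := numProd_size u i
      have h2 : 2 ^ i * 2 ^ (u + 3) ≤ u * 2 ^ (u + 3) := Nat.mul_le_mul_right _ h1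
      calc _ ≤ 2 * (u * 2 ^ (u + 3)) := Nat.mul_le_mul_left _ (this.trans h2)
        _ ≤ _ := by rw [← mul_assoc]; exact Nat.mul_le_mul_right _ (by omega)

/-- The array `Z` holds the products of level `i`. -/
def Products {F : Type} [Field F] (u : ℕ) (A : ℕ → F) (i : ℕ) (Z : ℕ → F) : Prop :=
  ∀ Q < numProd u i, blk (2 ^ (u / 2 ^ i + 3)) Z Q =
    blk (2 ^ (u / 2 ^ i + 3)) (fwdArr u A i) Q *
    blk (2 ^ (u / 2 ^ i + 3)) (fwdArr u A i) (numProd u i + Q)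

/-- This is `blk_combine` with `mu = x / 2 + 3`. For `x = 0` the level is idle in both directions.
-/
theorem Products.bwdFn {F : Type} [Field F] {u i : ℕ} {A Z : ℕ → F} {half : F}
    (hh : 2 * half = 1) (h : Products u A (i + 1) Z) :
    Products u A i (bwdFn (u / 2 ^ i) half Z) := by
  intro Q hQ
  rw [Products, fwdArr, numProd, div_two_pow_succ] at h
  generalize u / 2 ^ i = x at *
  generalize numProd u i = N at *
  generalize fwdArr u A i = B at *
  rcases Nat.eq_zero_or_pos x with hx | hx
  · subst hx
    simpa [nextN, WordRAM.bwdFn, fwdFn, hQ] using h Q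
  · simp only [nextN, WordRAM.bwdFn, fwdFn, if_pos hx] at h ⊢
    have h1 := blk_combine (F := F) (mu := x / 2 + 3) (lam := x - x / 2 + 1) (by omega) (by omega)
      hh (A := B) (Z := Z) (N := N)
    rw [show x / 2 + 3 - 1 = x / 2 + 2 by omega, pow_succ' 2 (x / 2 + 2), level_size] at h1
    rw [pow_succ' 2 (x / 2 + 2)] at h
    exact h1 h hQ

theorem eq_nega_of_products {F : Type} [Field F] {u : ℕ} {A Z : ℕ → F}
    (h : Products u A 0 Z) {c : ℕ} (hc : c < 2 ^ (u + 3)) :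
    Z c = nega (2 ^ (u + 3)) A (fun k => A (2 ^ (u + 3) + k)) c := by
  have h1 := h 0 (by simp [numProd])
  rw [show u / 2 ^ 0 = u by simp] at h1
  simp only [fwdArr, numProd, add_zero] at h1
  generalize 2 ^ (u + 3) = n at *
  have h2 : blk n Z 0 = blk n (nega n A (fun k => A (n + k))) 0 := by
    rw [h1, blk, blk, blk, mk_poly, mk_poly, mk_poly]
    simp only [zero_mul, one_mul, zero_add, map_nega]
    rw [sum_nega _ _ (xi_pow n)]
  simpa using coeff_eq_of_blk (by omega) h2 hc

/-- Negacyclic convolution. The array `10` holds two polynomials of length `2 ^ (u + 3)`, where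
`u` is in the register `12`; their product replaces the first of them. -/
def conv : Prog :=
  .assign 27 1 ;;
  forUp 20 12 fwdLevel ;;
  .assign 28 (reg 27 * 8) ;;
  stage baseBody ;;
  forUp 20 12 bwdLevel

/-- The loops run through `u` levels although about `log u` of them act; idle levels are harmless.
Each level costs `O(u)` passes over an array of length `O(u * 2 ^ u)`, which gives the cube of `u +
1`. -/
theorem runs_conv {w : ℕ} {ω : ℕ → Fin (2 ^ w)} {s : State} {p : ℕ} [Fact p.Prime]
    {u : ℕ} {A : ℕ → ZMod p} {half : ZMod p} (hh : 2 * half = 1) (hp : 2 * (p * p) ≤ 2 ^ w)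
    (hw : 16 * ((2 * u + 1) * 2 ^ (u + 3)) ≤ 2 ^ w)
    (h10 : s.reg 10 = p) (h11 : s.reg 11 = half.val) (h12 : s.reg 12 = u)
    (hA : Rep (s.mem 10) A (2 * 2 ^ (u + 3))) :
    Runs w ω conv s (60000 * (2 ^ u * (u + 1) ^ 3)) fun s' =>
      Rep (s'.mem 10) (nega (2 ^ (u + 3)) A (fun k => A (2 ^ (u + 3) + k))) (2 ^ (u + 3)) := by
  set S := (2 * u + 1) * 2 ^ (u + 3) with hS
  have hu : u < 2 ^ u := Nat.lt_two_pow_self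
  have hu8 : 2 ^ (u + 3) = 8 * 2 ^ u := by ring
  have hS0 : 2 ^ (u + 3) ≤ S := Nat.le_mul_of_pos_left _ (by omega)
  have hx : ∀ i, u / 2 ^ i + 2 ≤ u + 2 := fun i => by
    have := Nat.div_le_self u (2 ^ i)
    omega
  have hcost : ∀ i, 800 * (u / 2 ^ i + 2) * (numProd u i * 2 ^ (u / 2 ^ i + 3)) ≤
      800 * (u + 2) * S := fun i =>
    Nat.mul_le_mul (Nat.mul_le_mul_left _ (hx i)) (numProd_size_le u i)
  unfold conv
  refine WP.seq (WP.assign 1 ?_ ?_)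
  · simp (disch := omega) [mod_word]
  refine WP.seq (WP.call (runs_forUp_const (n := u) (fun i s' => Rep (s'.mem 10) (fwdArr u A i)
    (2 * (numProd u i * 2 ^ (u / 2 ^ i + 3))) ∧ s'.reg 27 = numProd u i) (800 * (u + 2) * S)
    rfl rfl (by simp [h12]) (by omega) ?_ ?_) ?_)
  · simpa [numProd, fwdArr] using hA
  · rintro i s1 hi h20 hs1 ⟨hA1, h27⟩
    have := numProd_size_le u i
    refine (runs_fwdLevel (u := u) (i := i) hp (by omega) (numProd_pos u i) rfl
      (by simp [hs1.reg 10 rfl, h10])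
      (by simp [hs1.reg 12 rfl, h12]) h20 h27 hA1).mono (hcost i) fun s2 _ h => ?_
    simpa [numProd, fwdArr, div_two_pow_succ] using h
  rintro s1 t1 ht1 hs1 ⟨hA1, h27⟩
  -- Since `u < 2 ^ u`, the exponent has dropped to `0` after `u` levels, so the remaining products
  -- have length `8`.
  have hlast := numProd_size_le u u
  rw [Nat.div_eq_of_lt hu] at hA1 hlast
  simp only [zero_add, show 2 ^ 3 = 8 by norm_num] at hA1 hlast
  refine WP.seq (WP.assign (numProd u u * 8) ?_ ?_)
  · simp (disch := omega) [h27, mod_word]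
  refine WP.seq (WP.call (runs_stage (n := numProd u u * 8) (baseFn (numProd u u) (fwdArr u A u))
    600 rfl rfl (by simp) (by omega) ?_) ?_)
  · intro j s2 hj h31 hs2
    refine runs_baseBody hp (by omega) hj ?_ (by simp [hs2.reg 27 rfl, h27]) h31 ?_
    · simp [hs2.reg 10 rfl, hs1.reg 10 rfl, h10]
    · rw [hs2.mem 10 rfl]
      exact hA1
  intro s2 t2 ht2 hs2 hA2
  refine WP.call (runs_forUp_const (n := u) (fun k s' => ∃ Z : ℕ → ZMod p,
    Products u A (u - k) Z ∧ Rep (s'.mem 10) Z (numProd u (u - k) * 2 ^ (u / 2 ^ (u - k) + 3)) ∧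
    s'.reg 27 = numProd u (u - k)) (800 * (u + 2) * S) rfl rfl ?_ (by omega) ?_ ?_) ?_
  · simp [hs2.reg 12 rfl, hs1.reg 12 rfl, h12]
  · refine ⟨baseFn (numProd u u) (fwdArr u A u), fun Q hQ => ?_, ?_, ?_⟩
    · rw [Nat.sub_zero, Nat.div_eq_of_lt hu]
      exact blk_baseFn _ _ Q
    · simpa [Nat.div_eq_of_lt hu] using hA2
    · simp [hs2.reg 27 rfl, h27]
  · rintro k s3 hk h20 hs3 ⟨Z, hZ, hR, h27'⟩
    have h1 : u - k = u - (k + 1) + 1 := by omega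
    have h2 : u - (k + 1) = u - 1 - k := by omega
    have := numProd_size_le u (u - (k + 1))
    rw [h1, numProd] at h27' hR
    rw [div_two_pow_succ] at hR
    rw [h1] at hZ
    refine (runs_bwdLevel (u := u) (k := k) (half := half) hp (by omega) (numProd_pos u _) (by rw [h2]) (by omega)
      (by simp [hs3.reg 10 rfl, hs2.reg 10 rfl, hs1.reg 10 rfl, h10])
      (by simp [hs3.reg 11 rfl, hs2.reg 11 rfl, hs1.reg 11 rfl, h11])
      (by simp [hs3.reg 12 rfl, hs2.reg 12 rfl, hs1.reg 12 rfl, h12])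
      h20 h27' hR).mono (hcost _) fun s4 _ h => ?_
    exact ⟨_, hZ.bwdFn hh, by simpa using h.1, by simpa using h.2⟩
  · rintro s3 t3 ht3 hs3 ⟨Z, hZ, hR, -⟩
    rw [Nat.sub_self] at hZ hR
    refine ⟨?_, fun c hc => ?_⟩
    · simp only [size_lit, size_mul, size_reg] at *
      rw [← hS] at hlast
      have e0 : u * 8 ≤ u * S := Nat.mul_le_mul_left _ (by omega)
      have e1 : u * (800 * (u + 2) * S + 8) ≤ 800 * u * (u + 2) * S + u * S := by linarith
      have e2 : numProd u u * 8 * (600 + 20) + 12 ≤ 640 * S := by omega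
      have e3 : t3 ≤ 2 * (800 * u * (u + 2) * S + u * S) + 640 * S + 40 := by omega
      have e4 : 2 * (800 * u * (u + 2) * S + u * S) + 640 * S + 40 ≤
          (1600 * u * (u + 2) + 2 * u + 645) * S := by linarith
      refine e3.trans (e4.trans ?_)
      rw [hS, hu8]
      have e5 : (1600 * u * (u + 2) + 2 * u + 645) * ((2 * u + 1) * 8) ≤
          60000 * (u + 1) ^ 3 := by
        ring_nf
        gcongr <;> omega
      calc _ = (1600 * u * (u + 2) + 2 * u + 645) * ((2 * u + 1) * 8) * 2 ^ u := by ring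
        _ ≤ 60000 * (u + 1) ^ 3 * 2 ^ u := Nat.mul_le_mul_right _ e5
        _ = _ := by ring
    · rw [← eq_nega_of_products hZ hc]
      exact hR c (by simpa [numProd] using hc)

end WordRAM


/-! ### The generating function of the subset sums -/

namespace SubsetSumSeries

open PowerSeries Finset

variable {F : Type} [Field F]

/-- The coefficients of the logarithmic derivative of `1 + X + ⋯ + X ^ c`. -/
def kap (F : Type) [Field F] (c k : ℕ) : F :=
  if k = 0 then 0 else if (c + 1) ∣ k then -(c : F) else 1

/-- Among `c + 1` consecutive positive indices exactly one is a multiple of `c + 1`; it contributes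
`-c` and the others contribute `1` each. The window starts at `M + 1` because the index `0` is
exceptional. -/
theorem sum_kap (c M : ℕ) : ∑ k ∈ range (c + 1), kap F c (M + 1 + k) = 0 := by
  induction M with
  | zero =>
    rw [sum_range_succ, sum_congr rfl (g := fun _ => (1 : F))]
    · simp [kap, add_comm 1 c]
    · intro k hk
      have hk' := mem_range.1 hk
      have h2 : ¬ (c + 1) ∣ (0 + 1 + k) := fun h => by
        have := Nat.le_of_dvd (by omega) h
        omega
      simp only [kap, if_neg h2]
      rw [if_neg (by omega)]
  | succ M ih =>
    rw [sum_range_succ'] at ih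
    rw [sum_range_succ, show M + 1 + 1 + c = M + 1 + 0 + (c + 1) by ring]
    have h1 : kap F c (M + 1 + 0 + (c + 1)) = kap F c (M + 1 + 0) := by
      simp [kap]
    rw [h1, ← ih]
    congr 1
    refine sum_congr rfl fun k _ => ?_
    congr 1
    ring

/-- The `N`-th coefficient of the identity `(1 + ⋯ + X ^ c) * kap = X * (1 + ⋯ + X ^ c)'`. The
formula for `kap` comes from writing the first factor as `(1 - X ^ (c + 1)) / (1 - X)`. -/
theorem window_kap (c N : ℕ) :
    ∑ k ∈ range (N + 1), (if N - k ≤ c then kap F c k else 0) =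
      if N ≤ c then (N : F) else 0 := by
  split_ifs with h
  · rw [sum_range_succ', sum_congr rfl (g := fun _ => (1 : F))]
    · simp [kap]
    · intro k hk
      have hk' := mem_range.1 hk
      have h2 : ¬ (c + 1) ∣ (k + 1) := fun h => by
        have := Nat.le_of_dvd (by omega) h
        omega
      simp only [kap, if_neg h2]
      rw [if_pos (by omega), if_neg (by omega)]
  -- For `N > c` the indices that count are the `c + 1` last ones, all positive, and `sum_kap`
  -- applies.
  · obtain ⟨M, rfl⟩ : ∃ M, N = c + 1 + M := ⟨N - (c + 1), by omega⟩
    rw [show c + 1 + M + 1 = (M + 1) + (c + 1) by ring, sum_range_add, sum_eq_zero, zero_add,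
      ← sum_kap c M]
    · refine sum_congr rfl fun k hk => ?_
      have hk' := mem_range.1 hk
      rw [if_pos (by omega)]
    · intro k hk
      have hk' := mem_range.1 hk
      rw [if_neg (by omega)]

/-- The series `∑ j ≤ c, r ^ j * X ^ (x * j)`. -/
noncomputable def factor {x : ℕ} (hx : x ≠ 0) (c : ℕ) (r : F) : F⟦X⟧ :=
  expand x hx (PowerSeries.mk fun j => if j ≤ c then r ^ j else 0)

/-- `X` times the logarithmic derivative of `factor`. -/
noncomputable def logDer {x : ℕ} (hx : x ≠ 0) (c : ℕ) (r : F) : F⟦X⟧ :=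
  C (x : F) * expand x hx (PowerSeries.mk fun k => kap F c k * r ^ k)

/-- The operator `X * d/dX` multiplies the `n`-th coefficient by `n`. Only multiples of `x` occur,
and there the claim is `window_kap` scaled by a power of `r` and by `x`. -/
theorem X_mul_derivative_factor {x : ℕ} (hx : x ≠ 0) (c : ℕ) (r : F) :
    X * d⁄dX F (factor hx c r) = factor hx c r * logDer hx c r := by
  have h1 : ∀ n, coeff n (X * d⁄dX F (factor hx c r)) = n * coeff n (factor hx c r) := by
    intro n
    cases n with
    | zero => simp
    | succ n =>
      rw [coeff_succ_X_mul, coeff_derivative]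
      push_cast
      ring
  ext n
  rw [h1, logDer, factor, mul_left_comm, ← map_mul, coeff_C_mul]
  by_cases hn : x ∣ n
  · obtain ⟨N, rfl⟩ := hn
    rw [coeff_expand_mul, coeff_expand_mul, coeff_mul, coeff_mk]
    have h2 : ∑ q ∈ antidiagonal N, coeff q.1 (PowerSeries.mk fun j => if j ≤ c then r ^ j else 0) *
        coeff q.2 (PowerSeries.mk fun k => kap F c k * r ^ k) =
        ∑ q ∈ antidiagonal N, (if q.1 ≤ c then kap F c q.2 else 0) * r ^ N := by
      refine sum_congr rfl fun q hq => ?_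
      rw [← mem_antidiagonal.1 hq, coeff_mk, coeff_mk, pow_add]
      split_ifs <;> ring
    rw [h2, ← sum_mul, ← Nat.sum_antidiagonal_swap, Nat.sum_antidiagonal_eq_sum_range_succ_mk]
    simp only [Prod.fst_swap, Prod.snd_swap]
    rw [window_kap]
    split_ifs
    · push_cast
      ring
    · simp
  · rw [coeff_expand_of_not_dvd _ _ _ hn, coeff_expand_of_not_dvd _ _ _ hn]
    simp

/-- The generating function of the subset sums of a multiset of items that contains the weight
`x + 1` with multiplicity `c (x + 1)` for `x < T`, where `x + 1` carries the marker `r x`. -/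
noncomputable def gen (T : ℕ) (c : ℕ → ℕ) (r : ℕ → F) : F⟦X⟧ :=
  ∏ x ∈ range T, factor x.succ_ne_zero (c (x + 1)) (r x)

/-- The coefficients of `X` times the logarithmic derivative of the generating function. -/
def logCoeff (T : ℕ) (c : ℕ → ℕ) (r : ℕ → F) (j : ℕ) : F :=
  ∑ x ∈ range T, if x + 1 ∣ j then
    ((x + 1 : ℕ) : F) * (kap F (c (x + 1)) (j / (x + 1)) * r x ^ (j / (x + 1))) else 0

theorem X_mul_derivative_gen (T : ℕ) (c : ℕ → ℕ) (r : ℕ → F) :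
    X * d⁄dX F (gen T c r) = gen T c r * PowerSeries.mk (logCoeff T c r) := by
  have hG : PowerSeries.mk (logCoeff T c r) =
      ∑ x ∈ range T, logDer x.succ_ne_zero (c (x + 1)) (r x) := by
    ext j
    rw [coeff_mk, map_sum]
    refine sum_congr rfl fun x _ => ?_
    rw [logDer, coeff_C_mul]
    split_ifs with h
    · obtain ⟨N, rfl⟩ := h
      rw [coeff_expand_mul, coeff_mk, Nat.mul_div_cancel_left _ (Nat.succ_pos x)]
    · rw [coeff_expand_of_not_dvd _ _ _ h, mul_zero]
  rw [hG, gen]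
  clear hG
  induction T with
  | zero => simp
  | succ T ih =>
    rw [prod_range_succ, sum_range_succ, Derivation.leibniz, mul_add, smul_eq_mul, smul_eq_mul,
      mul_left_comm, X_mul_derivative_factor, mul_left_comm X, ih]
    ring

/-- The logarithmic derivative has no constant term after multiplication by `X`, so the coefficient
`t` does not occur on the right. Where `t` is invertible, the earlier coefficients determine it. -/
theorem gen_recurrence (T : ℕ) (c : ℕ → ℕ) (r : ℕ → F) (t : ℕ) :
    (t : F) * coeff t (gen T c r) =
      ∑ a ∈ range t, coeff a (gen T c r) * logCoeff T c r (t - a) := by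
  have h := congrArg (coeff t) (X_mul_derivative_gen T c r)
  rw [coeff_mul t (gen T c r), Nat.sum_antidiagonal_eq_sum_range_succ_mk, sum_range_succ] at h
  simp only [coeff_mk] at h
  have h0 : logCoeff T c r (t - t) = 0 := by
    simp [logCoeff, kap]
  rw [h0, mul_zero, add_zero] at h
  rw [← h]
  cases t with
  | zero => simp
  | succ n =>
    rw [coeff_succ_X_mul, coeff_derivative]
    push_cast
    ring

theorem coeff_zero_gen (T : ℕ) (c : ℕ → ℕ) (r : ℕ → F) : coeff 0 (gen T c r) = 1 := by
  rw [coeff_zero_eq_constantCoeff_apply, gen, map_prod]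
  refine prod_eq_one fun x _ => ?_
  rw [factor, ← coeff_zero_eq_constantCoeff_apply]
  have := coeff_expand_mul (x + 1) x.succ_ne_zero
    (PowerSeries.mk fun j => if j ≤ c (x + 1) then r x ^ j else 0) 0
  rw [mul_zero] at this
  rw [this]
  simp

end SubsetSumSeries


/-! ### Detecting attainable sums with random markers -/

namespace SubsetSumSeries

open PowerSeries Finset

variable {F : Type} [Field F]

/-- The weight `t` is a sum of weights `x + 1 ≤ T` that are used at most `c (x + 1)` times. -/
def Reach (T : ℕ) (c : ℕ → ℕ) (t : ℕ) : Prop :=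
  ∃ φ : Fin T → ℕ, (∀ x, φ x ≤ c (x + 1)) ∧ ∑ x : Fin T, (x + 1) * φ x = t

/-- The ways to write `t` as a sum of weights `x + 1 ≤ T` that are used at most `c (x + 1)`
times. -/
def ways (T : ℕ) (c : ℕ → ℕ) (t : ℕ) : Finset (Fin T → ℕ) :=
  {φ ∈ Fintype.piFinset fun x : Fin T => range (c (x + 1) + 1) |
    ∑ x : Fin T, ((x : ℕ) + 1) * φ x = t}

theorem mem_ways {T : ℕ} {c : ℕ → ℕ} {t : ℕ} {φ : Fin T → ℕ} :
    φ ∈ ways T c t ↔ (∀ x, φ x ≤ c (x + 1)) ∧ ∑ x : Fin T, ((x : ℕ) + 1) * φ x = t := by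
  simp [ways]

theorem factor_eq_sum {x : ℕ} (hx : x ≠ 0) (c : ℕ) (r : F) :
    factor hx c r = ∑ j ∈ range (c + 1), C (r ^ j) * X ^ (x * j) := by
  ext n
  rw [factor, map_sum]
  simp only [coeff_C_mul, coeff_X_pow]
  by_cases hn : x ∣ n
  · obtain ⟨N, rfl⟩ := hn
    rw [coeff_expand_mul, coeff_mk]
    simp only [Nat.mul_right_inj hx, mul_ite, mul_one, mul_zero, Finset.sum_ite_eq,
      mem_range, Nat.lt_succ_iff]
  · rw [coeff_expand_of_not_dvd _ _ _ hn, eq_comm]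
    refine sum_eq_zero fun j _ => ?_
    rw [if_neg (by rintro rfl; exact hn (dvd_mul_right _ _)), mul_zero]

theorem coeff_gen (T : ℕ) (c : ℕ → ℕ) (r : ℕ → F) (t : ℕ) :
    coeff t (gen T c r) = ∑ φ ∈ ways T c t, ∏ x : Fin T, r x ^ φ x := by
  rw [gen, prod_range (fun x => factor x.succ_ne_zero (c (x + 1)) (r x))]
  simp only [factor_eq_sum]
  rw [prod_univ_sum, map_sum, ways, sum_filter]
  refine sum_congr rfl fun φ _ => ?_
  rw [prod_mul_distrib, ← map_prod, coeff_C_mul, prod_pow_eq_pow_sum, coeff_X_pow]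
  simp [eq_comm]

/-- The error is one-sided: no choice of the markers produces a false positive. -/
theorem coeff_gen_of_not_reach {T : ℕ} {c : ℕ → ℕ} {t : ℕ} (h : ¬ Reach T c t) (r : ℕ → F) :
    coeff t (gen T c r) = 0 := by
  rw [coeff_gen]
  refine sum_eq_zero fun φ hφ => ?_
  exact absurd ⟨φ, mem_ways.1 hφ⟩ h

/-- The coefficient of the generating function as a polynomial in the markers. -/
noncomputable def wayPoly (F : Type) [Field F] (T : ℕ) (c : ℕ → ℕ) (t : ℕ) :
    MvPolynomial (Fin T) F :=
  ∑ φ ∈ ways T c t, MvPolynomial.monomial (Finsupp.equivFunOnFinite.symm φ) 1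

theorem eval_wayPoly (T : ℕ) (c : ℕ → ℕ) (t : ℕ) (r : ℕ → F) :
    MvPolynomial.eval (fun x : Fin T => r x) (wayPoly F T c t) = coeff t (gen T c r) := by
  rw [coeff_gen, wayPoly, map_sum]
  refine sum_congr rfl fun φ _ => ?_
  rw [MvPolynomial.eval_monomial, one_mul, Finsupp.prod_fintype _ _ (by simp)]
  rfl

/-- Different ways give different monomials, each with coefficient `1`, so nothing cancels in any
characteristic. Counting ways without markers could fail modulo `p`. -/
theorem wayPoly_ne_zero {T : ℕ} {c : ℕ → ℕ} {t : ℕ} (h : Reach T c t) :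
    wayPoly F T c t ≠ 0 := by
  obtain ⟨φ, hφ⟩ := h
  intro h0
  have h1 := congrArg (MvPolynomial.coeff (Finsupp.equivFunOnFinite.symm φ)) h0
  rw [wayPoly, MvPolynomial.coeff_sum] at h1
  simp only [MvPolynomial.coeff_monomial, EmbeddingLike.apply_eq_iff_eq] at h1
  rw [sum_ite_eq', if_pos (mem_ways.2 hφ)] at h1
  simp at h1

theorem totalDegree_wayPoly_le (T : ℕ) (c : ℕ → ℕ) (t : ℕ) :
    (wayPoly F T c t).totalDegree ≤ t := by
  refine MvPolynomial.totalDegree_finsetSum_le fun φ hφ => ?_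
  refine (MvPolynomial.totalDegree_monomial_le _ _).trans ?_
  rw [Finsupp.sum_fintype _ _ (by simp)]
  refine le_trans ?_ (mem_ways.1 hφ).2.le
  refine sum_le_sum fun x _ => ?_
  simp only [Finsupp.equivFunOnFinite_symm_apply_apply, id]
  nlinarith

variable {p : ℕ} [Fact p.Prime]

/-- Few choices of the markers make the coefficient of a sum vanish. -/
theorem card_roots_le {T q W : ℕ} {c : ℕ → ℕ} {t : ℕ} (h : Reach T c t) (ht : t ≤ T)
    (hq : 0 < q) (hTq : 2 * T ≤ q) (hqp : q ≤ p) (hqW : q ∣ W) :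
    2 * #{f : Fin T → Fin W | MvPolynomial.eval (fun x => ((f x % q : ℕ) : ZMod p))
      (wayPoly (ZMod p) T c t) = 0} ≤ W ^ T := by
  classical
  -- Since `q ≤ p`, the residues of `0, …, q - 1` are distinct and `S` has `q` elements; with degree
  -- at most `T` and `2 * T ≤ q`, Schwartz–Zippel gives the probability `1/2`.
  set S : Finset (ZMod p) := (range q).image fun a : ℕ => (a : ZMod p)
  have hinj : ∀ a < q, ∀ b < q, (a : ZMod p) = b → a = b := by
    intro a ha b hb hab
    have := congrArg ZMod.val hab
    rwa [ZMod.val_cast_of_lt (by omega), ZMod.val_cast_of_lt (by omega)] at this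
  have hS : #S = q := by
    rw [card_image_of_injOn, card_range]
    intro a ha b hb hab
    exact hinj a (by simpa using ha) b (by simpa using hb) hab
  set P := wayPoly (ZMod p) T c t
  have hsz := MvPolynomial.schwartz_zippel_totalDegree (wayPoly_ne_zero (F := ZMod p) h) S
  rw [hS] at hsz
  set Z : Finset (Fin T → ZMod p) :=
    {f ∈ Fintype.piFinset fun _ => S | MvPolynomial.eval f P = 0}
  have hZ : 2 * #Z ≤ q ^ T := by
    have hq' : (0 : ℚ≥0) < q := by exact_mod_cast hq
    have h1 : (P.totalDegree : ℚ≥0) / q ≤ 1 / 2 := by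
      rw [div_le_div_iff₀ hq' (by norm_num)]
      have := totalDegree_wayPoly_le (F := ZMod p) T c t
      have h2 : P.totalDegree * 2 ≤ 1 * q := by simp only [P]; omega
      exact_mod_cast h2
    have h3 := hsz.trans h1
    rw [div_le_div_iff₀ (by positivity) (by norm_num)] at h3
    have h4 : #Z * 2 ≤ 1 * q ^ T := by exact_mod_cast h3
    omega
  set red : (Fin T → Fin W) → (Fin T → ZMod p) := fun f x => ((f x % q : ℕ) : ZMod p)
  -- As `q` divides `W`, reducing a uniform word modulo `q` is again uniform: every value has at
  -- most `W / q` preimages.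
  have hfib : ∀ g ∈ Z, #{f ∈ ({f | MvPolynomial.eval (red f) P = 0} : Finset (Fin T → Fin W)) |
      red f = g} ≤ (W / q) ^ T := by
    intro g _
    have h1 : ∀ y : ZMod p, #{v : Fin W | ((v % q : ℕ) : ZMod p) = y} ≤ W / q := by
      intro y
      rw [← card_range (W / q)]
      refine card_le_card_of_injOn (fun v => v / q) ?_ ?_
      · intro v _
        simp only [coe_range, Set.mem_Iio]
        exact Nat.div_lt_div_of_lt_of_dvd hqW v.2
      · intro v hv v' hv' hvv
        simp only [coe_filter, mem_univ, true_and, Set.mem_ofPred_eq] at hv hv' hvv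
        have := hinj _ (Nat.mod_lt v hq) _ (Nat.mod_lt v' hq) (hv.trans hv'.symm)
        apply Fin.ext
        rw [← Nat.div_add_mod v.1 q, ← Nat.div_add_mod v'.1 q, this, hvv]
    calc _ ≤ #(Fintype.piFinset fun x : Fin T =>
            ({v : Fin W | ((v % q : ℕ) : ZMod p) = g x} : Finset (Fin W))) := by
          refine card_le_card fun f hf => ?_
          rw [mem_filter] at hf
          rw [Fintype.mem_piFinset]
          intro x
          rw [mem_filter]
          exact ⟨mem_univ _, congrFun hf.2 x⟩
      _ = ∏ x : Fin T, #({v : Fin W | ((v % q : ℕ) : ZMod p) = g x} : Finset (Fin W)) :=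
          Fintype.card_piFinset _
      _ ≤ ∏ _x : Fin T, W / q := prod_le_prod' fun x _ => h1 _
      _ = (W / q) ^ T := by simp
  have h5 := card_le_mul_card_image_of_maps_to
    (s := ({f | MvPolynomial.eval (red f) P = 0} : Finset (Fin T → Fin W))) (t := Z) (f := red)
    (fun f hf => by
      simp only [Z, mem_filter, Fintype.mem_piFinset]
      rw [mem_filter] at hf
      refine ⟨fun x => ?_, hf.2⟩
      exact mem_image_of_mem _ (mem_range.2 (Nat.mod_lt _ hq))) _ hfib
  calc _ ≤ 2 * ((W / q) ^ T * #Z) := by gcongr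
    _ = (W / q) ^ T * (2 * #Z) := by ring
    _ ≤ (W / q) ^ T * q ^ T := by gcongr
    _ = W ^ T := by rw [← mul_pow, Nat.div_mul_cancel hqW]

/-- If each of `K` blocks of `T` words avoids a set of bad values with probability at least `1/2`,
then some block does, except with probability `2 ^ (-K)`. -/
theorem coins_blocks_le {w K T a : ℕ} (B : Finset (Fin T → Fin (2 ^ w)))
    (hB : 2 * #B ≤ (2 ^ w) ^ T) :
    WordRAM.coins w {ω | ∀ i < K, (fun x : Fin T => ω ((a + i) * T + x)) ∈ B} ≤ (1 / 2) ^ K := by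
  classical
  let I : Finset ℕ := Ico (a * T) (a * T + K * T)
  let pt : (Fin K → B) → Set (ℕ → Fin (2 ^ w)) := fun v =>
    Set.pi I fun n => if h : n / T - a < K ∧ n % T < T then
      {(v ⟨n / T - a, h.1⟩).1 ⟨n % T, h.2⟩} else Set.univ
  have hsub : {ω | ∀ i < K, (fun x : Fin T => ω ((a + i) * T + x)) ∈ B} ⊆ ⋃ v, pt v := by
    intro ω hω
    rw [Set.mem_iUnion]
    refine ⟨fun i => ⟨_, hω i i.2⟩, fun n hn => ?_⟩
    dsimp only
    split_ifs with h
    · have hn' := mem_Ico.1 hn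
      have h1 : a ≤ n / T := (Nat.le_div_iff_mul_le (by omega)).2 hn'.1
      rw [Set.mem_singleton_iff]
      congr 1
      rw [Nat.add_sub_cancel' h1, mul_comm, Nat.div_add_mod]
    · trivial
  have hpt : ∀ v, WordRAM.coins w (pt v) ≤ ((2 ^ w : ENNReal)⁻¹) ^ (K * T) := by
    intro v
    rw [WordRAM.coins, Measure.infinitePi_pi _ fun _ _ => MeasurableSet.of_discrete]
    calc _ ≤ ∏ n ∈ I, (2 ^ w : ENNReal)⁻¹ := by
          refine prod_le_prod' fun n hn => ?_
          have hn' := mem_Ico.1 hn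
          have hT : 0 < T := by
            rcases Nat.eq_zero_or_pos T with rfl | h
            · simp at hn'
            · exact h
          have h1 : a ≤ n / T := (Nat.le_div_iff_mul_le hT).2 hn'.1
          have h2 : n / T < a + K := (Nat.div_lt_iff_lt_mul hT).2 (by rw [add_mul]; exact hn'.2)
          rw [dif_pos ⟨by omega, Nat.mod_lt _ hT⟩, PMF.toMeasure_apply_singleton _ _ (by simp)]
          simp
      _ = _ := by simp [I]
  calc _ ≤ WordRAM.coins w (⋃ v, pt v) := measure_mono hsub
    _ ≤ ∑ v, WordRAM.coins w (pt v) := measure_iUnion_fintype_le _ _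
    _ ≤ ∑ _v : Fin K → B, ((2 ^ w : ENNReal)⁻¹) ^ (K * T) := sum_le_sum fun v _ => hpt v
    _ = ((#B : ENNReal) * ((2 ^ w : ENNReal)⁻¹) ^ T) ^ K := by
        simp [mul_pow, ← pow_mul, mul_comm]
    _ ≤ (1 / 2) ^ K := by
        gcongr
        have hB' : 2 * (#B : ENNReal) ≤ (2 ^ w) ^ T := by exact_mod_cast hB
        rw [← ENNReal.inv_pow, ← div_eq_mul_inv]
        refine ENNReal.div_le_of_le_mul ?_
        rw [one_div, mul_comm, ← div_eq_mul_inv, ENNReal.le_div_iff_mul_le (by simp) (by simp),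
          mul_comm]
        exact hB'

/-- The markers used in the `a`-th run of the randomized solver. -/
def marks (F : Type) [Field F] {w : ℕ} (ω : ℕ → Fin (2 ^ w)) (q T a x : ℕ) : F :=
  ((ω (a * T + x) % q : ℕ) : F)

/-- Each of the first `n` blocks of `K` runs of the solver finds all the sums. -/
def AllFound (p : ℕ) [Fact p.Prime] {w : ℕ} (q T K n : ℕ) (c : ℕ → ℕ → ℕ)
    (ω : ℕ → Fin (2 ^ w)) : Prop :=
  ∀ k < n, ∀ t ≤ T, Reach T (c k) t →
    ∃ i < K, coeff t (gen T (c k) (marks (ZMod p) ω q T (k * K + i))) ≠ 0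

/-- A union bound over the `n` blocks and the `T + 1` sums. It uses only monotonicity and
subadditivity of the measure, so `A` need not be shown measurable. -/
theorem le_coins_of_allFound {w q T K n : ℕ} (c : ℕ → ℕ → ℕ) (hq : 0 < q) (hTq : 2 * T ≤ q)
    (hqp : q ≤ p) (hqw : q ∣ 2 ^ w) {A : Set (ℕ → Fin (2 ^ w))}
    (hA : ∀ ω, AllFound p q T K n c ω → ω ∈ A) :
    1 - (n * (T + 1) : ℝ) / 2 ^ K ≤ (WordRAM.coins w).real A := by
  classical
  have : IsProbabilityMeasure (WordRAM.coins w) := by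
    unfold WordRAM.coins
    infer_instance
  let bad : ℕ → ℕ → Set (ℕ → Fin (2 ^ w)) := fun k t => {ω | Reach T (c k) t ∧
    ∀ i < K, coeff t (gen T (c k) (marks (ZMod p) ω q T (k * K + i))) = 0}
  have hbad : ∀ k, ∀ t ≤ T, WordRAM.coins w (bad k t) ≤ (1 / 2) ^ K := by
    intro k t ht
    by_cases h : Reach T (c k) t
    · refine le_trans (measure_mono ?_) (coins_blocks_le (a := k * K) (K := K) _
        (card_roots_le (p := p) h ht hq hTq hqp hqw))
      intro ω hω i hi
      have := hω.2 i hi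
      rw [← eval_wayPoly] at this
      simpa [marks] using this
    · simp [bad, h]
  have hcov : (Set.univ : Set (ℕ → Fin (2 ^ w))) ⊆
      A ∪ ⋃ k ∈ range n, ⋃ t ∈ range (T + 1), bad k t := by
    intro ω _
    by_cases h : AllFound p q T K n c ω
    · exact Or.inl (hA ω h)
    · right
      simp only [AllFound, not_forall, not_exists, not_and, not_not] at h
      obtain ⟨k, hk, t, ht, h1, h2⟩ := h
      simp only [Set.mem_iUnion, mem_range]
      exact ⟨k, hk, t, by omega, h1, h2⟩
  have h1 : (1 : ENNReal) ≤ WordRAM.coins w A + n * ((T + 1 : ℕ) * (1 / 2) ^ K) := by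
    rw [← measure_univ (μ := WordRAM.coins w)]
    refine (measure_mono hcov).trans ((measure_union_le _ _).trans ?_)
    gcongr
    refine (measure_biUnion_finset_le _ _).trans ?_
    refine (sum_le_card_nsmul _ _ ((T + 1 : ℕ) * (1 / 2 : ENNReal) ^ K) fun k _ => ?_).trans (by simp)
    refine (measure_biUnion_finset_le _ _).trans ?_
    refine (sum_le_card_nsmul _ _ ((1 / 2 : ENNReal) ^ K) fun t ht => ?_).trans (by simp)
    exact hbad k t (by simpa [Nat.lt_succ_iff] using ht)
  have h2 := ENNReal.toReal_mono (by finiteness) h1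
  rw [ENNReal.toReal_add (by finiteness) (by finiteness)] at h2
  simp only [ENNReal.toReal_one, ENNReal.toReal_mul, ENNReal.toReal_natCast, ENNReal.toReal_pow,
    ENNReal.toReal_div, ENNReal.toReal_ofNat] at h2
  rw [Measure.real]
  push_cast at h2
  rw [one_div, inv_pow, ← mul_assoc, ← div_eq_mul_inv] at h2
  linarith

end SubsetSumSeries


/-! ### Computing the logarithmic derivative with fresh markers -/

namespace SubsetSumSeries

open Finset

/-- A dyadic bound for harmonic sums. -/
theorem sum_div_le {T l : ℕ} (M : ℕ) (h : T < 2 ^ l) : ∑ x ∈ range T, M / (x + 1) ≤ l * M := by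
  refine (sum_le_sum_of_subset (range_subset_range.2 (show T ≤ 2 ^ l - 1 by omega))).trans ?_
  clear h
  induction l with
  | zero => simp
  | succ l ih =>
    have h1 : 2 ^ (l + 1) - 1 = (2 ^ l - 1) + 2 ^ l := by
      have := Nat.one_le_two_pow (n := l)
      rw [pow_succ]
      omega
    rw [h1, sum_range_add, add_mul, one_mul]
    refine Nat.add_le_add ih ?_
    have h2 : ∀ x ∈ range (2 ^ l), M / (2 ^ l - 1 + x + 1) ≤ M / 2 ^ l := fun x _ =>
      Nat.div_le_div_left (by omega) (by positivity)
    refine (sum_le_sum h2).trans ?_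
    simp only [sum_const, card_range, smul_eq_mul]
    exact Nat.mul_div_le _ _

/-- The contribution of the weight `x + 1` to `logCoeff`. -/
def logTerm {F : Type} [Field F] (c : ℕ) (r : F) (x j : ℕ) : F :=
  if x + 1 ∣ j then ((x + 1 : ℕ) : F) * (kap F c (j / (x + 1)) * r ^ (j / (x + 1))) else 0

end SubsetSumSeries

namespace WordRAM

open WordRAM.Expr WordRAM.Prog SubsetSumSeries

/-- Registers: `10` the modulus, `54` the marker, `55` the weight, `56` minus the weight times its
multiplicity, `57` the multiplicity plus one, `58` a power of the marker. -/
def logBody : Prog :=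
  .assign 61 ((reg 60 + 1) * reg 55) ;;
  .ite (.bin .eq ((reg 60 + 1) % reg 57) 0) (.assign 62 (reg 56)) (.assign 62 (reg 55)) ;;
  .store 13 (reg 61) ((load 13 (reg 61) + reg 62 * reg 58 % reg 10) % reg 10) ;;
  .assign 58 (reg 58 * reg 54 % reg 10)

section
variable {w : ℕ} {ω : ℕ → Fin (2 ^ w)} {s : State} {p : ℕ} [Fact p.Prime]

/-- The weight `x + 1` contributes only at its multiples. The power of the marker is carried along,
so each multiple costs a constant. -/
theorem runs_logLoop {c x M : ℕ} {r : ZMod p} {A : ℕ → ZMod p} (hp : 2 * (p * p) ≤ 2 ^ w)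
    (hM : 2 * M < 2 ^ w) (hx : x + 1 < p)
    (h10 : s.reg 10 = p) (h54 : s.reg 54 = r.val) (h55 : s.reg 55 = x + 1)
    (h56 : s.reg 56 = (-((c * (x + 1) : ℕ) : ZMod p)).val) (h57 : s.reg 57 = c + 1)
    (h58 : s.reg 58 = r.val) (h59 : s.reg 59 = M / (x + 1))
    (hA : Rep (s.mem 13) A (M + 1)) :
    Runs w ω (forUp 60 59 logBody) s (M / (x + 1) * 48 + 6) fun s' =>
      Rep (s'.mem 13) (fun j => A j + logTerm c r x j) (M + 1) := by
  have hpp : p ≤ p * p := Nat.le_mul_self p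
  have hdiv : M / (x + 1) ≤ M := Nat.div_le_self _ _
  have hvv : ∀ y z : ZMod p, y.val * z.val < p * p := fun y z =>
    Nat.mul_lt_mul'' (ZMod.val_lt y) (ZMod.val_lt z)
  have hmul : (x + 1) * (M / (x + 1)) ≤ M := Nat.mul_div_le _ _
  refine (runs_forUp_const (M / (x + 1)) (fun i s' => s'.reg 58 = (r ^ (i + 1)).val ∧
    Rep (s'.mem 13) (fun j => A j + if j ≤ (x + 1) * i then logTerm c r x j else 0) (M + 1)) 40
    rfl rfl h59 (by omega) ?_ ?_).mono le_rfl ?_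
  · refine ⟨by simp [h58], ?_⟩
    intro j hj
    rw [mem_setR, hA j hj]
    congr 1
    dsimp only
    split_ifs with h
    · obtain rfl : j = 0 := by omega
      simp [logTerm, kap]
    · simp
  · rintro i s1 hi h60 hs1 ⟨h1, hR⟩
    have h54' := (hs1.reg 54 rfl).trans h54
    have h55' := (hs1.reg 55 rfl).trans h55
    have h56' := (hs1.reg 56 rfl).trans h56
    have h57' := (hs1.reg 57 rfl).trans h57
    have h10' := (hs1.reg 10 rfl).trans h10
    have hij : (i + 1) * (x + 1) ≤ M := by
      have : (x + 1) * (i + 1) ≤ (x + 1) * (M / (x + 1)) := Nat.mul_le_mul_left _ hi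
      rw [mul_comm]
      omega
    have hwt : ((x + 1 : ℕ) : ZMod p).val = x + 1 := ZMod.val_cast_of_lt hx
    set y : ZMod p := ((x + 1 : ℕ) : ZMod p) * kap (ZMod p) c (i + 1) with hy
    unfold logBody
    refine WP.seq (WP.assign ((i + 1) * (x + 1)) ?_ ?_)
    · simp (disch := omega) [h60, h55', mod_word]
    refine WP.seq (WP.ite_assign ((i + 1) % (c + 1) = 0) y.val ?_ (fun h => ?_) (fun h => ?_)
      fun t1 ht1 => ?_)
    · simp (disch := omega) [h60, h57', mod_word]
    · simp only [eval_reg, reg_setR]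
      norm_num
      rw [h56', hy, kap, if_neg (by omega), if_pos (Nat.dvd_of_mod_eq_zero h)]
      congr 1
      push_cast
      ring
    · simp only [eval_reg, reg_setR]
      norm_num
      rw [h55', hy, kap, if_neg (by omega), if_neg (fun h' => h (Nat.mod_eq_zero_of_dvd h')),
        mul_one, hwt]
    have hRj := hR ((i + 1) * (x + 1)) (by omega)
    -- The cell of the current multiple has not been changed yet and still holds `A`.
    have hlt : ¬ (i + 1) * (x + 1) ≤ (x + 1) * i := by
      rw [mul_comm, not_le]
      exact Nat.mul_lt_mul_of_pos_left (Nat.lt_succ_self i) (Nat.succ_pos x)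
    dsimp only at hRj
    rw [if_neg hlt, add_zero] at hRj
    have hval := ZMod.val_lt (A ((i + 1) * (x + 1)))
    have hval' := ZMod.val_lt (y * r ^ (i + 1))
    have hv1 := hvv y (r ^ (i + 1))
    have hv2 := hvv (r ^ (i + 1)) r
    have hlog : logTerm c r x ((i + 1) * (x + 1)) = y * r ^ (i + 1) := by
      rw [logTerm, if_pos (dvd_mul_left _ _), Nat.mul_div_cancel _ (Nat.succ_pos x), hy]
      ring
    refine WP.seq (WP.store ((i + 1) * (x + 1))
      (A ((i + 1) * (x + 1)) + y * r ^ (i + 1)).val (by simp) ?_ ?_)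
    · simp (disch := omega) [h1, h10', mod_word, hRj, val_mul_mod, val_add_mod]
    refine WP.assign (r ^ (i + 1 + 1)).val ?_ ⟨?_, ?_, ?_⟩
    · simp (disch := omega) [h1, h54', h10', mod_word, val_mul_mod, pow_succ _ (i + 1)]
    · simp at ht1 ⊢
      omega
    · simp
    · intro j hj
      simp only [mem_setR, mem_setM_self, Function.update_apply]
      split_ifs with e1 e2 e2
      · rw [e1, hlog]
      · exact absurd (by rw [e1, mul_comm]) e2
      · rw [hR j hj]
        dsimp only
        by_cases e3 : j ≤ (x + 1) * i
        · rw [if_pos e3]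
        · rw [if_neg e3, logTerm, if_neg]
          rintro ⟨k, rfl⟩
          have : i < k := lt_of_not_ge fun h => e3 (Nat.mul_le_mul_left _ h)
          have : k ≤ i + 1 := Nat.le_of_mul_le_mul_left e2 (Nat.succ_pos x)
          exact e1 (by rw [show k = i + 1 by omega, mul_comm])
      · rw [hR j hj]
        dsimp only
        rw [if_neg]
        intro e3
        exact e2 (e3.trans (Nat.mul_le_mul_left _ (by omega)))
  · rintro s1 _ ⟨-, hR⟩ j hj
    rw [hR j hj]
    dsimp only
    split_ifs with h
    · rfl
    · rw [logTerm, if_neg]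
      rintro ⟨k, rfl⟩
      refine h (Nat.mul_le_mul_left _ ?_)
      rw [Nat.le_div_iff_mul_le (Nat.succ_pos x), mul_comm]
      exact Nat.le_of_lt_succ hj

/-- Draw the marker of the weight with index `reg 51` and add its contribution to the array
`13`. -/
def drawBody : Prog :=
  .rand 54 ;;
  .assign 54 (reg 54 % reg 4) ;;
  .assign 55 (reg 51 + 1) ;;
  .assign 56 ((reg 10 - load 3 (reg 55) * reg 55 % reg 10) % reg 10) ;;
  .assign 57 (load 3 (reg 55) + 1) ;;
  .assign 58 (reg 54) ;;
  .assign 59 ((reg 53 - 1) / reg 55) ;;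
  forUp 60 59 logBody

/-- Compute the coefficients of the logarithmic derivative with fresh random markers. -/
def drawAll : Prog :=
  .assign 53 (2 * reg 0 + 2) ;;
  forUp 51 53 (.store 13 (reg 51) 0) ;;
  forUp 51 0 drawBody

/-- The counter of random words pins run `a` to the words from `a * T` to `a * T + T - 1`, so
different runs use disjoint words. The array is filled beyond `T`, up to `2 * T + 1`, because the
multiplications of a round read windows of twice the length of the low bit. -/
theorem runs_drawAll {T q a l : ℕ} (hp : 2 * (p * p) ≤ 2 ^ w) (hT : 4 * (T + 2) ≤ 2 ^ w)
    (hTp : T < p) (hq : 0 < q) (hqp : q ≤ p) (hTl : T < 2 ^ l)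
    (h0 : s.reg 0 = T) (h4 : s.reg 4 = q) (h10 : s.reg 10 = p)
    (hc : ∀ x ≤ T, s.mem 3 x * x ≤ T) (hd : s.drawn = a * T) :
    Runs w ω drawAll s (200 * ((T + 1) * (l + 1))) fun s' =>
      s'.drawn = (a + 1) * T ∧ s'.reg 53 = 2 * T + 2 ∧
      Rep (s'.mem 13) (logCoeff T (s.mem 3) (marks (ZMod p) ω q T a)) (2 * T + 2) := by
  have hpp : p ≤ p * p := Nat.le_mul_self p
  unfold drawAll
  refine WP.seq (WP.assign (2 * T + 2) ?_ ?_)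
  · simp (disch := omega) [h0, mod_word]
  refine WP.seq (WP.call (runs_map (n := 2 * T + 2) 13 (fun _ => 0) 20 rfl rfl (by simp) (by omega)
    ?_) ?_)
  · intro j s1 hj h51 hs1
    refine WP.store j 0 (by simp [h51]) (by simp) ⟨by simp, by simp⟩
  intro s1 t1 ht1 hs1 hz
  have hdiv : ∀ x, (2 * T + 1) / (x + 1) ≤ 2 * T + 1 := fun x => Nat.div_le_self _ _
  refine WP.call (runs_forUp (n := T) (fun i s' => s'.drawn = a * T + i ∧
    Rep (s'.mem 13) (fun j => ∑ x ∈ Finset.range i,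
      logTerm (s.mem 3 (x + 1)) (marks (ZMod p) ω q T a x) x j) (2 * T + 2))
    (fun x => 60 + 48 * ((2 * T + 1) / (x + 1))) rfl rfl ?_ (by omega) ?_ ?_) ?_
  · simp [hs1.reg 0 rfl, h0]
  · refine ⟨by simp [hs1.drawn rfl, hd], fun j hj => ?_⟩
    simp [hz, hj]
  · rintro x s2 hx h51 hs2 ⟨hdr, hR⟩
    have h4' : s2.reg 4 = q := by simp [hs2.reg 4 rfl, hs1.reg 4 rfl, h4]
    have h10' : s2.reg 10 = p := by simp [hs2.reg 10 rfl, hs1.reg 10 rfl, h10]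
    have h53' : s2.reg 53 = 2 * T + 2 := by simp [hs2.reg 53 rfl, hs1.reg 53 rfl]
    have h3' : s2.mem 3 = s.mem 3 := by simp [hs2.mem 3 rfl, hs1.mem 3 rfl]
    have hcx := hc (x + 1) hx
    have hcx' : s.mem 3 (x + 1) ≤ s.mem 3 (x + 1) * (x + 1) := Nat.le_mul_of_pos_right _ (by omega)
    set c := s.mem 3 (x + 1) with hc'
    set r : ZMod p := marks (ZMod p) ω q T a x with hr
    have hrv : r.val = ω (a * T + x) % q := by
      rw [hr, marks, ZMod.val_cast_of_lt ((Nat.mod_lt _ hq).trans_le hqp)]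
    unfold drawBody
    refine WP.seq (WP.rand ?_)
    refine WP.seq (WP.assign r.val (by simp [h4', hdr, hrv]) ?_)
    refine WP.seq (WP.assign (x + 1) ?_ ?_)
    · simp (disch := omega) [h51, mod_word]
    refine WP.seq (WP.assign (-((c * (x + 1) : ℕ) : ZMod p)).val ?_ ?_)
    · rw [← val_neg_mod, ZMod.val_natCast]
      simp (disch := omega) [h10', h3', ← hc', mod_word]
    refine WP.seq (WP.assign (c + 1) ?_ ?_)
    · simp (disch := omega) [h3', mod_word, ← hc']
    refine WP.seq (WP.assign r.val (by simp) ?_)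
    refine WP.seq (WP.assign ((2 * T + 1) / (x + 1)) ?_ ?_)
    · simp (disch := omega) [h53', mod_word]
    refine WP.call (runs_logLoop (c := c) (r := r) (x := x) (M := 2 * T + 1) hp (by omega)
      (by omega) (by simp [h10']) (by simp) (by simp) (by simp) (by simp) (by simp) (by simp)
      (by simpa using hR)) ?_
    intro s3 t3 ht3 hs3 hR3
    refine ⟨?_, ?_, ?_⟩
    · simp at ht3
      have := hdiv x
      omega
    · simp [hs3.drawn rfl, hdr, add_assoc]
    · rw [mem_setR]
      intro j hj
      rw [hR3 j hj]
      dsimp only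
      rw [Finset.sum_range_succ]
  · rintro s2 t2 ht2 hs2 ⟨hdr, hR⟩
    refine ⟨?_, by rw [hdr]; ring, by simp [hs2.reg 53 rfl, hs1.reg 53 rfl], hR⟩
    -- The numbers of multiples over all weights form a harmonic sum.
    have h1 := sum_div_le (2 * T + 1) hTl
    rw [Finset.sum_add_distrib, ← Finset.mul_sum] at ht2
    simp at ht1 ht2
    nlinarith

end

end WordRAM


namespace SubsetSumSeries

open Finset

/-! ### A Fenwick order of summation -/

/-- The largest power of two that divides `t`. -/
def lowBit (t : ℕ) : ℕ := 2 ^ padicValNat 2 t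

theorem two_pow_dvd_iff {t e : ℕ} (ht : t ≠ 0) : 2 ^ e ∣ t ↔ e ≤ padicValNat 2 t :=
  padicValNat_dvd_iff_le ht

theorem lowBit_dvd (t : ℕ) : lowBit t ∣ t := pow_padicValNat_dvd

theorem lowBit_le {t : ℕ} (ht : t ≠ 0) : lowBit t ≤ t :=
  Nat.le_of_dvd (Nat.pos_of_ne_zero ht) (lowBit_dvd t)

theorem lowBit_pos (t : ℕ) : 0 < lowBit t := Nat.two_pow_pos _

/-- For each of the `l` exponents `e`, the multiples of `2 ^ e` up to `T` contribute at most `T` in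
total. -/
theorem sum_lowBit_le {T l : ℕ} (h : T < 2 ^ l) :
    ∑ x ∈ range T, lowBit (x + 1) ≤ l * T := by
  have h1 : ∀ x ∈ range T, lowBit (x + 1) ≤ ∑ e ∈ range l, if 2 ^ e ∣ x + 1 then 2 ^ e else 0 := by
    intro x hx
    have hx' := mem_range.1 hx
    have h2 : padicValNat 2 (x + 1) < l := by
      rw [← Nat.pow_lt_pow_iff_right (a := 2) (by omega)]
      have := lowBit_le x.succ_ne_zero
      simp only [lowBit, Nat.succ_eq_add_one] at this
      omega
    refine le_trans (le_of_eq ?_) (single_le_sum (f := fun e => if 2 ^ e ∣ x + 1 then 2 ^ e else 0)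
      (fun _ _ => Nat.zero_le _) (mem_range.2 h2))
    rw [if_pos ((two_pow_dvd_iff x.succ_ne_zero).2 le_rfl), lowBit]
  refine (sum_le_sum h1).trans ?_
  rw [sum_comm]
  refine (sum_le_card_nsmul _ _ T fun e _ => ?_).trans (by simp)
  rw [← sum_filter, sum_const, smul_eq_mul, Nat.card_multiples]
  exact Nat.div_mul_le_self _ _

/-- Clearing the lowest set bit leaves a number whose lowest set bit is strictly higher. Hence the
window of round `t - lowBit t` contains that of round `t`. -/
theorem sub_lowBit {t : ℕ} (ht : t ≠ 0) (h : t - lowBit t ≠ 0) :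
    2 * lowBit t ≤ lowBit (t - lowBit t) := by
  have h1 : 2 ^ (padicValNat 2 t + 1) ∣ t - lowBit t := by
    obtain ⟨k, hk⟩ := lowBit_dvd t
    have hodd : ¬ 2 ∣ k := by
      rintro ⟨k', rfl⟩
      have : 2 ^ (padicValNat 2 t + 1) ∣ t := ⟨k', by rw [pow_succ]; rw [lowBit] at hk; linarith⟩
      rw [two_pow_dvd_iff ht] at this
      omega
    obtain ⟨k', rfl⟩ : ∃ k', k = 2 * k' + 1 := ⟨k / 2, by omega⟩
    refine ⟨k', ?_⟩
    rw [pow_succ]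
    have h3 : lowBit t * (2 * k' + 1) = lowBit t * 2 * k' + lowBit t := by ring
    rw [← lowBit]
    omega
  rw [two_pow_dvd_iff h] at h1
  calc 2 * lowBit t = 2 ^ (padicValNat 2 t + 1) := by rw [lowBit]; ring
    _ ≤ _ := Nat.pow_le_pow_right (by omega) h1

/-- The windows of the rounds strictly between `t - lowBit t` and `t` end before `t`: `lowBit t'`
divides `t - t'`. -/
theorem add_lowBit_le {t t' : ℕ} (h1 : t - lowBit t < t') (h2 : t' < t) :
    t' + lowBit t' ≤ t := by
  have ht : t ≠ 0 := by omega
  have ht' : t' ≠ 0 := by omega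
  have h3 : lowBit t' ∣ lowBit t := by
    refine pow_dvd_pow 2 (le_of_lt (lt_of_not_ge fun h => ?_))
    have h4 : lowBit t ∣ t' := (two_pow_dvd_iff ht').2 h
    have h5 : lowBit t ∣ t - t' := Nat.dvd_sub (lowBit_dvd t) h4
    have := Nat.le_of_dvd (by omega) h5
    have := lowBit_le ht
    omega
  have h6 : lowBit t' ∣ t - t' := Nat.dvd_sub (h3.trans (lowBit_dvd t)) (lowBit_dvd t')
  have := Nat.le_of_dvd (by omega) h6
  omega

/-- The block of indices that receive a contribution in round `t`. -/
def Win (t j : ℕ) : Prop := t ≤ j ∧ (t = 0 ∨ j < t + lowBit t)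

variable {F : Type} [Field F]

/-- After round `τ`, each sum `S j` contains the contributions of all the indices below the last
round that changed it. -/
def Partial (P G : ℕ → F) (τ : ℕ) (S : ℕ → F) : Prop :=
  ∀ t ≤ τ, ∀ j, Win t j → (∀ t', t < t' → t' ≤ τ → ¬ Win t' j) →
    S j = ∑ a ∈ range t, P a * G (j - a)

theorem partial_zero (P G : ℕ → F) : Partial P G 0 fun _ => 0 := by
  intro t ht j _ _
  obtain rfl : t = 0 := by omega
  simp

theorem Partial.apply_self {P G S : ℕ → F} {t : ℕ} (h : Partial P G t S) :
    S t = ∑ a ∈ range t, P a * G (t - a) :=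
  h t le_rfl t ⟨le_rfl, Or.inr (Nat.lt_add_of_pos_right (lowBit_pos t))⟩ fun t' h1 h2 =>
    absurd h1 (by omega)

/-- For an index in the window of round `t = τ + 1`, the last earlier round that touched it is `t -
lowBit t`. Its sum thus runs over the indices below `t - lowBit t`, and the new contribution extends
it exactly to the indices below `t`. -/
theorem Partial.step {P G S : ℕ → F} {τ : ℕ} (h : Partial P G τ S) :
    Partial P G (τ + 1) fun j => S j + if τ + 1 ≤ j ∧ j < τ + 1 + lowBit (τ + 1) then
      ∑ a ∈ range (lowBit (τ + 1)),
        P (τ + 1 - lowBit (τ + 1) + a) * G (j - (τ + 1 - lowBit (τ + 1) + a)) else 0 := by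
  have hle := lowBit_le τ.succ_ne_zero
  rw [Nat.succ_eq_add_one] at hle
  intro t ht j hw hno
  rcases ht.lt_or_eq with ht | rfl
  · have h1 := hno (τ + 1) ht le_rfl
    dsimp only
    rw [if_neg fun h2 => h1 ⟨h2.1, Or.inr h2.2⟩, add_zero]
    exact h t (by omega) j hw fun t' h3 h4 => hno t' h3 (by omega)
  · have hj : j < τ + 1 + lowBit (τ + 1) := hw.2.resolve_left (by omega)
    dsimp only
    -- The invariant is used for round `t - lowBit t`: it covers `j` by `sub_lowBit` (round `0`
    -- covers everything), and no round in between does by `add_lowBit_le`.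
    rw [if_pos ⟨hw.1, hj⟩, h (τ + 1 - lowBit (τ + 1)) (by have := lowBit_pos (τ + 1); omega) j,
      ← sum_range_add (fun a => P a * G (j - a)), Nat.sub_add_cancel hle]
    · refine ⟨by have := hw.1; omega, ?_⟩
      by_cases h0 : τ + 1 - lowBit (τ + 1) = 0
      · exact Or.inl h0
      · have := sub_lowBit τ.succ_ne_zero h0
        rw [Nat.succ_eq_add_one] at this
        right
        omega
    · rintro t' h1 h2 ⟨h3, h4⟩
      have := add_lowBit_le h1 (by omega)
      have := hw.1
      omega

end SubsetSumSeries

/-! ### Solving the recurrence by online convolution -/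

namespace WordRAM

open WordRAM.Expr WordRAM.Prog SubsetSumSeries Negacyclic

/-- The two polynomials that are multiplied in round `t`. -/
def window {F : Type} [Zero F] (P G : ℕ → F) (t l c : ℕ) : F :=
  if c < l then P (t - l + c) else if c < 8 * l then 0 else
    if c < 10 * l then G (c - 8 * l) else 0

/-- The factors have lengths `l` and `2 * l`, so a product of length `8 * l` has no wraparound. The
length `8 * l` is what `conv` offers when its exponent is the exponent of `l`, the shortest case
being `8`. -/
theorem nega_window {F : Type} [Field F] (P G : ℕ → F) {t l c : ℕ} (hc : c < l) :
    nega (8 * l) (window P G t l) (fun k => window P G t l (8 * l + k)) (l + c) =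
      ∑ a ∈ Finset.range l, P (t - l + a) * G (l + c - a) := by
  rw [nega, show 8 * l = l + 7 * l by ring, Finset.sum_range_add, Finset.sum_eq_zero (s := Finset.range (7 * l)), add_zero]
  · refine Finset.sum_congr rfl fun a ha => ?_
    have ha' := Finset.mem_range.1 ha
    rw [rot, if_pos (by omega), window, if_pos ha', window, if_neg (by omega), if_neg (by omega),
      if_pos (by omega)]
    congr 2
    omega
  · intro a ha
    have ha' := Finset.mem_range.1 ha
    rw [window, if_neg (by omega), if_pos (by omega), zero_mul]

/-- Compute in the registers `12` and `64` the exponent and the value of the largest power of two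
that divides the number in the register `63`. -/
def lowBitLoop : Prog :=
  .assign 12 0 ;;
  .assign 64 1 ;;
  forUp 65 8 (.ite (.bin .eq (reg 63 % (reg 64 * 2)) 0)
    (.assign 64 (reg 64 * 2) ;; .assign 12 (reg 12 + 1)) .skip)

def fillBody : Prog :=
  .ite (.bin .lt (reg 65) (reg 64)) (.store 10 (reg 65) (load 15 (reg 63 - reg 64 + reg 65)))
    (.ite (.bin .lt (reg 65) (reg 67)) (.store 10 (reg 65) 0)
      (.ite (.bin .lt (reg 65) (reg 68)) (.store 10 (reg 65) (load 13 (reg 65 - reg 67)))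
        (.store 10 (reg 65) 0)))

def addBody : Prog :=
  .store 14 (reg 63 + reg 65)
    ((load 14 (reg 63 + reg 65) + load 10 (reg 64 + reg 65)) % reg 10)

/-- One round of the recurrence: array `13` holds the coefficients of the logarithmic derivative,
array `14` the partial sums, array `15` the solution and array `2` the inverses. -/
def roundBody : Prog :=
  .assign 63 (reg 51 + 1) ;;
  lowBitLoop ;;
  .assign 66 (16 * reg 64) ;;
  .assign 67 (8 * reg 64) ;;
  .assign 68 (10 * reg 64) ;;
  forUp 65 66 fillBody ;;
  conv ;;
  forUp 65 64 addBody ;;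
  .store 15 (reg 63) (load 2 (reg 63) * load 14 (reg 63) % reg 10)

section
variable {w : ℕ} {ω : ℕ → Fin (2 ^ w)} {s : State}

theorem runs_lowBitLoop {t l : ℕ} (ht : t ≠ 0) (htl : t < 2 ^ l) (hw : 4 * t ≤ 2 ^ w)
    (hl : l < 2 ^ w) (h8 : s.reg 8 = l) (h63 : s.reg 63 = t) :
    Runs w ω lowBitLoop s (40 * (l + 1)) fun s' =>
      s'.reg 12 = padicValNat 2 t ∧ s'.reg 64 = lowBit t := by
  have hv : padicValNat 2 t < l := by
    rw [← Nat.pow_lt_pow_iff_right (a := 2) (by omega)]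
    exact (lowBit_le ht).trans_lt htl
  have hlt := lowBit_le ht
  unfold lowBitLoop
  refine WP.seq (WP.assign 0 (by simp) ?_)
  refine WP.seq (WP.assign 1 (by simp (disch := omega) [mod_word]) ?_)
  refine WP.call (runs_forUp_const (n := l) (fun i s' => s'.reg 12 = min i (padicValNat 2 t) ∧
    s'.reg 64 = 2 ^ min i (padicValNat 2 t)) 20 rfl rfl (by simp [h8]) (by omega)
    (by simp) ?_) ?_
  · rintro i s1 hi h65 hs1 ⟨h12, h64⟩
    have h63' : s1.reg 63 = t := by simp [hs1.reg 63 rfl, h63]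
    have hle : 2 ^ min i (padicValNat 2 t) ≤ lowBit t :=
      Nat.pow_le_pow_right (by omega) (min_le_right _ _)
    have hvl := Nat.lt_two_pow_self (n := padicValNat 2 t)
    rw [← lowBit] at hvl
    refine WP.ite (2 ^ (min i (padicValNat 2 t) + 1) ∣ t) ?_ (fun h => ?_) (fun h => ?_)
    · rw [pow_succ]
      simp (disch := omega) [h63', h64, mod_word, Nat.dvd_iff_mod_eq_zero]
    · rw [two_pow_dvd_iff ht] at h
      have h1 : min (i + 1) (padicValNat 2 t) = min i (padicValNat 2 t) + 1 := by omega
      refine WP.seq (WP.assign (2 ^ (min i (padicValNat 2 t) + 1)) ?_ ?_)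
      · rw [pow_succ, eval_mul, eval_reg, h64, eval_lit, mod_word (a := 2) (by omega),
          mod_word (by omega)]
      refine WP.assign (min i (padicValNat 2 t) + 1) ?_ ?_
      · simp (disch := omega) [h12, mod_word]
      · refine ⟨by simp, by simp [h1], by simp [h1]⟩
    · rw [two_pow_dvd_iff ht] at h
      have h1 : min (i + 1) (padicValNat 2 t) = min i (padicValNat 2 t) := by omega
      exact WP.skip ⟨by simp, by simp [h1, h12], by simp [h1, h64]⟩
  · rintro s1 t1 ht1 _ ⟨h12, h64⟩
    rw [min_eq_right hv.le] at h12 h64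
    simp at ht1
    exact ⟨by omega, h12, h64⟩

variable {p : ℕ} [Fact p.Prime]

/-- Round `x + 1` multiplies only coefficients of `P` with index at most `x`, which are known, and
completes the sum that determines `P (x + 1)`. -/
theorem runs_roundBody {T l x : ℕ} {half : ZMod p} {P G S : ℕ → ZMod p} (hh : 2 * half = 1)
    (hp : 2 * (p * p) ≤ 2 ^ w) (hw : 16 * ((2 * l + 1) * (8 * (2 * T + 2))) ≤ 2 ^ w)
    (hx : x < T) (hTl : T < 2 ^ l)
    (h8 : s.reg 8 = l) (h10 : s.reg 10 = p) (h11 : s.reg 11 = half.val) (h51 : s.reg 51 = x)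
    (h2 : s.mem 2 (x + 1) = ((x + 1 : ℕ) : ZMod p)⁻¹.val)
    (hG : Rep (s.mem 13) G (2 * T + 2)) (hS : Rep (s.mem 14) S (2 * T + 2))
    (hP : Rep (s.mem 15) P (x + 1)) (hpart : Partial P G x S) :
    Runs w ω roundBody s (200 * (l + 1) + 62000 * (lowBit (x + 1) * (l + 1) ^ 3)) fun s' =>
      s'.mem 15 = Function.update (s.mem 15) (x + 1)
        (((x + 1 : ℕ) : ZMod p)⁻¹ * ∑ a ∈ Finset.range (x + 1), P a * G (x + 1 - a)).val ∧
      ∃ S', Rep (s'.mem 14) S' (2 * T + 2) ∧ Partial P G (x + 1) S' := by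
  have hpp : p ≤ p * p := Nat.le_mul_self p
  have hL0 := lowBit_pos (x + 1)
  have hLx := lowBit_le x.succ_ne_zero
  rw [Nat.succ_eq_add_one] at hLx
  set L := lowBit (x + 1) with hL
  have hu8 : 2 ^ (padicValNat 2 (x + 1) + 3) = 8 * L := by rw [hL, lowBit]; ring
  have hv : padicValNat 2 (x + 1) < l := by
    rw [← Nat.pow_lt_pow_iff_right (a := 2) (by omega)]
    exact hLx.trans_lt (by omega)
  have hw1 : 8 * (2 * T + 2) ≤ (2 * l + 1) * (8 * (2 * T + 2)) :=
    Nat.le_mul_of_pos_left _ (by omega)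
  have hw2 : 2 * l + 1 ≤ (2 * l + 1) * (8 * (2 * T + 2)) := Nat.le_mul_of_pos_right _ (by omega)
  have hw3 : (2 * padicValNat 2 (x + 1) + 1) * 2 ^ (padicValNat 2 (x + 1) + 3) ≤
      (2 * l + 1) * (8 * (2 * T + 2)) := by
    rw [hu8]
    exact Nat.mul_le_mul (by omega) (by omega)
  unfold roundBody
  refine WP.seq (WP.assign (x + 1) ?_ ?_)
  · simp (disch := omega) [h51, mod_word]
  refine WP.seq (WP.call (runs_lowBitLoop (t := x + 1) (l := l) (by omega) (by omega) (by omega)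
    (by omega) (by simp [h8]) (by simp)) ?_)
  rintro s1 t1 ht1 hs1 ⟨h12, h64⟩
  rw [← hL] at h64
  refine WP.seq (WP.assign (16 * L) ?_ ?_)
  · simp (disch := omega) [h64, mod_word]
  refine WP.seq (WP.assign (8 * L) ?_ ?_)
  · simp (disch := omega) [h64, mod_word]
  refine WP.seq (WP.assign (10 * L) ?_ ?_)
  · simp (disch := omega) [h64, mod_word]
  refine WP.seq (WP.call (runs_map (n := 16 * L) 10 (fun c => (window P G (x + 1) L c).val) 40
    rfl rfl (by simp) (by omega) ?_) ?_)
  · intro c s2 hc h65 hs2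
    have h63' : s2.reg 63 = x + 1 := by simp [hs2.reg 63 rfl, hs1.reg 63 rfl]
    have h64' : s2.reg 64 = L := by simp [hs2.reg 64 rfl, h64]
    have h67' : s2.reg 67 = 8 * L := by simp [hs2.reg 67 rfl]
    have h68' : s2.reg 68 = 10 * L := by simp [hs2.reg 68 rfl]
    have h13' : s2.mem 13 = s.mem 13 := by simp [hs2.mem 13 rfl, hs1.mem 13 rfl]
    have h15' : s2.mem 15 = s.mem 15 := by simp [hs2.mem 15 rfl, hs1.mem 15 rfl]
    unfold fillBody
    refine WP.ite (c < L) (by simp [h65, h64']) (fun e1 => ?_) (fun e1 => ?_)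
    · refine WP.store c (window P G (x + 1) L c).val (by simp [h65]) ?_ ⟨by simp, by simp⟩
      simp (disch := omega) [h63', h64', h65, h15', mod_word]
      rw [hP _ (by omega), window, if_pos e1]
    refine WP.ite (c < 8 * L) (by simp [h65, h67']) (fun e2 => ?_) (fun e2 => ?_)
    · refine WP.store c (window P G (x + 1) L c).val (by simp [h65]) ?_ ⟨by simp, by simp⟩
      simp [window, e1, e2]
    refine WP.ite (c < 10 * L) (by simp [h65, h68']) (fun e3 => ?_) (fun e3 => ?_)
    · refine WP.store c (window P G (x + 1) L c).val (by simp [h65]) ?_ ⟨by simp, by simp⟩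
      simp [h65, h67', h13', window, e1, e2, e3]
      exact hG _ (by omega)
    · refine WP.store c (window P G (x + 1) L c).val (by simp [h65]) ?_ ⟨by simp, by simp⟩
      simp [window, e1, e2, e3]
  intro s2 t2 ht2 hs2 hfill
  refine WP.seq (WP.call (runs_conv (u := padicValNat 2 (x + 1)) (A := window P G (x + 1) L) hh hp
    (by omega) ?_ ?_ ?_ ?_) ?_)
  · simp [hs2.reg 10 rfl, hs1.reg 10 rfl, h10]
  · simp [hs2.reg 11 rfl, hs1.reg 11 rfl, h11]
  · simp [hs2.reg 12 rfl, h12]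
  · rw [hu8]
    intro c hc
    rw [hfill]
    dsimp only
    rw [if_pos (by omega)]
  intro s3 t3 ht3 hs3 hconv
  rw [hu8] at hconv
  have hres : ∀ c < L, s3.mem 10 (L + c) =
      (∑ a ∈ Finset.range L, P (x + 1 - L + a) * G (L + c - a)).val := fun c hc => by
    rw [hconv _ (by omega), nega_window _ _ hc]
  set D : ℕ → ZMod p := fun j => ∑ a ∈ Finset.range L, P (x + 1 - L + a) * G (j - (x + 1 - L + a))
    with hD
  have h63' : s3.reg 63 = x + 1 := by simp [hs3.reg 63 rfl, hs2.reg 63 rfl, hs1.reg 63 rfl]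
  have h64' : s3.reg 64 = L := by simp [hs3.reg 64 rfl, hs2.reg 64 rfl, h64]
  have h10' : s3.reg 10 = p := by simp [hs3.reg 10 rfl, hs2.reg 10 rfl, hs1.reg 10 rfl, h10]
  have h14' : s3.mem 14 = s.mem 14 := by simp [hs3.mem 14 rfl, hs2.mem 14 rfl, hs1.mem 14 rfl]
  have h15' : s3.mem 15 = s.mem 15 := by simp [hs3.mem 15 rfl, hs2.mem 15 rfl, hs1.mem 15 rfl]
  have h2' : s3.mem 2 = s.mem 2 := by simp [hs3.mem 2 rfl, hs2.mem 2 rfl, hs1.mem 2 rfl]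
  refine WP.seq (WP.call (runs_forUp_const (n := L) (fun c s' => Rep (s'.mem 14)
    (fun j => S j + if x + 1 ≤ j ∧ j < x + 1 + c then D j else 0) (2 * T + 2)) 30
    rfl rfl h64' (by omega) ?_ ?_) ?_)
  · intro j hj
    rw [mem_setR, h14', hS j hj]
    dsimp only
    rw [if_neg (by omega), add_zero]
  · intro c s4 hc h65 hs4 hR
    have h63'' := (hs4.reg 63 rfl).trans h63'
    have h64'' := (hs4.reg 64 rfl).trans h64'
    have h10'' := (hs4.reg 10 rfl).trans h10'
    have h1 := hR (x + 1 + c) (by omega)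
    dsimp only at h1
    rw [if_neg (by omega), add_zero] at h1
    have h3 : s4.mem 10 (L + c) = (D (x + 1 + c)).val := by
      rw [hs4.mem 10 rfl, hres c hc, hD]
      dsimp only
      congr 1
      refine Finset.sum_congr rfl fun a ha => ?_
      congr 2
      omega
    have h4 := ZMod.val_lt (S (x + 1 + c))
    have h5 := ZMod.val_lt (D (x + 1 + c))
    refine WP.store (x + 1 + c) (S (x + 1 + c) + D (x + 1 + c)).val ?_ ?_ ⟨by simp, ?_⟩
    · simp (disch := omega) [h63'', h65, mod_word]
    · simp (disch := omega) [h63'', h64'', h65, h10'', h1, h3, mod_word, val_add_mod]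
    · intro j hj
      simp only [mem_setR, mem_setM_self, Function.update_apply]
      split_ifs with e1 e2 e2
      · rw [e1]
      · omega
      · rw [hR j hj]
        dsimp only
        rw [if_pos (by omega)]
      · rw [hR j hj]
        dsimp only
        rw [if_neg (by omega)]
  intro s4 t4 ht4 hs4 hR
  -- Round `x + 1` belongs to its own window, so `Partial.apply_self` identifies the sum at `x + 1`
  -- with the right side of the recurrence.
  have hstep := hpart.step
  rw [← hL] at hstep
  change Partial P G (x + 1) (fun j => S j + if x + 1 ≤ j ∧ j < x + 1 + L then D j else 0) at hstep
  have hself := hstep.apply_self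
  have h14 := hR (x + 1) (by omega)
  dsimp only at h14
  rw [hself] at h14
  have hinv := ZMod.val_lt ((x + 1 : ℕ) : ZMod p)⁻¹
  set y : ZMod p := ∑ a ∈ Finset.range (x + 1), P a * G (x + 1 - a) with hy
  have hmul := Nat.mul_lt_mul'' hinv (ZMod.val_lt y)
  refine WP.store (x + 1) (((x + 1 : ℕ) : ZMod p)⁻¹ * y).val ?_ ?_ ⟨?_, ?_, _, ?_, hstep⟩
  · simp [hs4.reg 63 rfl, h63']
  · simp only [eval_mod, eval_mul, eval_load, eval_reg, hs4.reg 63 rfl, h63', hs4.reg 10 rfl, h10',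
      hs4.mem 2 rfl, h2', h2, h14]
    rw [mod_word (by omega), val_mul_mod]
  · simp only [size_load, size_mul, size_mod, size_lit, size_add, size_reg] at *
    have e1 : 2 ^ padicValNat 2 (x + 1) * (padicValNat 2 (x + 1) + 1) ^ 3 ≤ L * (l + 1) ^ 3 := by
      rw [hL, lowBit]
      gcongr
    have e2 : L ≤ L * (l + 1) ^ 3 := Nat.le_mul_of_pos_right _ (by positivity)
    generalize L * (l + 1) ^ 3 = Z at *
    omega
  · simp [hs4.mem 15 rfl, h15']
  · exact hR

/-- Solve the recurrence. -/
def rounds : Prog :=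
  forUp 51 53 (.store 14 (reg 51) 0) ;;
  .store 15 0 1 ;;
  forUp 51 0 roundBody

theorem runs_rounds {T l : ℕ} {half : ZMod p} {P G : ℕ → ZMod p} (hh : 2 * half = 1)
    (hp : 2 * (p * p) ≤ 2 ^ w) (hw : 16 * ((2 * l + 1) * (8 * (2 * T + 2))) ≤ 2 ^ w)
    (hTl : T < 2 ^ l) (hTp : T < p)
    (h0 : s.reg 0 = T) (h8 : s.reg 8 = l) (h10 : s.reg 10 = p) (h11 : s.reg 11 = half.val)
    (h53 : s.reg 53 = 2 * T + 2)
    (h2 : ∀ t, 1 ≤ t → t ≤ T → s.mem 2 t = ((t : ℕ) : ZMod p)⁻¹.val)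
    (hG : Rep (s.mem 13) G (2 * T + 2)) (hP0 : P 0 = 1)
    (hP : ∀ t : ℕ, (t : ZMod p) * P t = ∑ a ∈ Finset.range t, P a * G (t - a)) :
    Runs w ω rounds s (70000 * ((T + 1) * (l + 1) ^ 4)) fun s' =>
      Rep (s'.mem 15) P (T + 1) := by
  have hw1 : 8 * (2 * T + 2) ≤ (2 * l + 1) * (8 * (2 * T + 2)) :=
    Nat.le_mul_of_pos_left _ (by omega)
  have hp1 := (Fact.out : p.Prime).one_lt
  unfold rounds
  refine WP.seq (WP.call (runs_map (n := 2 * T + 2) 14 (fun _ => 0) 20 rfl rfl h53 (by omega)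
    ?_) ?_)
  · intro j s1 hj h51 hs1
    refine WP.store j 0 (by simp [h51]) (by simp) ⟨by simp, by simp⟩
  intro s1 t1 ht1 hs1 hz
  refine WP.seq (WP.store 0 1 (by simp) ?_ ?_)
  · simp (disch := omega) [mod_word]
  refine WP.call (runs_forUp (n := T) (fun x s' => Rep (s'.mem 15) P (x + 1) ∧
    ∃ S, Rep (s'.mem 14) S (2 * T + 2) ∧ Partial P G x S)
    (fun x => 200 * (l + 1) + 62000 * (lowBit (x + 1) * (l + 1) ^ 3)) rfl rfl ?_ (by omega) ?_ ?_)
    ?_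
  · simp [hs1.reg 0 rfl, h0]
  · refine ⟨?_, fun _ => 0, ?_, partial_zero P G⟩
    · intro i hi
      obtain rfl : i = 0 := by omega
      have : Fact (1 < p) := ⟨hp1⟩
      simp [hP0, ZMod.val_one]
    · intro j hj
      simp [mem_setM_of_ne, hz, hj]
  · rintro x s2 hx h51 hs2 ⟨hR, S, hS, hpart⟩
    refine (runs_roundBody (T := T) (l := l) (x := x) (P := P) (G := G) (S := S) hh hp hw hx hTl
      ?_ ?_ ?_ h51 ?_ ?_ hS hR hpart).mono le_rfl ?_
    · simp [hs2.reg 8 rfl, hs1.reg 8 rfl, h8]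
    · simp [hs2.reg 10 rfl, hs1.reg 10 rfl, h10]
    · simp [hs2.reg 11 rfl, hs1.reg 11 rfl, h11]
    · rw [hs2.mem 2 rfl, mem_setM_of_ne _ _ _ _ _ (by decide), hs1.mem 2 rfl]
      exact h2 _ (by omega) (by omega)
    · rw [hs2.mem 13 rfl, mem_setM_of_ne _ _ _ _ _ (by decide), hs1.mem 13 rfl]
      exact hG
    · rintro s3 hs3 ⟨h15, S', hS', hpart'⟩
      refine ⟨?_, S', by simpa using hS', hpart'⟩
      intro j hj
      rw [mem_setR, h15, Function.update_apply]
      split_ifs with e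
      -- This is where `T < p` is needed: the recurrence can be divided by `x + 1 ≤ T`.
      · have hne : ((x + 1 : ℕ) : ZMod p) ≠ 0 := by
          rw [Ne, ZMod.natCast_eq_zero_iff]
          intro h
          have := Nat.le_of_dvd (by omega) h
          omega
        rw [e, ← hP (x + 1), inv_mul_cancel_left₀ hne]
      · exact hR j (by omega)
  · rintro s2 t2 ht2 _ ⟨hR, -⟩
    refine ⟨?_, hR⟩
    have h1 := sum_lowBit_le hTl
    simp only [Finset.sum_add_distrib, ← Finset.mul_sum, ← Finset.sum_mul, Finset.sum_const,
      Finset.card_range, smul_eq_mul, size_lit] at ht2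
    have h3 : (∑ x ∈ Finset.range T, lowBit (x + 1)) * (l + 1) ^ 3 ≤ T * (l + 1) ^ 4 := by
      calc _ ≤ l * T * (l + 1) ^ 3 := Nat.mul_le_mul_right _ h1
        _ ≤ (l + 1) * T * (l + 1) ^ 3 := by gcongr; omega
        _ = _ := by ring
    have h4 : l + 1 ≤ (l + 1) ^ 4 := Nat.le_self_pow (by omega) _
    have h5 : T * (l + 1) ≤ T * (l + 1) ^ 4 := Nat.mul_le_mul_left _ h4
    have h6 : T ≤ T * (l + 1) := Nat.le_mul_of_pos_right _ (by omega)
    have h7 : T * (l + 1) = T * l + T := by ring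
    have h8 : (T + 1) * (l + 1) ^ 4 = T * (l + 1) ^ 4 + (l + 1) ^ 4 := by ring
    rw [h8]
    generalize (∑ x ∈ Finset.range T, lowBit (x + 1)) * (l + 1) ^ 3 = Z at *
    generalize T * (l + 1) ^ 4 = Y at *
    generalize (l + 1) ^ 4 = X at *
    rw [h7] at h5 h6
    generalize T * l = V at *
    omega

/-- One run of the randomized solver. -/
def solve : Prog := drawAll ;; rounds

theorem runs_solve {T q a l : ℕ} {half : ZMod p} (hh : 2 * half = 1)
    (hp : 2 * (p * p) ≤ 2 ^ w) (hw : 16 * ((2 * l + 1) * (8 * (2 * T + 2))) ≤ 2 ^ w)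
    (hTl : T < 2 ^ l) (hTp : T < p) (hq : 0 < q) (hqp : q ≤ p)
    (h0 : s.reg 0 = T) (h4 : s.reg 4 = q) (h8 : s.reg 8 = l) (h10 : s.reg 10 = p)
    (h11 : s.reg 11 = half.val)
    (h2 : ∀ t, 1 ≤ t → t ≤ T → s.mem 2 t = ((t : ℕ) : ZMod p)⁻¹.val)
    (hc : ∀ x ≤ T, s.mem 3 x * x ≤ T) (hd : s.drawn = a * T) :
    Runs w ω solve s (80000 * ((T + 1) * (l + 1) ^ 4)) fun s' =>
      s'.drawn = (a + 1) * T ∧ Rep (s'.mem 15) (fun t => PowerSeries.coeff t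
        (gen T (s.mem 3) (marks (ZMod p) ω q T a))) (T + 1) := by
  have hw1 : 8 * (2 * T + 2) ≤ (2 * l + 1) * (8 * (2 * T + 2)) :=
    Nat.le_mul_of_pos_left _ (by omega)
  unfold solve
  refine WP.seq (WP.call (runs_drawAll (p := p) (a := a) hp (by omega) hTp hq hqp hTl h0 h4 h10 hc
    hd) ?_)
  rintro s1 t1 ht1 hs1 ⟨hdr, h53, hG⟩
  refine WP.call (runs_rounds (T := T) (l := l) hh hp hw hTl hTp ?_ ?_ ?_ ?_ h53 ?_ hG
    (coeff_zero_gen _ _ _) (gen_recurrence _ _ _)) ?_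
  · rw [hs1.reg 0 rfl, h0]
  · rw [hs1.reg 8 rfl, h8]
  · rw [hs1.reg 10 rfl, h10]
  · rw [hs1.reg 11 rfl, h11]
  · rw [hs1.mem 2 rfl]
    exact h2
  · intro s2 t2 ht2 hs2 hP
    refine ⟨?_, by rw [hs2.drawn rfl, hdr], hP⟩
    have h4 : l + 1 ≤ (l + 1) ^ 4 := Nat.le_self_pow (by omega) _
    have h5 : (T + 1) * (l + 1) ≤ (T + 1) * (l + 1) ^ 4 := Nat.mul_le_mul_left _ h4
    omega

end

end WordRAM


namespace WordRAM

open WordRAM.Expr WordRAM.Prog SubsetSumSeries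

/-! ### Parameters, a prime and a table of inverses -/

/-- Compute `reg 71 = 2 ^ reg 8`, the least power of two that is at least `reg 70`. -/
def logLoop : Prog :=
  .assign 71 1 ;;
  .assign 8 0 ;;
  forUp 72 70 (.ite (.bin .lt (reg 71) (reg 70))
    (.assign 71 (reg 71 * 2) ;; .assign 8 (reg 8 + 1)) .skip)

/-- Mark in the array `16` the composite numbers up to `reg 73`. -/
def sieve : Prog :=
  forUp 72 73 (.assign 74 (reg 72 + 2) ;; .assign 75 (reg 73 / reg 74 - 1) ;;
    forUp 76 75 (.store 16 ((reg 76 + 2) * reg 74) 1))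

/-- Find a prime between `reg 4` and `2 * reg 4`. -/
def findPrime : Prog :=
  .assign 10 0 ;;
  forUp 72 4 (.ite (.bin .eq (load 16 (reg 4 + 1 + reg 72)) 0)
    (.assign 10 (reg 4 + 1 + reg 72)) .skip)

/-- Tabulate in the array `2` the inverses of the numbers up to `reg 0`. -/
def inverses : Prog :=
  forUp 72 0 (.assign 74 (reg 72 + 1) ;;
    .ite (.bin .eq (reg 74) 1) (.store 2 (reg 74) 1)
      (.store 2 (reg 74) ((reg 10 - reg 10 / reg 74) * load 2 (reg 10 % reg 74) % reg 10)))

section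
variable {w : ℕ} {ω : ℕ → Fin (2 ^ w)} {s : State}

theorem runs_wordLogLoop {N : ℕ} (hN : 1 ≤ N) (hw : 4 * N ≤ 2 ^ w) (h70 : s.reg 70 = N) :
    Runs w ω logLoop s (40 * N) fun s' => ∃ l, s'.reg 8 = l ∧ s'.reg 71 = 2 ^ l ∧
      N ≤ 2 ^ l ∧ 2 ^ l < 2 * N := by
  unfold logLoop
  refine WP.seq (WP.assign 1 (by simp (disch := omega) [mod_word]) ?_)
  refine WP.seq (WP.assign 0 (by simp) ?_)
  refine WP.call (runs_forUp_const (n := N) (fun i s' => ∃ l, s'.reg 8 = l ∧ s'.reg 71 = 2 ^ l ∧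
    (N ≤ 2 ^ l ∨ l = i) ∧ 2 ^ l < 2 * N) 20 rfl rfl (by simp [h70]) (by omega)
    ⟨0, by simp, by simp, Or.inr rfl, by omega⟩ ?_) ?_
  · rintro i s1 hi h72 hs1 ⟨l, h8, h71, h1, h2⟩
    have h70' : s1.reg 70 = N := by simp [hs1.reg 70 rfl, h70]
    have hl := Nat.lt_two_pow_self (n := l)
    refine WP.ite (2 ^ l < N) (by simp [h71, h70']) (fun h => ?_) (fun h => ?_)
    · refine WP.seq (WP.assign (2 ^ l * 2) ?_ ?_)
      · simp (disch := omega) [h71, mod_word]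
      refine WP.assign (l + 1) ?_ ⟨by simp, l + 1, by simp, by simp [pow_succ], Or.inr (by omega),
        by rw [pow_succ]; omega⟩
      simp (disch := omega) [h8, mod_word]
    · exact WP.skip ⟨by simp, l, by simp [h8], by simp [h71], Or.inl (by omega), h2⟩
  · rintro s1 t1 ht1 _ ⟨l, h8, h71, h1, h2⟩
    simp at ht1
    refine ⟨by omega, l, h8, h71, ?_, h2⟩
    rcases h1 with h1 | h1
    · exact h1
    · rw [h1]
      exact Nat.lt_two_pow_self.le

/-- Every number at least `2` is used for crossing out, prime or not; the harmonic sum still gives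
`O(B * l)`. -/
theorem runs_sieve {B l : ℕ} (hB : B < 2 ^ l) (hw : 4 * (B + 1) ≤ 2 ^ w) (h73 : s.reg 73 = B)
    (h16 : ∀ j, s.mem 16 j = 0) :
    Runs w ω sieve s (100 * ((B + 1) * (l + 1))) fun s' =>
      ∀ j, 2 ≤ j → j ≤ B → (s'.mem 16 j = 0 ↔ j.Prime) := by
  unfold sieve
  have hdiv : ∀ x, B / (x + 2) ≤ B := fun x => Nat.div_le_self _ _
  refine WP.call (runs_forUp (n := B) (fun i s' => ∀ j ≤ B,
    (s'.mem 16 j ≠ 0 ↔ ∃ x < i, ∃ k, j = (k + 2) * (x + 2)))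
    (fun x => 30 + 20 * (B / (x + 1))) rfl rfl h73 (by omega) (by simp [h16]) ?_) ?_
  · intro x s1 hx h72 hs1 hI
    have h73' := (hs1.reg 73 rfl).trans h73
    refine WP.seq (WP.assign (x + 2) ?_ ?_)
    · simp (disch := omega) [h72, mod_word]
    -- The cofactors run from `2` to `B / (x + 2)`, so that `x + 2` itself is not crossed out.
    refine WP.seq (WP.assign (B / (x + 2) - 1) ?_ ?_)
    · simp (disch := omega) [h73', mod_word]
    have hd := hdiv x
    have hmul : B / (x + 2) * (x + 2) ≤ B := Nat.div_mul_le_self _ _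
    have hle : ∀ k < B / (x + 2) - 1, (k + 2) * (x + 2) ≤ B := fun k hk =>
      (Nat.mul_le_mul_right _ (by omega)).trans hmul
    refine WP.call (runs_forUp_const (n := B / (x + 2) - 1) (fun i s' => ∀ j ≤ B,
      (s'.mem 16 j ≠ 0 ↔ (∃ y < x, ∃ k, j = (k + 2) * (y + 2)) ∨
        ∃ k < i, j = (k + 2) * (x + 2))) 12 rfl rfl (by simp) (by omega) ?_ ?_) ?_
    · intro j hj
      simpa using hI j hj
    · intro k s2 hk h76 hs2 hI2
      have h74' : s2.reg 74 = x + 2 := by simp [hs2.reg 74 rfl]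
      have hle' := hle k hk
      have hk' : k + 2 ≤ (k + 2) * (x + 2) := Nat.le_mul_of_pos_right _ (by omega)
      refine WP.store ((k + 2) * (x + 2)) 1 ?_ ?_ ⟨by simp, ?_⟩
      · simp (disch := omega) [h76, h74', mod_word]
      · simp (disch := omega) [mod_word]
      · intro j hj
        simp only [mem_setR, mem_setM_self, Function.update_apply]
        split_ifs with e
        · simp only [ne_eq, one_ne_zero, not_false_eq_true, true_iff]
          exact Or.inr ⟨k, by omega, e⟩
        · rw [hI2 j hj]
          refine or_congr_right ⟨?_, ?_⟩
          · rintro ⟨k', h1, h2⟩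
            exact ⟨k', by omega, h2⟩
          · rintro ⟨k', h1, h2⟩
            refine ⟨k', ?_, h2⟩
            rcases Nat.lt_succ_iff_lt_or_eq.1 h1 with h3 | rfl
            · exact h3
            · exact absurd h2 e
    · intro s2 t2 ht2 hs2 hI2
      refine ⟨?_, ?_⟩
      · have h1 : B / (x + 2) ≤ B / (x + 1) := Nat.div_le_div_left (by omega) (by omega)
        simp at ht2
        omega
      · intro j hj
        rw [mem_setR, hI2 j hj]
        constructor
        · rintro (⟨y, hy, k, h⟩ | ⟨k, _, h⟩)
          · exact ⟨y, by omega, k, h⟩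
          · exact ⟨x, by omega, k, h⟩
        · rintro ⟨y, hy, k, h⟩
          rcases Nat.lt_succ_iff_lt_or_eq.1 hy with h3 | rfl
          · exact Or.inl ⟨y, h3, k, h⟩
          · refine Or.inr ⟨k, ?_, h⟩
            have : k + 2 ≤ B / (y + 2) := by
              rw [Nat.le_div_iff_mul_le (by omega), ← h]
              exact hj
            omega
  · intro s1 t1 ht1 hs1 hI
    refine ⟨?_, fun j h2 hj => ?_⟩
    · have h1 := sum_div_le B hB
      rw [Finset.sum_add_distrib, ← Finset.mul_sum] at ht1
      simp at ht1
      have h2 : (B + 1) * (l + 1) = l * B + B + l + 1 := by ring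
      omega
    · have h := hI j hj
      constructor
      · intro h0
        by_contra hp
        have h1 := (Nat.not_prime_iff_exists_mul_eq (by omega)).1 hp
        obtain ⟨a, b, ha, hb, hab⟩ := h1
        have ha2 : 2 ≤ a := by
          rcases a with _ | _ | a
          · omega
          · omega
          · omega
        have hb2 : 2 ≤ b := by
          rcases b with _ | _ | b
          · omega
          · omega
          · omega
        refine h.2 ⟨b - 2, by omega, a - 2, ?_⟩ h0
        rw [Nat.sub_add_cancel ha2, Nat.sub_add_cancel hb2, hab]
      · intro hp
        by_contra h0
        obtain ⟨x, _, k, hk⟩ := h.1 h0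
        exact Nat.not_prime_mul (by omega) (by omega) (hk ▸ hp)

/-- The greatest prime that is at most `2 * q`. -/
def bigPrime (q : ℕ) : ℕ := Nat.findGreatest Nat.Prime (2 * q)

/-- Bertrand's postulate. Taking the greatest prime makes `p` a function of the input, so that the
random event can be named before the program runs. -/
theorem bigPrime_spec {q : ℕ} (hq : 1 ≤ q) :
    (bigPrime q).Prime ∧ q < bigPrime q ∧ bigPrime q ≤ 2 * q := by
  obtain ⟨p, hp, h1, h2⟩ := Nat.exists_prime_lt_and_le_two_mul q (by omega)
  exact ⟨Nat.findGreatest_spec h2 hp, h1.trans_le (Nat.le_findGreatest h2 hp),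
    Nat.findGreatest_le _⟩

theorem runs_findPrime {q : ℕ} (hq : 1 ≤ q) (hw : 4 * q + 4 ≤ 2 ^ w) (h4 : s.reg 4 = q)
    (h16 : ∀ j, 2 ≤ j → j ≤ 2 * q → (s.mem 16 j = 0 ↔ j.Prime)) :
    Runs w ω findPrime s (50 * (q + 1)) fun s' => s'.reg 10 = bigPrime q := by
  unfold findPrime
  refine WP.seq (WP.assign 0 (by simp) ?_)
  -- Later primes overwrite earlier ones, so the register holds the greatest prime seen; the value
  -- `0` means that none above `q` has been met.
  refine WP.call (runs_forUp_const (n := q) (fun i s' =>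
    s'.reg 10 = if q < Nat.findGreatest Nat.Prime (q + i) then
      Nat.findGreatest Nat.Prime (q + i) else 0) 22 rfl rfl (by simp [h4]) (by omega) ?_ ?_) ?_
  · have := Nat.findGreatest_le (P := Nat.Prime) q
    rw [add_zero, if_neg (by omega)]
    simp
  · intro i s1 hi h72 hs1 h10
    have h4' : s1.reg 4 = q := by simp [hs1.reg 4 rfl, h4]
    have h16' : s1.mem 16 = s.mem 16 := by simp [hs1.mem 16 rfl]
    have hpr := h16 (q + 1 + i) (by omega) (by omega)
    have hsucc : q + (i + 1) = q + i + 1 := rfl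
    have hcomm : q + 1 + i = q + i + 1 := by omega
    refine WP.ite (s.mem 16 (q + 1 + i) = 0) ?_ (fun h => ?_) (fun h => ?_)
    · simp (disch := omega) [h72, h4', h16', mod_word]
    · refine WP.assign (q + 1 + i) ?_ ⟨by simp, ?_⟩
      · simp (disch := omega) [h72, h4', mod_word]
      · have hg : Nat.findGreatest Nat.Prime (q + i + 1) = q + i + 1 := by
          rw [Nat.findGreatest_succ, if_pos (hcomm ▸ hpr.1 h)]
        rw [hsucc, hg, if_pos (by omega)]
        simpa using hcomm
    · refine WP.skip ⟨by simp, ?_⟩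
      rw [hsucc, Nat.findGreatest_succ, if_neg (fun h' => h (hpr.2 (hcomm ▸ h')))]
      simpa using h10
  · intro s1 t1 ht1 _ h1
    simp at ht1
    refine ⟨by omega, ?_⟩
    have h := (bigPrime_spec hq).2.1
    rw [bigPrime] at h ⊢
    dsimp only
    rw [h1, ← two_mul, if_pos h]

/-- Reducing `p = (p / t) * t + p % t` modulo `p` expresses the inverse of `t` by the inverse of the
smaller number `p % t`, which is already tabulated. -/
theorem runs_inverses {p : ℕ} [Fact p.Prime] {T : ℕ} (hp : 2 * (p * p) ≤ 2 ^ w)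
    (hTp : T < p) (h0 : s.reg 0 = T) (h10 : s.reg 10 = p) :
    Runs w ω inverses s (50 * (T + 1)) fun s' =>
      ∀ t, 1 ≤ t → t ≤ T → s'.mem 2 t = ((t : ℕ) : ZMod p)⁻¹.val := by
  have hp1 := (Fact.out : p.Prime).one_lt
  have hpp : p ≤ p * p := Nat.le_mul_self p
  have : Fact (1 < p) := ⟨hp1⟩
  unfold inverses
  refine WP.call (runs_forUp_const (n := T) (fun i s' => ∀ t, 1 ≤ t → t ≤ i →
    s'.mem 2 t = ((t : ℕ) : ZMod p)⁻¹.val) 35 rfl rfl h0 (by omega)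
    (fun t h1 h2 => absurd h1 (by omega)) ?_) ?_
  · intro i s1 hi h72 hs1 hI
    have h10' := (hs1.reg 10 rfl).trans h10
    refine WP.seq (WP.assign (i + 1) ?_ ?_)
    · simp (disch := omega) [h72, mod_word]
    refine WP.ite_store (i + 1 = 1) (i + 1) ((i + 1 : ℕ) : ZMod p)⁻¹.val ?_ (by simp)
      (fun h => ?_) (fun h => ?_) fun t1 ht1 => ⟨?_, ?_⟩
    · simp (disch := omega) [mod_word]
    · rw [h]
      simp (disch := omega) [mod_word, ZMod.val_one]
    -- Here `1 < i + 1 < p`, so `i + 1` does not divide the prime `p` and the table entry at the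
    -- remainder exists.
    · have hr0 : p % (i + 1) ≠ 0 := fun h0 => by
        have h1 := (Nat.dvd_prime (Fact.out : p.Prime)).1 (Nat.dvd_of_mod_eq_zero h0)
        omega
      have hrl : p % (i + 1) < i + 1 := Nat.mod_lt _ (Nat.succ_pos i)
      have hI' := hI (p % (i + 1)) (by omega) (by omega)
      have hdm := Nat.div_add_mod p (i + 1)
      have hdl : p / (i + 1) < p := Nat.div_lt_self (by omega) (by omega)
      have hne : ∀ t : ℕ, t ≠ 0 → t < p → ((t : ℕ) : ZMod p) ≠ 0 := fun t h1 h2 h3 => by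
        rw [ZMod.natCast_eq_zero_iff] at h3
        have := Nat.le_of_dvd (by omega) h3
        omega
      have hz : ((i + 1 : ℕ) : ZMod p)⁻¹ =
          -((p / (i + 1) : ℕ) : ZMod p) * ((p % (i + 1) : ℕ) : ZMod p)⁻¹ := by
        have h1 := hne (i + 1) (by omega) (by omega)
        have h2 := hne (p % (i + 1)) hr0 (by omega)
        have h3 := congrArg (fun n : ℕ => (n : ZMod p)) hdm
        simp only [CharP.cast_eq_zero, Nat.cast_add, Nat.cast_mul] at h3
        field_simp
        push_cast
        push_cast at h3
        linear_combination h3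
      have hmul : (p - p / (i + 1)) * ((p % (i + 1) : ℕ) : ZMod p)⁻¹.val < 2 ^ w := by
        have := Nat.mul_le_mul (Nat.sub_le p (p / (i + 1)))
          (ZMod.val_lt ((p % (i + 1) : ℕ) : ZMod p)⁻¹).le
        omega
      simp only [eval_mod, eval_mul, eval_sub, eval_div, eval_load, eval_reg, reg_setR, mem_setR]
      norm_num
      rw [h10', hI', mod_word hmul, show (i : ZMod p) + 1 = ((i + 1 : ℕ) : ZMod p) by push_cast; rfl,
        hz, ← val_mul_mod, ← val_neg_mod, ZMod.val_cast_of_lt hdl,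
        Nat.mod_eq_of_lt (Nat.sub_lt (by omega) (Nat.div_pos (by omega) (Nat.succ_pos i)))]
    · simp at ht1
      omega
    · intro t h1 h2
      simp only [mem_setR, mem_setM_self, Function.update_apply]
      split_ifs with e
      · rw [e]
      · exact hI t h1 (by omega)
  · intro s1 t1 ht1 _ hI
    exact ⟨by omega, hI⟩

/-- Compute all the parameters of the solver; the register `5` receives the number of
repetitions. -/
def setup (d : ℕ) : Prog :=
  .assign 70 (reg 0 + reg 1 + 2) ;;
  logLoop ;;
  .assign 4 (2 * reg 71) ;;
  .assign 5 (.const (d + 2) * reg 8) ;;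
  .assign 73 (2 * reg 4) ;;
  sieve ;;
  findPrime ;;
  .assign 11 ((reg 10 + 1) / 2) ;;
  inverses

/-- The parameters of the solver have been computed. -/
structure Params (d T n l p : ℕ) (s : State) : Prop where
  prime : p.Prime
  le_two_pow : T + n + 2 ≤ 2 ^ l
  two_pow_lt : 2 ^ l < 2 * (T + n + 2)
  lt_prime : 2 * 2 ^ l < p
  prime_le : p ≤ 4 * 2 ^ l
  reg_q : s.reg 4 = 2 * 2 ^ l
  reg_K : s.reg 5 = (d + 2) * l
  reg_l : s.reg 8 = l
  reg_p : s.reg 10 = p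
  reg_half : ∃ half : ZMod p, 2 * half = 1 ∧ s.reg 11 = half.val
  inv : ∀ t, 1 ≤ t → t ≤ T → s.mem 2 t = ((t : ℕ) : ZMod p)⁻¹.val

theorem runs_setup {d T n l p : ℕ} (hl : l = Nat.clog 2 (T + n + 2))
    (hbp : p = bigPrime (2 * 2 ^ l))
    (hw : (d + 200) * ((T + n + 2) * (T + n + 2)) ≤ 2 ^ w)
    (h0 : s.reg 0 = T) (h1 : s.reg 1 = n) (h16 : ∀ j, s.mem 16 j = 0) :
    Runs w ω (setup d) s (5000 * ((T + n + 2) * (l + 1))) fun s' =>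
      Params d T n l p s' := by
  set N := T + n + 2 with hN
  have hw1 : d + 200 ≤ (d + 200) * (N * N) := Nat.le_mul_of_pos_right _ (by positivity)
  have hw2 : (d + 200) * N ≤ (d + 200) * (N * N) := by
    rw [← mul_assoc]
    exact Nat.le_mul_of_pos_right _ (by omega)
  have hw3 : d * N + 200 * N = (d + 200) * N := by ring
  have hw4 : 200 * (N * N) ≤ (d + 200) * (N * N) := Nat.mul_le_mul_right _ (by omega)
  unfold setup
  refine WP.seq (WP.assign N ?_ ?_)
  · simp (disch := omega) [h0, h1, mod_word, hN]
  refine WP.seq (WP.call (runs_wordLogLoop (N := N) (by omega) (by omega) (by simp)) ?_)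
  rintro s1 t1 ht1 hs1 ⟨l', h8, h71, hl1, hl2⟩
  -- The exponent found by the loop is the ceiling logarithm: its power of two lies in the interval
  -- from `N` to `2 * N`, which contains only one.
  have hll : l' = l := by
    have e1 := Nat.clog_le_of_le_pow hl1
    have e2 := Nat.le_pow_clog (b := 2) (by omega) N
    rw [← hl] at e1 e2
    have e3 : 2 ^ l' < 2 ^ (l + 1) := by
      rw [pow_succ]
      omega
    have e4 := (Nat.pow_lt_pow_iff_right (a := 2) (by omega)).1 e3
    omega
  rw [hll] at h8 h71 hl1 hl2
  clear hl hll l'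
  have hlt := Nat.lt_two_pow_self (n := l)
  have hK : (d + 2) * l ≤ (d + 200) * (2 * N) := Nat.mul_le_mul (by omega) (by omega)
  have hK' : (d + 200) * (2 * N) ≤ (d + 200) * (N * N) :=
    Nat.mul_le_mul_left _ (Nat.mul_le_mul_right _ (by omega))
  have hdw : d + 2 < 2 ^ w := by omega
  have hKw : (d + 2) * l < 2 ^ w := by
    have : (d + 2) * l < (d + 200) * (2 * N) :=
      Nat.mul_lt_mul_of_lt_of_le (by omega) (by omega) (by omega)
    omega
  have hNN : N ≤ N * N := Nat.le_mul_self N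
  have h2l : 2 ^ (l + 3) = 8 * 2 ^ l := by ring
  refine WP.seq (WP.assign (2 * 2 ^ l) ?_ ?_)
  · simp (disch := omega) [h71, mod_word]
  refine WP.seq (WP.assign ((d + 2) * l) ?_ ?_)
  · simp only [eval_mul, eval_const, eval_reg, reg_setR]
    norm_num
    rw [h8, mod_word hKw]
  refine WP.seq (WP.assign (4 * 2 ^ l) ?_ ?_)
  · simp (disch := omega) [mod_word]
    omega
  refine WP.seq (WP.call (runs_sieve (B := 4 * 2 ^ l) (l := l + 3) (by omega) (by omega) (by simp)
    ?_) ?_)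
  · simpa [hs1.mem 16 rfl] using h16
  intro s2 t2 ht2 hs2 hsv
  refine WP.seq (WP.call (runs_findPrime (q := 2 * 2 ^ l) (by omega) (by omega) ?_
    fun j h1 h2 => hsv j h1 (by omega)) ?_)
  · simp [hs2.reg 4 rfl]
  intro s3 t3 ht3 hs3 h10
  obtain ⟨hp, hqp, hpq⟩ := bigPrime_spec (q := 2 * 2 ^ l) (by omega)
  rw [← hbp] at h10 hp hqp hpq
  have : Fact p.Prime := ⟨hp⟩
  have hp2 : p * p ≤ 8 * N * (8 * N) := Nat.mul_le_mul (by omega) (by omega)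
  have hp3 : 8 * N * (8 * N) = 64 * (N * N) := by ring
  -- The prime exceeds `2 * 2 ^ l`, hence it is odd.
  have hhalf : 2 * (((p + 1) / 2 : ℕ) : ZMod p) = 1 := by
    have h1 : 2 * ((p + 1) / 2) = p + 1 := by
      have := hp.eq_two_or_odd
      omega
    have h2 := congrArg (fun n : ℕ => (n : ZMod p)) h1
    push_cast at h2
    simpa using h2
  refine WP.seq (WP.assign ((p + 1) / 2) ?_ ?_)
  · simp (disch := omega) [h10, mod_word]
  refine WP.call (runs_inverses (p := p) (T := T) (by omega) (by omega) ?_ (by simp [h10])) ?_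
  · simp [hs3.reg 0 rfl, hs2.reg 0 rfl, hs1.reg 0 rfl, h0]
  intro s4 t4 ht4 hs4 hinv
  refine ⟨?_, hp, hl1, hl2, hqp, by omega, ?_, ?_, ?_, ?_, ⟨_, hhalf, ?_⟩, hinv⟩
  · simp at ht2 ht3 ht4
    have e1 : (4 * 2 ^ l + 1) * (l + 3 + 1) ≤ 9 * N * (4 * (l + 1)) :=
      Nat.mul_le_mul (by omega) (by omega)
    have e2 : 9 * N * (4 * (l + 1)) = 36 * (N * (l + 1)) := by ring
    have e3 : N ≤ N * (l + 1) := Nat.le_mul_of_pos_right _ (by omega)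
    simp at ht1
    generalize (4 * 2 ^ l + 1) * (l + 3 + 1) = Z at *
    generalize N * (l + 1) = Y at *
    omega
  · simp [hs4.reg 4 rfl, hs3.reg 4 rfl, hs2.reg 4 rfl]
  · simp [hs4.reg 5 rfl, hs3.reg 5 rfl, hs2.reg 5 rfl]
  · simp [hs4.reg 8 rfl, hs3.reg 8 rfl, hs2.reg 8 rfl, h8]
  · simp [hs4.reg 10 rfl, h10]
  · rw [ZMod.val_cast_of_lt (by omega)]
    simp [hs4.reg 11 rfl]

end

end WordRAM


namespace DynSubsetSum

open SubsetSumSeries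

/-! ### Subset sums of multisets -/

/-- Some submultiset of `W` has the sum `t`. -/
def Sub (W : Multiset ℕ) (t : ℕ) : Prop := ∃ S ≤ W, S.sum = t

theorem Sub.mono {W W' : Multiset ℕ} (h : W ≤ W') {t : ℕ} : Sub W t → Sub W' t :=
  fun ⟨S, hS, hs⟩ => ⟨S, hS.trans h, hs⟩

theorem sub_zero (W : Multiset ℕ) : Sub W 0 := ⟨0, Multiset.zero_le _, by simp⟩

theorem sub_nil {t : ℕ} : Sub 0 t ↔ t = 0 := by
  simp [Sub, eq_comm]

theorem sub_cons {W : Multiset ℕ} {x t : ℕ} :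
    Sub (x ::ₘ W) t ↔ Sub W t ∨ (x ≤ t ∧ Sub W (t - x)) := by
  constructor
  · rintro ⟨S, hS, hs⟩
    by_cases hx : x ∈ S
    · right
      have h := Multiset.cons_erase hx
      have h2 : x + (S.erase x).sum = t := by
        rw [← Multiset.sum_cons, h, hs]
      exact ⟨by omega, S.erase x, Multiset.erase_le_iff_le_cons.2 hS, by omega⟩
    · exact Or.inl ⟨S, (Multiset.le_cons_of_notMem hx).1 hS, hs⟩
  · rintro (⟨S, hS, hs⟩ | ⟨hx, S, hS, hs⟩)
    · exact ⟨S, hS.trans (Multiset.le_cons_self _ _), hs⟩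
    · exact ⟨x ::ₘ S, (Multiset.cons_le_cons_iff _).2 hS, by rw [Multiset.sum_cons]; omega⟩

theorem count_mul_le_sum (S : Multiset ℕ) (x : ℕ) : S.count x * x ≤ S.sum := by
  obtain ⟨U, hU⟩ := Multiset.le_iff_exists_add.1
    (Multiset.le_count_iff_replicate_le.1 (le_refl (S.count x)))
  have h := congrArg Multiset.sum hU
  rw [Multiset.sum_add, Multiset.sum_replicate, smul_eq_mul] at h
  omega

/-- Items that occur too often do not matter. -/
theorem sub_of_min_count {W L : Multiset ℕ} {T t : ℕ}
    (h : ∀ x, 0 < x → min (W.count x) (T / x) ≤ L.count x) (ht : t ≤ T) : Sub W t → Sub L t := by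
  rintro ⟨S, hS, hs⟩
  refine ⟨S.filter (0 < ·), Multiset.le_iff_count.2 fun x => ?_, ?_⟩
  · rw [Multiset.count_filter]
    split_ifs with hx
    · refine le_trans (le_min (Multiset.count_le_of_le _ hS) ?_) (h x hx)
      rw [Nat.le_div_iff_mul_le hx]
      have := count_mul_le_sum S x
      omega
    · exact Nat.zero_le _
  · have h1 := congrArg Multiset.sum (Multiset.filter_add_not (0 < ·) S)
    rw [Multiset.sum_add, hs] at h1
    have h2 : (S.filter fun a => ¬ 0 < a).sum = 0 :=
      Multiset.sum_eq_zero fun x hx => by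
        have := (Multiset.mem_filter.1 hx).2
        omega
    omega

theorem reach_iff_sub {T t : ℕ} {L : Multiset ℕ} (hL : ∀ x ∈ L, 1 ≤ x ∧ x ≤ T) :
    Reach T (fun x => L.count x) t ↔ Sub L t := by
  constructor
  · rintro ⟨φ, hφ, hs⟩
    refine ⟨∑ x : Fin T, Multiset.replicate (φ x) (x + 1), Multiset.le_iff_count.2 fun y => ?_, ?_⟩
    · rw [Multiset.count_sum']
      simp only [Multiset.count_replicate]
      by_cases hy : ∃ x : Fin T, (x : ℕ) + 1 = y
      · obtain ⟨x, rfl⟩ := hy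
        rw [Finset.sum_eq_single x]
        · simpa using hφ x
        · intro b _ hb
          rw [if_neg]
          intro h
          exact hb (Fin.ext (by omega))
        · simp
      · rw [Finset.sum_eq_zero]
        · exact Nat.zero_le _
        · intro x _
          rw [if_neg]
          intro h
          exact hy ⟨x, h⟩
    · rw [← hs]
      have := map_sum (Multiset.sumAddMonoidHom : Multiset ℕ →+ ℕ)
        (fun x : Fin T => Multiset.replicate (φ x) ((x : ℕ) + 1)) Finset.univ
      simp only [Multiset.coe_sumAddMonoidHom, Multiset.sum_replicate, smul_eq_mul] at this
      rw [this]
      exact Finset.sum_congr rfl fun x _ => mul_comm _ _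
  · rintro ⟨S, hS, hs⟩
    refine ⟨fun x => S.count ((x : ℕ) + 1), fun x => Multiset.count_le_of_le _ hS, ?_⟩
    rw [← hs, Finset.sum_multiset_count_of_subset S (Finset.Icc 1 T)]
    · rw [Fin.sum_univ_eq_sum_range (fun x => (x + 1) * S.count (x + 1)) T,
        Finset.range_eq_Ico, Finset.sum_Ico_add' (fun x => x * S.count x) 0 T 1]
      rw [show Finset.Ico (0 + 1) (T + 1) = Finset.Icc 1 T by ext; simp]
      exact Finset.sum_congr rfl fun x _ => by rw [smul_eq_mul, mul_comm]
    · intro x hx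
      have := hL x (Multiset.mem_of_le hS (Multiset.mem_toFinset.1 hx))
      simp [this.1, this.2]

/-! ### Removing superfluous items -/

/-- The weights of the inserted items. -/
def weights : List Op → Multiset ℕ
  | [] => 0
  | .insert x :: ops => x ::ₘ weights ops
  | .query _ :: ops => weights ops

theorem weights_append (l l' : List Op) : weights (l ++ l') = weights l + weights l' := by
  induction l with
  | nil => simp [weights]
  | cons o l ih => cases o <;> simp [weights, ih]

/-- Add an item to the list of items unless there are enough items of the same weight. -/
def keep (T : ℕ) (L : List ℕ) : Op → List ℕ
  | .insert x => if L.count x < T / x then L ++ [x] else L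
  | .query _ => L

/-- The items that matter for the sums up to `T`. -/
def kept (T : ℕ) (ops : List Op) : List ℕ := ops.foldl (keep T) []

theorem kept_concat (T : ℕ) (ops : List Op) (o : Op) :
    kept T (ops ++ [o]) = keep T (kept T ops) o := by
  simp [kept]

theorem keep_prefix (T : ℕ) (L : List ℕ) (o : Op) : L <+: keep T L o := by
  cases o with
  | insert x =>
    rw [keep]
    split_ifs
    · exact List.prefix_append _ _
    · exact List.prefix_rfl
  | query t => exact List.prefix_rfl

theorem kept_prefix (T : ℕ) (l l' : List Op) : kept T l <+: kept T (l ++ l') := by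
  induction l' using List.reverseRecOn with
  | nil => simp
  | append_singleton l' o ih =>
    rw [← List.append_assoc, kept_concat]
    exact ih.trans (keep_prefix _ _ _)

theorem count_kept (T : ℕ) (ops : List Op) (x : ℕ) :
    (kept T ops).count x = min ((weights ops).count x) (T / x) := by
  induction ops using List.reverseRecOn with
  | nil => simp [kept, weights]
  | append_singleton ops o ih =>
    rw [kept_concat, weights_append, Multiset.count_add]
    cases o with
    | insert y =>
      rw [keep]
      by_cases hxy : x = y
      · subst hxy
        split_ifs with h
        · simp [weights, ih]
          omega
        · rw [ih] at h ⊢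
          simp [weights]
          omega
      · have h1 : ([y] : List ℕ).count x = 0 := by simp [Ne.symm hxy]
        have h2 : (weights [Op.insert y]).count x = 0 := by simp [weights, hxy]
        rw [h2, add_zero, ← ih]
        split_ifs
        · rw [List.count_append, h1, add_zero]
        · rfl
    | query t => simp [keep, weights, ih]

/-- The bound `T / x` on the multiplicity is `0` for `x > T` and, by the convention for division by
zero, also for `x = 0`; the machine uses the same convention. -/
theorem mem_kept {T : ℕ} {ops : List Op} {x : ℕ} (hx : x ∈ kept T ops) : 1 ≤ x ∧ x ≤ T := by
  have h := count_kept T ops x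
  have h1 := List.count_pos_iff.2 hx
  have h2 : 0 < T / x := by omega
  constructor
  · by_contra h3
    obtain rfl : x = 0 := by omega
    simp at h2
  · by_contra h3
    rw [Nat.div_eq_of_lt (by omega)] at h2
    omega

theorem length_kept_le (T : ℕ) (ops : List Op) : (kept T ops).length ≤ ops.length := by
  induction ops using List.reverseRecOn with
  | nil => simp [kept]
  | append_singleton ops o ih =>
    rw [kept_concat]
    cases o with
    | insert y =>
      rw [keep]
      split_ifs <;> simp <;> omega
    | query t =>
      simp [keep]
      omega

/-- The multiplicities are at most `T / x`, so the length is bounded by a harmonic sum. This is the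
source of the `√tmax` in the minimum. -/
theorem length_kept_le_mul {T l : ℕ} (hT : T < 2 ^ l) (ops : List Op) :
    (kept T ops).length ≤ l * T := by
  refine le_trans ?_ (sum_div_le T hT)
  have h : (kept T ops).length = ∑ x ∈ Finset.Icc 1 T, (kept T ops).count x := by
    rw [← Multiset.coe_card, ← Multiset.sum_count_eq_card (s := Finset.Icc 1 T)]
    · simp
    · intro x hx
      have := mem_kept (Multiset.mem_coe.1 hx)
      simp [this.1, this.2]
  rw [h, Finset.range_eq_Ico, Finset.sum_Ico_add' (fun x => T / x) 0 T 1,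
    show Finset.Ico (0 + 1) (T + 1) = Finset.Icc 1 T by ext; simp]
  exact Finset.sum_le_sum fun x _ => (count_kept T ops x).trans_le (min_le_right _ _)

theorem sub_kept_iff {T t : ℕ} (ht : t ≤ T) (ops : List Op) :
    Sub (kept T ops : Multiset ℕ) t ↔ Sub (weights ops) t := by
  constructor
  · refine Sub.mono (Multiset.le_iff_count.2 fun x => ?_)
    rw [Multiset.coe_count, count_kept]
    exact min_le_left _ _
  · refine sub_of_min_count (T := T) (fun x _ => ?_) ht
    rw [Multiset.coe_count, count_kept]

/-! ### The answers -/

open Classical in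
theorem answersFrom_concat (W : Multiset ℕ) (l : List Op) (o : Op) :
    answersFrom W (l ++ [o]) = answersFrom W l ++
      match o with
      | .insert _ => []
      | .query t => [if Sub (W + weights l) t then 1 else 0] := by
  induction l generalizing W with
  | nil => cases o <;> simp [answersFrom, weights, Sub]
  | cons a l ih =>
    cases a with
    | insert x =>
      rw [List.cons_append, answersFrom, ih, answersFrom, weights, Multiset.cons_add,
        Multiset.add_cons]
    | query t =>
      rw [List.cons_append, answersFrom, ih, answersFrom, weights, List.cons_append]

/-- `v` is the least number of items with which the sum `t` is possible. -/
def IsFirst (L : List ℕ) (t v : ℕ) : Prop :=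
  v ≤ L.length + 1 ∧ ∀ j ≤ L.length, v ≤ j ↔ Sub (L.take j : Multiset ℕ) t

/-- The items kept during the first operations form a prefix of all kept items, so one threshold per
sum, computed for the whole sequence, answers queries at every moment. -/
theorem IsFirst.answer {T t v : ℕ} {l l' : List Op} (h : IsFirst (kept T (l ++ l')) t v)
    (ht : t ≤ T) : v ≤ (kept T l).length ↔ Sub (weights l) t := by
  rw [h.2 _ (kept_prefix T l l').length_le, ← sub_kept_iff ht,
    ← List.prefix_iff_eq_take.1 (kept_prefix T l l')]

end DynSubsetSum


namespace WordRAM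

open WordRAM.Expr WordRAM.Prog SubsetSumSeries DynSubsetSum

/-! ### Selection of the items and the block length -/

def filterBody : Prog :=
  .ite (.bin .eq (load 0 (reg 51)) 0)
    (.assign 52 (load 1 (reg 51)) ;;
      .ite (.bin .lt (load 8 (reg 52)) (reg 0 / reg 52))
        (.store 8 (reg 52) (load 8 (reg 52) + 1) ;; .store 5 (reg 2) (reg 52) ;;
          .assign 2 (reg 2 + 1))
        .skip)
    .skip ;;
  .store 6 (reg 51) (reg 2)

/-- Write the items that matter to the array `5`, their number to the register `2`, and the
number of such items among the first operations to the array `6`. -/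
def filterItems : Prog := .assign 2 0 ;; forUp 51 1 filterBody

/-- The items that matter are in the memory. -/
structure Items (T : ℕ) (ops : List Op) (L : List ℕ) (s : State) : Prop where
  reg_m : s.reg 2 = L.length
  item : ∀ j (h : j < L.length), s.mem 5 j = L[j]
  kap : ∀ i < ops.length, s.mem 6 i = (kept T (ops.take (i + 1))).length

section
variable {w : ℕ} {ω : ℕ → Fin (2 ^ w)} {s : State}

theorem runs_filterItems {T : ℕ} {ops : List Op} (hw : 4 * (T + ops.length + 2) ≤ 2 ^ w)
    (h0 : s.reg 0 = T) (h1 : s.reg 1 = ops.length)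
    (hk : ∀ i (h : i < ops.length), s.mem 0 i = ops[i].kind)
    (hv : ∀ i (h : i < ops.length), s.mem 1 i = ops[i].value)
    (h8 : ∀ x, s.mem 8 x = 0) :
    Runs w ω filterItems s (60 * (ops.length + 1)) (Items T ops (kept T ops)) := by
  unfold filterItems
  refine WP.seq (WP.assign 0 (by simp) ?_)
  refine WP.call (runs_forUp_const (n := ops.length) (fun i s' =>
    s'.reg 2 = (kept T (ops.take i)).length ∧
    (∀ j (h : j < (kept T (ops.take i)).length), s'.mem 5 j = (kept T (ops.take i))[j]) ∧
    (∀ x, s'.mem 8 x = (kept T (ops.take i)).count x) ∧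
    ∀ j < i, s'.mem 6 j = (kept T (ops.take (j + 1))).length) 40
    rfl rfl (by simp [h1]) (by omega) (by simp [kept, h8]) ?_) ?_
  · rintro i s1 hi h51 hs1 ⟨hm, hit, hc, hkap⟩
    have h0' : s1.reg 0 = T := by simp [hs1.reg 0 rfl, h0]
    have hk' : s1.mem 0 i = ops[i].kind := by simp [hs1.mem 0 rfl, hk i hi]
    have hv' : s1.mem 1 i = ops[i].value := by simp [hs1.mem 1 rfl, hv i hi]
    have htake : ops.take (i + 1) = ops.take i ++ [ops[i]] := by
      rw [List.take_add_one, List.getElem?_eq_getElem hi]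
      rfl
    have hlen := length_kept_le T (ops.take i)
    rw [List.length_take] at hlen
    have hkap' : ∀ (s' : State), s'.mem 6 = Function.update (s1.mem 6) i
        (kept T (ops.take (i + 1))).length → ∀ j < i + 1,
        s'.mem 6 j = (kept T (ops.take (j + 1))).length := by
      intro s' hs' j hj
      rw [hs', Function.update_apply]
      split_ifs with e
      · rw [e]
      · exact hkap j (by omega)
    generalize hL : kept T (ops.take i) = L at *
    have hnext : kept T (ops.take (i + 1)) = keep T L ops[i] := by
      rw [htake, kept_concat, hL]
    unfold filterBody
    refine WP.seq ?_
    cases ho : ops[i] with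
    | query t =>
      rw [ho] at hk' hnext
      rw [keep] at hnext
      refine WP.ite False (by simp [h51, hk', Op.kind]) (fun h => h.elim) fun _ => WP.skip ?_
      refine WP.store i L.length (by simp [h51]) (by simp [hm]) ⟨by simp, ?_⟩
      rw [hnext] at hkap' ⊢
      exact ⟨by simp [hm], fun j h => by simp [mem_setM_of_ne, hit j h],
        fun x => by simp [mem_setM_of_ne, hc x], fun j hj => hkap' _ (by simp) j hj⟩
    | insert x =>
      rw [ho] at hk' hv' hnext
      rw [keep] at hnext
      refine WP.ite True (by simp [h51, hk', Op.kind]) (fun _ => ?_) (fun h => absurd trivial h)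
      refine WP.seq (WP.assign x (by simp [h51, hv', Op.value]) ?_)
      refine WP.ite (L.count x < T / x) (by simp [hc, h0']) (fun h => ?_) (fun h => ?_)
      · rw [if_pos h] at hnext
        have hdiv := Nat.div_le_self T x
        refine WP.seq (WP.store x (L.count x + 1) (by simp) ?_ ?_)
        · simp (disch := omega) [hc, mod_word]
        refine WP.seq (WP.store L.length x (by simp [hm]) (by simp) ?_)
        refine WP.assign (L.length + 1) ?_ ?_
        · simp (disch := omega) [hm, mod_word]
        refine WP.store i (L.length + 1) (by simp [h51]) (by simp) ⟨by simp, ?_⟩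
        rw [hnext] at hkap' ⊢
        refine ⟨by simp, fun j h => ?_, fun y => ?_, fun j hj => hkap' _ ?_ j hj⟩
        · simp only [mem_setR, mem_setM]
          norm_num
          rw [Function.update_apply]
          split_ifs with e
          · subst e
            simp
          · rw [List.getElem_append_left (by simp at h; omega)]
            exact hit j _
        · simp only [mem_setR, mem_setM]
          norm_num
          by_cases e : y = x
          · simp [e]
          · simp [e, Ne.symm e, hc]
        · simp [mem_setM_of_ne]
      · rw [if_neg h] at hnext
        refine WP.skip ?_
        refine WP.store i L.length (by simp [h51]) (by simp [hm]) ⟨by simp, ?_⟩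
        rw [hnext] at hkap' ⊢
        exact ⟨by simp [hm], fun j h => by simp [mem_setM_of_ne, hit j h],
          fun x => by simp [mem_setM_of_ne, hc x], fun j hj => hkap' _ (by simp) j hj⟩
  · rintro s1 t1 ht1 _ ⟨hm, hit, hc, hkap⟩
    simp only [List.take_length] at hm hit
    simp at ht1
    exact ⟨by omega, hm, hit, hkap⟩

/-- Compute in the register `3` the least positive number whose square is at least `reg 2`, and
in the register `6` the number of blocks of this length. -/
def blockLength : Prog :=
  .assign 3 1 ;;
  forUp 51 2 (.ite (.bin .lt (reg 3 * reg 3) (reg 2)) (.assign 3 (reg 3 + 1)) .skip) ;;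
  .assign 6 ((reg 2 + reg 3 - 1) / reg 3)

/-- Blocks of length `b` partition `m` items. -/
structure Blocks (m b nb : ℕ) : Prop where
  pos : 1 ≤ b
  small : b = 1 ∨ (b - 1) * (b - 1) < m
  nb_le : nb ≤ b
  le_mul : m ≤ nb * b
  mul_lt : nb * b < m + b

theorem runs_blockLength {m : ℕ} (hw : 4 * (m + 2) * (m + 2) ≤ 2 ^ w) (h2 : s.reg 2 = m) :
    Runs w ω blockLength s (60 * (m + 1)) fun s' =>
      ∃ b nb, s'.reg 3 = b ∧ s'.reg 6 = nb ∧ Blocks m b nb := by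
  have hmm : m + 2 ≤ (m + 2) * (m + 2) := Nat.le_mul_self _
  rw [mul_assoc] at hw
  unfold blockLength
  refine WP.seq (WP.assign 1 (by simp (disch := omega) [mod_word]) ?_)
  refine WP.seq (WP.call (runs_forUp_const (n := m) (fun i s' => ∃ b, s'.reg 3 = b ∧ 1 ≤ b ∧
    (b = 1 ∨ (b - 1) * (b - 1) < m) ∧ (m ≤ b * b ∨ b = i + 1) ∧ b ≤ i + 1) 20 rfl rfl
    (by simp [h2]) (by omega) ⟨1, by simp⟩ ?_) ?_)
  · rintro i s1 hi h51 hs1 ⟨b, h3, hb1, hb2, hb3, hb4⟩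
    have h2' : s1.reg 2 = m := by simp [hs1.reg 2 rfl, h2]
    have hbb : b * b ≤ (m + 2) * (m + 2) := Nat.mul_le_mul (by omega) (by omega)
    refine WP.ite (b * b < m) ?_ (fun h => ?_) (fun h => ?_)
    · simp (disch := omega) [h3, h2', mod_word]
    · refine WP.assign (b + 1) ?_ ⟨by simp, b + 1, by simp, by omega, Or.inr (by simpa using h),
        Or.inr (by omega), by omega⟩
      simp (disch := omega) [h3, mod_word]
    · exact WP.skip ⟨by simp, b, by simp [h3], hb1, hb2, Or.inl (by omega), by omega⟩
  · rintro s1 t1 ht1 hs1 ⟨b, h3, hb1, hb2, hb3, hb4⟩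
    have h2' : s1.reg 2 = m := by simp [hs1.reg 2 rfl, h2]
    have hmb : m ≤ b * b := by
      rcases hb3 with h | h
      · exact h
      · rw [h]
        nlinarith
    refine WP.assign ((m + b - 1) / b) ?_ ⟨?_, b, (m + b - 1) / b, by simp [h3], by simp, hb1, hb2,
      ?_, ?_, ?_⟩
    · simp (disch := omega) [h3, h2', mod_word]
    · simp at ht1 ⊢
      omega
    · refine Nat.le_of_lt_succ (Nat.div_lt_of_lt_mul ?_)
      rw [Nat.mul_succ]
      omega
    · have h5 := Nat.div_add_mod (m + b - 1) b
      have h6 := Nat.mod_lt (m + b - 1) hb1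
      rw [mul_comm]
      omega
    · have := Nat.div_mul_le_self (m + b - 1) b
      omega

end

end WordRAM


namespace WordRAM

open WordRAM.Expr WordRAM.Prog SubsetSumSeries DynSubsetSum

/-! ### Locating the sums up to the block length -/

/-- Add the items of the block with index `reg 80` to the multiplicities in the array `3`. -/
def countLoop : Prog :=
  forUp 51 3 (.assign 52 (reg 80 * reg 3 + reg 51) ;;
    .ite (.bin .lt (reg 52) (reg 2))
      (.store 3 (load 5 (reg 52)) (load 3 (load 5 (reg 52)) + 1)) .skip)

/-- Record in the array `4` the sums that were found for the first time. -/
def recordLoop : Prog :=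
  .assign 53 (reg 0 + 1) ;;
  forUp 51 53 (.ite (.bin .eq (load 4 (reg 51)) 0)
    (.ite (.bin .eq (load 15 (reg 51)) 0) .skip (.store 4 (reg 51) (reg 80 + 1))) .skip)

def allBlocks : Prog := forUp 80 6 (countLoop ;; forUp 81 5 (solve ;; recordLoop))

/-- The multiplicities of the items of the first `k + 1` blocks. -/
def blockCount (L : List ℕ) (b k x : ℕ) : ℕ := (L.take ((k + 1) * b)).count x

/-- The run `a` of the solver finds the sum `t`. -/
def Hit (p : ℕ) [Fact p.Prime] {w : ℕ} (ω : ℕ → Fin (2 ^ w)) (q T K b : ℕ) (L : List ℕ)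
    (a t : ℕ) : Prop :=
  PowerSeries.coeff t (gen T (blockCount L b (a / K)) (marks (ZMod p) ω q T a)) ≠ 0

/-- `v` is one plus the block of the first of the runs `0, …, A - 1` that succeeds, and `0` if no
run succeeds. -/
def FirstHit (K : ℕ) (hit : ℕ → Prop) (A v : ℕ) : Prop :=
  (v = 0 ∧ ∀ a < A, ¬ hit a) ∨ ∃ a < A, hit a ∧ (∀ a' < a, ¬ hit a') ∧ v = a / K + 1

theorem FirstHit.step {K A v : ℕ} {hit : ℕ → Prop} (h : FirstHit K hit A v) :
    (v ≠ 0 → FirstHit K hit (A + 1) v) ∧ (v = 0 → ¬ hit A → FirstHit K hit (A + 1) 0) ∧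
      (v = 0 → hit A → FirstHit K hit (A + 1) (A / K + 1)) := by
  rcases h with ⟨rfl, h⟩ | ⟨a, ha, h1, h2, rfl⟩
  · refine ⟨fun h => absurd rfl h, fun _ h1 => Or.inl ⟨rfl, fun a ha => ?_⟩, fun _ h1 =>
      Or.inr ⟨A, by omega, h1, h, rfl⟩⟩
    rcases Nat.lt_succ_iff_lt_or_eq.1 ha with h2 | rfl
    · exact h a h2
    · exact h1
  · exact ⟨fun _ => Or.inr ⟨a, by omega, h1, h2, rfl⟩, fun h => absurd h (Nat.succ_ne_zero _),
      fun h => absurd h (Nat.succ_ne_zero _)⟩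

section
variable {w : ℕ} {ω : ℕ → Fin (2 ^ w)} {s : State}

theorem runs_countLoop {L : List ℕ} {k b : ℕ} (hw : 4 * (k * b + b + L.length + 2) ≤ 2 ^ w)
    (h2 : s.reg 2 = L.length) (h3 : s.reg 3 = b) (h80 : s.reg 80 = k)
    (hit : ∀ j (h : j < L.length), s.mem 5 j = L[j])
    (hc : s.mem 3 = fun x => (L.take (k * b)).count x) :
    Runs w ω countLoop s (b * 40 + 6) fun s' => s'.mem 3 = blockCount L b k := by
  unfold countLoop
  refine (runs_forUp_const (n := b) (fun j s' =>
    s'.mem 3 = fun x => (L.take (k * b + j)).count x) 32 rfl rfl h3 (by omega) (by simp [hc])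
    ?_).mono le_rfl ?_
  · intro j s1 hj h51 hs1 hI
    have h2' := (hs1.reg 2 rfl).trans h2
    have h3' := (hs1.reg 3 rfl).trans h3
    have h80' := (hs1.reg 80 rfl).trans h80
    have hit' : s1.mem 5 = s.mem 5 := hs1.mem 5 rfl
    refine WP.seq (WP.assign (k * b + j) ?_ ?_)
    · simp (disch := omega) [h51, h3', h80', mod_word]
    refine WP.ite (k * b + j < L.length) (by simp [h2']) (fun h => ?_) (fun h => ?_)
    · have hx := hit _ h
      have hcount : (L.take (k * b + j)).count L[k * b + j] + 1 < 2 ^ w := by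
        have h5 := List.count_le_length (a := L[k * b + j]) (l := L.take (k * b + j))
        rw [List.length_take] at h5
        omega
      refine WP.store L[k * b + j] ((L.take (k * b + j)).count L[k * b + j] + 1) ?_ ?_
        ⟨by simp, ?_⟩
      · simp [hit', hx]
      · simp only [eval_add, eval_load, eval_reg, reg_setR, mem_setR, if_true, hit', hx, hI,
          eval_lit]
        rw [mod_word (a := 1) (by omega), mod_word hcount]
      · ext x
        rw [← add_assoc, List.take_add_one, List.getElem?_eq_getElem h, Option.toList_some,
          List.count_append]
        simp only [mem_setR, mem_setM_self, Function.update_apply, hI]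
        split_ifs with e
        · rw [e]
          simp
        · simp [Ne.symm e]
    · refine WP.skip ⟨by simp, ?_⟩
      dsimp only [mem_setR]
      rw [hI]
      ext x
      rw [List.take_of_length_le (by omega), List.take_of_length_le (by omega)]
  · intro s1 _ h
    rw [h]
    ext x
    rw [blockCount, add_mul, one_mul]

theorem runs_recordLoop {T k K A : ℕ} {hit : ℕ → ℕ → Prop} (hw : 4 * (T + k + 2) ≤ 2 ^ w)
    (h0 : s.reg 0 = T) (h80 : s.reg 80 = k) (hA : A / K = k)
    (h4 : ∀ t ≤ T, FirstHit K (fun a => hit a t) A (s.mem 4 t))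
    (h15 : ∀ t ≤ T, (s.mem 15 t ≠ 0 ↔ hit A t)) :
    Runs w ω recordLoop s (40 * (T + 1) + 20) fun s' =>
      ∀ t ≤ T, FirstHit K (fun a => hit a t) (A + 1) (s'.mem 4 t) := by
  unfold recordLoop
  refine WP.seq (WP.assign (T + 1) ?_ ?_)
  · simp (disch := omega) [h0, mod_word]
  refine WP.call (runs_forUp_const (n := T + 1) (fun i s' => ∀ t ≤ T,
    if t < i then FirstHit K (fun a => hit a t) (A + 1) (s'.mem 4 t)
    else s'.mem 4 t = s.mem 4 t) 25 rfl rfl (by simp) (by omega) (by simp) ?_) ?_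
  · intro i s1 hi h51 hs1 hI
    have h80' : s1.reg 80 = k := by simp [hs1.reg 80 rfl, h80]
    have h15' : s1.mem 15 = s.mem 15 := by simp [hs1.mem 15 rfl]
    have hi4 := hI i (by omega)
    rw [if_neg (lt_irrefl i)] at hi4
    obtain ⟨e1, e2, e3⟩ := (h4 i (by omega)).step
    have hfin : ∀ (s' : State) (v : ℕ), s'.mem 4 = Function.update (s1.mem 4) i v →
        FirstHit K (fun a => hit a i) (A + 1) v → ∀ t ≤ T,
        if t < i + 1 then FirstHit K (fun a => hit a t) (A + 1) (s'.mem 4 t)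
        else s'.mem 4 t = s.mem 4 t := by
      intro s' v hs' hv t ht
      rw [hs', Function.update_apply]
      have := hI t ht
      split_ifs with a1 a2 a2
      · rwa [a2]
      · rwa [if_pos (by omega)] at this
      · omega
      · rwa [if_neg (by omega)] at this
    have hupd : s1.mem 4 = Function.update (s1.mem 4) i (s.mem 4 i) := by
      rw [← hi4, Function.update_eq_self]
    refine WP.ite (s.mem 4 i = 0) (by simp [h51, hi4]) (fun a1 => ?_) (fun a1 => ?_)
    · refine WP.ite (s.mem 15 i = 0) (by simp [h51, h15']) (fun a2 => ?_) (fun a2 => ?_)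
      · refine WP.skip ⟨by simp, hfin _ (s.mem 4 i) (by simpa using hupd) ?_⟩
        rw [a1]
        exact e2 a1 fun h => (h15 i (by omega)).2 h a2
      · refine WP.store i (k + 1) (by simp [h51]) ?_ ⟨by simp, hfin _ (k + 1) (by simp) ?_⟩
        · simp (disch := omega) [h80', mod_word]
        · rw [← hA]
          exact e3 a1 ((h15 i (by omega)).1 a2)
    · exact WP.skip ⟨by simp, hfin _ (s.mem 4 i) (by simpa using hupd) (e1 a1)⟩
  · intro s1 t1 ht1 _ hI
    refine ⟨?_, fun t ht => ?_⟩
    · simp at ht1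
      omega
    · have := hI t ht
      rwa [if_pos (by omega)] at this

/-- The multiplicities are only extended from block to block, and the solver is run `K` times on
each prefix. The runs are numbered consecutively, so run `a` belongs to block `a / K` and draws its
own `T` words. -/
theorem runs_allBlocks {d T n l p b nb : ℕ} [Fact p.Prime] {L : List ℕ}
    (hpar : Params d T n l p s) (hw : 16 * ((2 * l + 1) * (8 * (2 * T + 2))) ≤ 2 ^ w)
    (hp : 2 * (p * p) ≤ 2 ^ w) (hK : (d + 2) * l < 2 ^ w)
    (hw2 : 8 * (T + L.length + b + nb + 2) ≤ 2 ^ w)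
    (hb : Blocks L.length b nb) (hL : ∀ x, L.count x * x ≤ T)
    (h0 : s.reg 0 = T) (h2 : s.reg 2 = L.length) (h3 : s.reg 3 = b) (h6 : s.reg 6 = nb)
    (hit : ∀ j (h : j < L.length), s.mem 5 j = L[j])
    (hc : ∀ x, s.mem 3 x = 0) (hl : ∀ x, s.mem 4 x = 0) (hd : s.drawn = 0) :
    Runs w ω allBlocks s
      (nb * (40 * b + 20 + (d + 2) * l * (80100 * ((T + 1) * (l + 1) ^ 4))) + 6) fun s' =>
      ∀ t ≤ T, FirstHit ((d + 2) * l)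
        (fun a => Hit p ω (2 * 2 ^ l) T ((d + 2) * l) b L a t) (nb * ((d + 2) * l))
        (s'.mem 4 t) := by
  obtain ⟨half, hhalf, hhalf'⟩ := hpar.reg_half
  have hTl := hpar.le_two_pow
  have hTp := hpar.lt_prime
  have hK5 := hpar.reg_K
  have hq0 := Nat.two_pow_pos l
  set K := (d + 2) * l with hKdef
  have hmul := hb.mul_lt
  unfold allBlocks
  refine (runs_forUp_const (n := nb) (fun k s' => s'.drawn = k * K * T ∧
    (s'.mem 3 = fun x => (L.take (k * b)).count x) ∧ ∀ t ≤ T, FirstHit K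
      (fun a => Hit p ω (2 * 2 ^ l) T K b L a t) (k * K) (s'.mem 4 t))
    (40 * b + 12 + K * (80100 * ((T + 1) * (l + 1) ^ 4))) rfl rfl h6 (by omega) ?_ ?_).mono
    (by refine Nat.add_le_add_right (Nat.mul_le_mul_left _ (by omega)) _) fun s1 _ h => h.2.2
  · refine ⟨by simp [hd], ?_, fun t ht => Or.inl ⟨by simp [hl], fun a ha => by simp at ha⟩⟩
    ext x
    simp [hc]
  · rintro k s1 hk h80 hs1 ⟨hdr, hc1, hlev⟩
    have hkb : k * b + b ≤ nb * b := by
      rw [← Nat.succ_mul]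
      exact Nat.mul_le_mul_right _ hk
    refine WP.seq (WP.call (runs_countLoop (L := L) (k := k) (b := b) (by omega) ?_ ?_ h80 ?_ hc1)
      ?_)
    · rw [hs1.reg 2 rfl, h2]
    · rw [hs1.reg 3 rfl, h3]
    · rw [hs1.mem 5 rfl]
      exact hit
    intro s2 t2 ht2 hs2 hc2
    refine WP.call (runs_forUp_const (n := K) (fun i s' => s'.drawn = (k * K + i) * T ∧
      ∀ t ≤ T, FirstHit K (fun a => Hit p ω (2 * 2 ^ l) T K b L a t) (k * K + i) (s'.mem 4 t))
      (80080 * ((T + 1) * (l + 1) ^ 4)) rfl rfl ?_ hK ?_ ?_) ?_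
    · rw [hs2.reg 5 rfl, hs1.reg 5 rfl, hK5]
    · refine ⟨by simp [hs2.drawn rfl, hdr], ?_⟩
      rw [mem_setR, hs2.mem 4 rfl]
      exact hlev
    · rintro i s3 hi h81 hs3 ⟨hdr3, hlev3⟩
      have h0' : s3.reg 0 = T := by rw [hs3.reg 0 rfl, hs2.reg 0 rfl, hs1.reg 0 rfl, h0]
      have h80' : s3.reg 80 = k := by rw [hs3.reg 80 rfl, hs2.reg 80 rfl, h80]
      have h3' : s3.mem 3 = blockCount L b k := by rw [hs3.mem 3 rfl, hc2]
      have hAK : (k * K + i) / K = k := by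
        rw [mul_comm, Nat.mul_add_div (by omega), Nat.div_eq_of_lt hi, add_zero]
      refine WP.seq (WP.call (runs_solve (T := T) (q := 2 * 2 ^ l) (a := k * K + i) (l := l) (p := p)
        hhalf hp hw (by omega) (by omega) (by omega) (by omega) h0' ?_ ?_ ?_ ?_ ?_ ?_ hdr3) ?_)
      · rw [hs3.reg 4 rfl, hs2.reg 4 rfl, hs1.reg 4 rfl, hpar.reg_q]
      · rw [hs3.reg 8 rfl, hs2.reg 8 rfl, hs1.reg 8 rfl, hpar.reg_l]
      · rw [hs3.reg 10 rfl, hs2.reg 10 rfl, hs1.reg 10 rfl, hpar.reg_p]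
      · rw [hs3.reg 11 rfl, hs2.reg 11 rfl, hs1.reg 11 rfl, hhalf']
      · rw [hs3.mem 2 rfl, hs2.mem 2 rfl, hs1.mem 2 rfl]
        exact hpar.inv
      · intro x _
        rw [h3', blockCount]
        exact (Nat.mul_le_mul_right _ ((List.take_sublist _ _).count_le x)).trans (hL x)
      rintro s4 t4 ht4 hs4 ⟨hdr4, hP⟩
      refine WP.call (runs_recordLoop (T := T) (k := k) (K := K) (A := k * K + i)
        (hit := Hit p ω (2 * 2 ^ l) T K b L) (by omega) ?_ ?_ hAK ?_ ?_) ?_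
      · rw [hs4.reg 0 rfl, h0']
      · rw [hs4.reg 80 rfl, h80']
      · rw [hs4.mem 4 rfl]
        exact hlev3
      · intro t ht
        rw [hP t (by omega), Hit, hAK, h3', Ne, ZMod.val_eq_zero]
      · intro s5 t5 ht5 hs5 hlev5
        refine ⟨?_, by rw [drawn_setR, hs5.drawn rfl, hdr4, add_assoc], ?_⟩
        · have h1 : T + 1 ≤ (T + 1) * (l + 1) ^ 4 := Nat.le_mul_of_pos_right _ (by positivity)
          omega
        · rw [mem_setR, ← add_assoc]
          exact hlev5
    · rintro s3 t3 ht3 hs3 ⟨hdr3, hlev3⟩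
      have hkK : k * K + K = (k + 1) * K := by ring
      rw [hkK] at hdr3 hlev3
      refine ⟨?_, by simpa using hdr3, ?_, by simpa using hlev3⟩
      · have h1 : 1 ≤ (T + 1) * (l + 1) ^ 4 := Nat.mul_pos (by omega) (by positivity)
        have h2 : K * (80080 * ((T + 1) * (l + 1) ^ 4) + 8) ≤
            K * (80100 * ((T + 1) * (l + 1) ^ 4)) := Nat.mul_le_mul_left _ (by omega)
        omega
      · rw [mem_setR, hs3.mem 3 rfl, hc2]
        rfl

end

end WordRAM


/-! ### The state of a scan through one block -/

namespace DynSubsetSum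

/-- `v` is the least number of items, up to `J`, with which the sum `t` is possible. -/
def Scan (L : List ℕ) (t J v : ℕ) : Prop :=
  (v = L.length + 1 ∧ ¬ Sub (L.take J : Multiset ℕ) t) ∨
    (v ≤ J ∧ v ≤ L.length ∧ Sub (L.take v : Multiset ℕ) t ∧
      ∀ j < v, ¬ Sub (L.take j : Multiset ℕ) t)

theorem sub_take_mono {L : List ℕ} {i j t : ℕ} (h : i ≤ j) (hs : Sub (L.take i : Multiset ℕ) t) :
    Sub (L.take j : Multiset ℕ) t :=
  hs.mono (Multiset.coe_le.2 (List.take_sublist_take_left h).subperm)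

theorem sub_take_succ {L : List ℕ} {J t : ℕ} (hJ : J < L.length) :
    Sub (L.take (J + 1) : Multiset ℕ) t ↔ Sub (L.take J : Multiset ℕ) t ∨
      (L[J] ≤ t ∧ Sub (L.take J : Multiset ℕ) (t - L[J])) := by
  rw [← sub_cons, List.take_add_one, List.getElem?_eq_getElem hJ, Option.toList_some]
  have : ((L.take J ++ [L[J]] : List ℕ) : Multiset ℕ) = L[J] ::ₘ (L.take J : Multiset ℕ) := by
    rw [Multiset.cons_coe, Multiset.coe_eq_coe]
    exact List.perm_append_singleton _ _
  rw [this]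

theorem Scan.step {L : List ℕ} {t J v : ℕ} (h : Scan L t J v)
    (h' : ¬ Sub (L.take (J + 1) : Multiset ℕ) t ∨ v ≠ L.length + 1) : Scan L t (J + 1) v := by
  rcases h with ⟨h1, h2⟩ | ⟨h1, h2⟩
  · exact Or.inl ⟨h1, h'.resolve_right (not_not.2 h1)⟩
  · exact Or.inr ⟨by omega, h2⟩

theorem Scan.found {L : List ℕ} {t J : ℕ} (h : Scan L t J (L.length + 1)) (hJ : J < L.length)
    (h' : Sub (L.take (J + 1) : Multiset ℕ) t) : Scan L t (J + 1) (J + 1) := by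
  rcases h with ⟨-, h2⟩ | ⟨-, h1, -⟩
  · exact Or.inr ⟨le_rfl, hJ, h', fun j hj hs => h2 (sub_take_mono (by omega) hs)⟩
  · omega

theorem Scan.isFirst {L : List ℕ} {t J v : ℕ} (h : Scan L t J v)
    (hJ : L.length ≤ J ∨ Sub (L.take J : Multiset ℕ) t) : IsFirst L t v := by
  rcases h with ⟨h1, h2⟩ | ⟨-, h2, h3, h4⟩
  · refine ⟨h1.le, fun j hj => ⟨fun h => absurd h (by omega), fun h => ?_⟩⟩
    rcases hJ with hJ | hJ
    · exact absurd (sub_take_mono (hj.trans hJ) h) h2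
    · exact absurd hJ h2
  · refine ⟨by omega, fun j hj => ⟨fun h => sub_take_mono h h3, fun h => ?_⟩⟩
    exact le_of_not_gt fun hlt => h4 j hlt h

/-- `v` is one plus the index of the first block with which the sum `t` is possible, and `0` if
the sum is not possible. -/
def IsLevel (L : List ℕ) (b t v : ℕ) : Prop :=
  (v = 0 ∧ ¬ Sub (L : Multiset ℕ) t) ∨ ∃ k, v = k + 1 ∧
    ¬ Sub (L.take (k * b) : Multiset ℕ) t ∧ Sub (L.take (k * b + b) : Multiset ℕ) t

end DynSubsetSum

namespace WordRAM

open WordRAM.Expr WordRAM.Prog SubsetSumSeries DynSubsetSum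

/-! ### The table of first occurrences and the answers -/

/-- Registers: `2` the number of items, `52` the sum, `55` the first index of the block. -/
def scanBody : Prog :=
  .assign 57 (reg 55 + reg 56) ;;
  .ite (.bin .lt (reg 57) (reg 2))
    (.assign 58 (load 5 (reg 57)) ;;
      .ite (.bin .lt (reg 52) (reg 58)) .skip
        (.ite (.bin .lt (load 7 (reg 52 - reg 58)) (reg 57 + 1))
          (.ite (.bin .eq (load 7 (reg 52)) (reg 2 + 1)) (.store 7 (reg 52) (reg 57 + 1)) .skip)
          .skip))
    .skip

def tableBody : Prog :=
  .assign 52 (reg 51 + 1) ;;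
  .store 7 (reg 52) (reg 2 + 1) ;;
  .assign 54 (load 4 (reg 52)) ;;
  .ite (.bin .eq (reg 54) 0) .skip
    (.assign 55 ((reg 54 - 1) * reg 3) ;; forUp 56 3 scanBody)

/-- The sums are treated in increasing order, because the entry of `t` depends on the entries of
smaller sums. The sum `0` needs no items, and an entry larger than the number of items stands for a
sum that is never attained. -/
def table : Prog := .store 7 0 0 ;; forUp 51 0 tableBody

def queries : Prog :=
  forUp 51 1 (.ite (.bin .eq (load 0 (reg 51)) 0) .skip
    (.out (.bin .lt (load 7 (load 1 (reg 51))) (load 6 (reg 51) + 1))))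

section
variable {w : ℕ} {ω : ℕ → Fin (2 ^ w)} {s : State}

/-- If `t` was not attainable with the first `J` items, the next item of weight `x` makes it so
exactly if `t - x` was attainable with those items, which the finished entry of `t - x` tells. The
proposition `G` stands for success of the random runs: halting and time must not depend on it. -/
theorem runs_scanBody {L : List ℕ} {t k b j : ℕ} {G : Prop}
    (hw : 4 * (k * b + b + L.length + 2) ≤ 2 ^ w)
    (hL : ∀ x ∈ L, 1 ≤ x) (hj : j < b)
    (h2 : s.reg 2 = L.length) (h52 : s.reg 52 = t) (h55 : s.reg 55 = k * b) (h56 : s.reg 56 = j)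
    (hit : ∀ j (h : j < L.length), s.mem 5 j = L[j])
    (hf : G → ∀ t' < t, IsFirst L t' (s.mem 7 t'))
    (hscan : G → Scan L t (k * b + j) (s.mem 7 t)) :
    Runs w ω scanBody s 40 fun s' => (∀ t' < t, s'.mem 7 t' = s.mem 7 t') ∧
      (G → Scan L t (k * b + (j + 1)) (s'.mem 7 t)) := by
  unfold scanBody
  refine WP.seq (WP.assign (k * b + j) ?_ ?_)
  · simp (disch := omega) [h55, h56, mod_word]
  refine WP.ite (k * b + j < L.length) (by simp [h2]) (fun h => ?_) (fun h => ?_)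
  · set J := k * b + j
    set x := L[J] with hx
    have hx1 : 1 ≤ x := hL _ (List.getElem_mem h)
    refine WP.seq (WP.assign x (by simp [hit J h, hx]) ?_)
    refine WP.ite (t < x) (by simp [h52]) (fun a1 => ?_) (fun a1 => ?_)
    · refine WP.skip ⟨by simp, by simp, fun hG => ?_⟩
      by_cases e : s.mem 7 t = L.length + 1
      · refine (hscan hG).step (Or.inl fun hs => ?_)
        rcases hscan hG with ⟨-, h2⟩ | ⟨-, h2, -⟩
        · rcases (sub_take_succ h).1 hs with h3 | ⟨h3, -⟩
          · exact h2 h3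
          · omega
        · omega
      · exact (hscan hG).step (Or.inr e)
    refine WP.ite (s.mem 7 (t - x) < J + 1) ?_ (fun a2 => ?_) (fun a2 => ?_)
    · simp (disch := omega) [h52, mod_word]
    · refine WP.ite (s.mem 7 t = L.length + 1) ?_ (fun a3 => ?_) (fun a3 => ?_)
      · simp (disch := omega) [h52, h2, mod_word]
      · refine WP.store t (J + 1) (by simp [h52]) ?_ ⟨by simp, fun t' ht' => ?_, fun hG => ?_⟩
        · simp (disch := omega) [mod_word]
        · simp [ht'.ne]
        · have hs := hscan hG
          rw [a3] at hs
          -- Since `x ≥ 1`, the entry of `t - x` is final.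
          have h7 := ((hf hG (t - x) (by omega)).2 J h.le).1 (by omega)
          simp only [mem_setM_self, Function.update_self]
          exact hs.found h ((sub_take_succ h).2 (Or.inr ⟨by omega, h7⟩))
      · exact WP.skip ⟨by simp, by simp, fun hG => (hscan hG).step (Or.inr a3)⟩
    · refine WP.skip ⟨by simp, by simp, fun hG => ?_⟩
      by_cases e : s.mem 7 t = L.length + 1
      · refine (hscan hG).step (Or.inl fun hs => ?_)
        rcases hscan hG with ⟨-, h2⟩ | ⟨-, h2, -⟩
        · rcases (sub_take_succ h).1 hs with h3 | ⟨h3, h4⟩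
          · exact h2 h3
          · have := ((hf hG (t - x) (by omega)).2 J h.le).2 h4
            omega
        · omega
      · exact (hscan hG).step (Or.inr e)
  -- The last block may be incomplete; beyond the end of the list the prefix does not change.
  · refine WP.skip ⟨by simp, by simp, fun hG => ?_⟩
    have hs := hscan hG
    rcases hs with ⟨h1, h2⟩ | h1
    · refine Or.inl ⟨h1, ?_⟩
      rw [List.take_of_length_le (by omega)] at h2 ⊢
      exact h2
    · exact Or.inr ⟨by dsimp only [mem_setR]; omega, h1.2⟩

/-- The level says that the sum is attainable with the first `k + 1` blocks but not with the first
`k`, so scanning the `b` items of one block is enough. -/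
theorem runs_tableBody {L : List ℕ} {i b nb T : ℕ} {G : Prop}
    (hw : 4 * (nb * b + b + L.length + nb + T + 2) ≤ 2 ^ w) (hL : ∀ x ∈ L, 1 ≤ x) (hi : i < T)
    (h2 : s.reg 2 = L.length) (h3 : s.reg 3 = b) (h51 : s.reg 51 = i)
    (hit : ∀ j (h : j < L.length), s.mem 5 j = L[j])
    (hlev : s.mem 4 (i + 1) ≤ nb) (hlev' : G → IsLevel L b (i + 1) (s.mem 4 (i + 1)))
    (hf : G → ∀ t < i + 1, IsFirst L t (s.mem 7 t)) :
    Runs w ω tableBody s (50 * b + 40) fun s' =>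
      (G → ∀ t < i + 2, IsFirst L t (s'.mem 7 t)) := by
  unfold tableBody
  refine WP.seq (WP.assign (i + 1) ?_ ?_)
  · simp (disch := omega) [h51, mod_word]
  refine WP.seq (WP.store (i + 1) (L.length + 1) (by simp) ?_ ?_)
  · simp (disch := omega) [h2, mod_word]
  refine WP.seq (WP.assign (s.mem 4 (i + 1)) (by simp [mem_setM_of_ne]) ?_)
  have hfin : ∀ (s' : State), (∀ t < i + 1, s'.mem 7 t = s.mem 7 t) →
      (G → IsFirst L (i + 1) (s'.mem 7 (i + 1))) → G → ∀ t < i + 2, IsFirst L t (s'.mem 7 t) := by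
    intro s' h4 h5 hG t ht
    rcases Nat.lt_succ_iff_lt_or_eq.1 ht with h | rfl
    · rw [h4 t h]
      exact hf hG t h
    · exact h5 hG
  refine WP.ite (s.mem 4 (i + 1) = 0) (by simp) (fun h => ?_) (fun h => ?_)
  · refine WP.skip ⟨by simp, hfin _ (fun t ht => by simp [ht.ne]) fun hG => ?_⟩
    rcases hlev' hG with ⟨-, h4⟩ | ⟨k, h4, -⟩
    · refine Scan.isFirst (J := L.length) (Or.inl ⟨by simp, ?_⟩) (Or.inl le_rfl)
      rwa [List.take_length]
    · omega
  · obtain ⟨k, hk⟩ := Nat.exists_eq_succ_of_ne_zero h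
    have hkb : (k + 1) * b ≤ nb * b := Nat.mul_le_mul_right _ (by omega)
    rw [add_mul, one_mul] at hkb
    refine WP.seq (WP.assign (k * b) ?_ ?_)
    · simp (disch := omega) [hk, h3, mod_word]
    refine WP.call (runs_forUp_const (n := b) (fun j s' => (∀ t < i + 1, s'.mem 7 t = s.mem 7 t) ∧
      (G → Scan L (i + 1) (k * b + j) (s'.mem 7 (i + 1)))) 40 rfl rfl (by simp [h3]) (by omega)
      ⟨fun t ht => by simp [ht.ne], fun hG => ?_⟩ ?_) ?_
    · rcases hlev' hG with ⟨h4, -⟩ | ⟨k', h4, h5, h6⟩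
      · omega
      · obtain rfl : k' = k := by omega
        exact Or.inl ⟨by simp, by simpa using h5⟩
    · rintro j s1 hj h56 hs1 ⟨hI1, hI2⟩
      refine (runs_scanBody (L := L) (t := i + 1) (k := k) (b := b) (j := j) (G := G) (by omega) hL hj
        ?_ ?_ ?_ h56 ?_ ?_ hI2).mono le_rfl ?_
      · simp [hs1.reg 2 rfl, h2]
      · simp [hs1.reg 52 rfl]
      · simp [hs1.reg 55 rfl]
      · simpa [hs1.mem 5 rfl, mem_setM_of_ne] using hit
      · intro hG t ht
        rw [hI1 t ht]
        exact hf hG t ht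
      · rintro s2 _ ⟨h4, h5⟩
        exact ⟨fun t ht => by rw [mem_setR, h4 t ht, hI1 t ht], h5⟩
    · rintro s1 t1 ht1 _ ⟨hI1, hI2⟩
      refine ⟨by simp at ht1; omega, hfin _ hI1 fun hG => (hI2 hG).isFirst ?_⟩
      rcases hlev' hG with ⟨h4, -⟩ | ⟨k', h4, h5, h6⟩
      · omega
      · obtain rfl : k' = k := by omega
        exact Or.inr h6

theorem runs_table {L : List ℕ} {b nb T : ℕ} {G : Prop}
    (hw : 4 * (nb * b + b + L.length + nb + T + 2) ≤ 2 ^ w) (hL : ∀ x ∈ L, 1 ≤ x)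
    (h0 : s.reg 0 = T) (h2 : s.reg 2 = L.length) (h3 : s.reg 3 = b)
    (hit : ∀ j (h : j < L.length), s.mem 5 j = L[j])
    (hlev : ∀ t ≤ T, s.mem 4 t ≤ nb) (hlev' : G → ∀ t, 1 ≤ t → t ≤ T → IsLevel L b t (s.mem 4 t)) :
    Runs w ω table s (T * (50 * b + 48) + 9) fun s' =>
      (G → ∀ t ≤ T, IsFirst L t (s'.mem 7 t)) := by
  unfold table
  refine WP.seq (WP.store 0 0 (by simp) (by simp) ?_)
  refine WP.call (runs_forUp_const (n := T) (fun i s' => G → ∀ t < i + 1, IsFirst L t (s'.mem 7 t))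
    (50 * b + 40) rfl rfl (by simp [h0]) (by omega) ?_ ?_) ?_
  · intro _ t ht
    obtain rfl : t = 0 := by omega
    refine ⟨by simp, fun j hj => ?_⟩
    simp [sub_zero]
  · intro i s1 hi h51 hs1 hI
    refine (runs_tableBody (L := L) (i := i) (b := b) (nb := nb) (T := T) (G := G) hw hL hi
      ?_ ?_ h51 ?_ ?_ ?_ hI).mono le_rfl fun s2 _ h => h
    · simp [hs1.reg 2 rfl, h2]
    · simp [hs1.reg 3 rfl, h3]
    · simpa [hs1.mem 5 rfl, mem_setM_of_ne] using hit
    · simpa [hs1.mem 4 rfl, mem_setM_of_ne] using hlev (i + 1) hi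
    · intro hG
      simpa [hs1.mem 4 rfl, mem_setM_of_ne] using hlev' hG (i + 1) (by omega) hi
  · intro s1 t1 ht1 _ hI
    refine ⟨?_, fun hG t ht => hI hG t (by omega)⟩
    have e : T * (50 * b + 40 + 8) = T * (50 * b + 48) := rfl
    simp at ht1
    omega

theorem runs_queries {T : ℕ} {ops : List Op} {G : Prop} (hw : 4 * (ops.length + 2) ≤ 2 ^ w)
    (hT : ∀ t, Op.query t ∈ ops → t ≤ T)
    (h1 : s.reg 1 = ops.length)
    (hk : ∀ i (h : i < ops.length), s.mem 0 i = ops[i].kind)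
    (hv : ∀ i (h : i < ops.length), s.mem 1 i = ops[i].value)
    (h6 : ∀ i < ops.length, s.mem 6 i = (kept T (ops.take (i + 1))).length)
    (h7 : G → ∀ t ≤ T, IsFirst (kept T ops) t (s.mem 7 t)) (ho : s.out = []) :
    Runs w ω queries s (ops.length * 30 + 6) fun s' => G → s'.out = answers ops := by
  classical
  unfold queries
  refine (runs_forUp_const (n := ops.length) (fun i s' => G → s'.out = answers (ops.take i)) 22
    rfl rfl h1 (by omega) (by simp [ho, answers, answersFrom]) ?_).mono le_rfl fun s1 _ h => by
      simpa using h
  intro i s1 hi h51 hs1 hI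
  have hk' : s1.mem 0 i = ops[i].kind := by simp [hs1.mem 0 rfl, hk i hi]
  have hv' : s1.mem 1 i = ops[i].value := by simp [hs1.mem 1 rfl, hv i hi]
  have h6' : s1.mem 6 i = (kept T (ops.take (i + 1))).length := by simp [hs1.mem 6 rfl, h6 i hi]
  have h7' : s1.mem 7 = s.mem 7 := hs1.mem 7 rfl
  have hlen := length_kept_le T (ops.take (i + 1))
  rw [List.length_take] at hlen
  have htake : ops.take (i + 1) = ops.take i ++ [ops[i]] := by
    rw [List.take_add_one, List.getElem?_eq_getElem hi]
    rfl
  have hans := answersFrom_concat 0 (ops.take i) ops[i]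
  rw [← htake] at hans
  change answers _ = answers _ ++ _ at hans
  have hmem : ops[i] ∈ ops := List.getElem_mem hi
  cases hop : ops[i] with
  | insert x =>
    rw [hop] at hk' hans
    refine WP.ite True (by simp [h51, hk', Op.kind]) (fun _ => ?_) (fun h => absurd trivial h)
    refine WP.skip ⟨by simp, fun hG => ?_⟩
    rw [out_setR, hI hG, hans]
    simp [answers]
  | query t =>
    rw [hop] at hk' hv' hans hmem htake
    have ht := hT t hmem
    refine WP.ite False (by simp [h51, hk', Op.kind]) (fun h => h.elim) fun _ => ?_
    refine WP.out (if s.mem 7 t < (kept T (ops.take (i + 1))).length + 1 then 1 else 0) ?_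
      ⟨by simp, fun hG => ?_⟩
    · simp (disch := omega) [h51, hv', Op.value, h6', h7', mod_word]
    · have hfirst := h7 hG t ht
      rw [← List.take_append_drop (i + 1) ops] at hfirst
      have hw' : weights (ops.take (i + 1)) = weights (ops.take i) := by
        rw [htake, weights_append]
        simp [weights]
      have hiff := hfirst.answer ht
      rw [hw'] at hiff
      rw [out_setR, hans]
      dsimp only
      rw [hI hG, answers, zero_add]
      congr 2
      simp only [Nat.lt_succ_iff, hiff]

end

end WordRAM


/-! ### Correctness and running time of the whole program -/

namespace WordRAM

open WordRAM.Expr WordRAM.Prog SubsetSumSeries DynSubsetSum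

theorem exists_blocks (m : ℕ) : ∃ b nb, Blocks m b nb := by
  set b := Nat.sqrt (m - 1) + 1 with hb
  have h1 : Nat.sqrt (m - 1) * Nat.sqrt (m - 1) ≤ m - 1 := Nat.sqrt_le _
  have h2 : m - 1 < b * b := Nat.lt_succ_sqrt _
  refine ⟨b, (m + b - 1) / b, by omega, ?_, ?_, ?_, ?_⟩
  · rcases Nat.eq_zero_or_pos m with rfl | h
    · left
      simp [hb]
    · right
      rw [hb, Nat.add_sub_cancel]
      omega
  · refine Nat.le_of_lt_succ (Nat.div_lt_of_lt_mul ?_)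
    rw [Nat.mul_succ]
    omega
  · have h5 := Nat.div_add_mod (m + b - 1) b
    have h6 := Nat.mod_lt (m + b - 1) (show b > 0 by omega)
    rw [mul_comm]
    omega
  · have := Nat.div_mul_le_self (m + b - 1) b
    omega

theorem Blocks.le_square {m b nb : ℕ} (h : Blocks m b nb) : m ≤ b * b :=
  h.le_mul.trans (Nat.mul_le_mul_right _ h.nb_le)

theorem Blocks.length_le {m b nb b' nb' : ℕ} (h : Blocks m b nb) (h' : Blocks m b' nb') :
    b ≤ b' := by
  rcases h.small with h1 | h1
  · have := h'.pos
    omega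
  · have h2 := h'.le_square
    by_contra h3
    have : b' * b' ≤ (b - 1) * (b - 1) := Nat.mul_le_mul (by omega) (by omega)
    omega

/-- The event that all runs succeed mentions `b` and `nb` before any execution is considered;
uniqueness identifies them with the values that the program computes. -/
theorem Blocks.unique {m b nb b' nb' : ℕ} (h : Blocks m b nb) (h' : Blocks m b' nb') :
    b = b' ∧ nb = nb' := by
  obtain rfl : b = b' := le_antisymm (h.length_le h') (h'.length_le h)
  refine ⟨rfl, le_antisymm ?_ ?_⟩
  · have h1 : nb * b < (nb' + 1) * b := by
      rw [add_mul, one_mul]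
      exact h.mul_lt.trans_le (Nat.add_le_add_right h'.le_mul _)
    exact Nat.le_of_lt_succ (Nat.lt_of_mul_lt_mul_right h1)
  · have h1 : nb' * b < (nb + 1) * b := by
      rw [add_mul, one_mul]
      exact h'.mul_lt.trans_le (Nat.add_le_add_right h.le_mul _)
    exact Nat.le_of_lt_succ (Nat.lt_of_mul_lt_mul_right h1)

theorem Blocks.length_le_add {m b nb : ℕ} (h : Blocks m b nb) : b ≤ m + 1 := by
  rcases h.small with h1 | h1
  · omega
  · have : b - 1 ≤ (b - 1) * (b - 1) := Nat.le_mul_self _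
    omega

section
variable {w : ℕ} {ω : ℕ → Fin (2 ^ w)} {p : ℕ} [Fact p.Prime]

theorem reach_blockCount {T b k t : ℕ} {L : List ℕ} (hL : ∀ x ∈ L, 1 ≤ x ∧ x ≤ T) :
    Reach T (blockCount L b k) t ↔ Sub (L.take ((k + 1) * b) : Multiset ℕ) t := by
  rw [← reach_iff_sub fun x hx => hL x (List.mem_of_mem_take (Multiset.mem_coe.1 hx))]
  simp only [Multiset.coe_count]
  rfl

/-- A successful run is never wrong, and if the sum were attainable one block earlier, one of the
`K` runs for that block would have succeeded before. -/
theorem isLevel_of_firstHit {q T K b nb t v : ℕ} {L : List ℕ} (hL : ∀ x ∈ L, 1 ≤ x ∧ x ≤ T)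
    (hb : Blocks L.length b nb) (hall : AllFound p q T K nb (blockCount L b) ω)
    (h1 : 1 ≤ t) (ht : t ≤ T)
    (hv : FirstHit K (fun a => Hit p ω q T K b L a t) (nb * K) v) : IsLevel L b t v := by
  have hfind : ∀ k < nb, Sub (L.take ((k + 1) * b) : Multiset ℕ) t →
      ∃ i < K, Hit p ω q T K b L (k * K + i) t := by
    intro k hk hs
    obtain ⟨i, hi, hne⟩ := hall k hk t ht ((reach_blockCount hL).2 hs)
    refine ⟨i, hi, ?_⟩
    have : (k * K + i) / K = k := by
      rw [mul_comm, Nat.mul_add_div (by omega), Nat.div_eq_of_lt hi, add_zero]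
    rwa [Hit, this]
  -- For `t = 0` the empty prefix suffices and no level in this sense exists; hence the hypothesis
  -- `1 ≤ t`.
  have hnil : ¬ Sub ((L.take 0 : List ℕ) : Multiset ℕ) t := by
    rw [List.take_zero, Multiset.coe_nil, sub_nil]
    omega
  rcases hv with ⟨rfl, hv⟩ | ⟨a, ha, hit, hno, rfl⟩
  · refine Or.inl ⟨rfl, fun hs => ?_⟩
    rcases Nat.eq_zero_or_pos nb with rfl | hnb
    · have := hb.le_mul
      rw [zero_mul] at this
      rw [List.take_of_length_le this] at hnil
      exact hnil hs
    · obtain ⟨i, hi, hit⟩ := hfind (nb - 1) (by omega) (by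
        rwa [Nat.sub_add_cancel hnb, List.take_of_length_le hb.le_mul])
      refine hv _ ?_ hit
      have : (nb - 1) * K + K = nb * K := by
        rw [← Nat.succ_mul, Nat.succ_eq_add_one, Nat.sub_add_cancel hnb]
      omega
  · have hK : 0 < K := Nat.pos_of_mul_pos_left (by omega : 0 < nb * K)
    have hak : a / K < nb := (Nat.div_lt_iff_lt_mul hK).2 ha
    refine Or.inr ⟨a / K, rfl, fun hs => ?_, ?_⟩
    · rcases Nat.eq_zero_or_pos (a / K) with h | h
      · rw [h, zero_mul] at hs
        exact hnil hs
      · obtain ⟨i, hi, hit'⟩ := hfind (a / K - 1) (by omega) (by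
          rwa [Nat.sub_add_cancel h])
        refine hno _ ?_ hit'
        have h3 : (a / K - 1) * K + K = a / K * K := by
          rw [← Nat.succ_mul, Nat.succ_eq_add_one, Nat.sub_add_cancel h]
        have := Nat.div_mul_le_self a K
        omega
    · have h3 : Sub (L.take ((a / K + 1) * b) : Multiset ℕ) t := by
        by_contra h
        exact hit (coeff_gen_of_not_reach (fun h' => h ((reach_blockCount hL).1 h')) _)
      rwa [add_mul, one_mul] at h3

/-- The program for dynamic subset sum with offline access. -/
def subsetSum (d : ℕ) : Prog :=
  filterItems ;; setup d ;; blockLength ;; allBlocks ;; table ;; queries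

/-- The time bound for `subsetSum`. -/
def timeBound (d T n l b nb : ℕ) : ℕ :=
  6000 * ((T + n + 2) * (l + 1)) +
    nb * (40 * b + 20 + (d + 2) * l * (80100 * ((T + 1) * (l + 1) ^ 4))) + T * (50 * b + 48)

/-- The time bound is unconditional, whereas the output is claimed correct only on `AllFound`. -/
theorem runs_subsetSum {d T l b nb : ℕ} {ops : List Op}
    (hw : (d + 2000) * ((T + ops.length + 2) * (T + ops.length + 2)) ≤ 2 ^ w)
    (hT : ∀ t, Op.query t ∈ ops → t ≤ T)
    (hl : l = Nat.clog 2 (T + ops.length + 2)) (hbp : p = bigPrime (2 * 2 ^ l))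
    (hb : Blocks (kept T ops).length b nb) :
    Runs w ω (subsetSum d) (input T ops) (timeBound d T ops.length l b nb) fun s' =>
      AllFound p (2 * 2 ^ l) T ((d + 2) * l) nb (blockCount (kept T ops) b) ω →
        s'.out = answers ops := by
  set n := ops.length with hn
  set N := T + n + 2 with hN
  set L := kept T ops with hLdef
  have hLn : L.length ≤ n := length_kept_le T ops
  have hbm := hb.length_le_add
  have hnb := hb.nb_le
  have hmul := hb.mul_lt
  have hNN : N ≤ N * N := Nat.le_mul_self N
  have hwN : (d + 2000) * (N * N) = d * (N * N) + 2000 * (N * N) := by ring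
  have hdN : d * N ≤ d * (N * N) := Nat.mul_le_mul_left _ hNN
  have hw1 : (d + 200) * (N * N) ≤ 2 ^ w := (Nat.mul_le_mul_right _ (by omega)).trans hw
  have hm2 : (L.length + 2) * (L.length + 2) ≤ N * N := Nat.mul_le_mul (by omega) (by omega)
  have hkind : ∀ i (h : i < ops.length), (input T ops).mem 0 i = ops[i].kind := fun i h => by
    simp [input, List.getElem?_eq_getElem h]
  have hval : ∀ i (h : i < ops.length), (input T ops).mem 1 i = ops[i].value := fun i h => by
    simp [input, List.getElem?_eq_getElem h]
  have hzero : ∀ a x, 2 ≤ a → (input T ops).mem a x = 0 := fun a x ha => by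
    simp only [input]
    rw [if_neg (by omega), if_neg (by omega)]
  have hLT : ∀ x ∈ L, 1 ≤ x ∧ x ≤ T := fun x hx => mem_kept hx
  have hcount : ∀ x, L.count x * x ≤ T := fun x => by
    rw [hLdef, count_kept]
    exact (Nat.mul_le_mul_right _ (min_le_right _ _)).trans (Nat.div_mul_le_self _ _)
  unfold subsetSum
  refine WP.seq (WP.call (runs_filterItems (T := T) (ops := ops) (by omega) (by simp [input])
    (by simp [input]) hkind hval fun x => hzero 8 x (by omega)) ?_)
  intro s1 t1 ht1 hs1 hit1
  refine WP.seq (WP.call (runs_setup (d := d) (T := T) (n := n) hl hbp hw1 ?_ ?_ ?_) ?_)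
  · simp [hs1.reg 0 rfl, input]
  · simp [hs1.reg 1 rfl, input, hn]
  · intro j
    rw [hs1.mem 16 rfl]
    exact hzero 16 j (by omega)
  intro s2 t2 ht2 hs2 hpar
  refine WP.seq (WP.call (runs_blockLength (m := L.length) (by rw [mul_assoc]; omega) ?_) ?_)
  · rw [hs2.reg 2 rfl, hit1.reg_m]
  rintro s3 t3 ht3 hs3 ⟨b', nb', h3, h6, hb'⟩
  obtain ⟨rfl, rfl⟩ := hb'.unique hb
  have hpar3 : Params d T n l p s3 := by
    refine ⟨hpar.prime, hpar.le_two_pow, hpar.two_pow_lt, hpar.lt_prime, hpar.prime_le,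
      ?_, ?_, ?_, ?_, ?_, ?_⟩
    · rw [hs3.reg 4 rfl, hpar.reg_q]
    · rw [hs3.reg 5 rfl, hpar.reg_K]
    · rw [hs3.reg 8 rfl, hpar.reg_l]
    · rw [hs3.reg 10 rfl, hpar.reg_p]
    · rw [hs3.reg 11 rfl]
      exact hpar.reg_half
    · rw [hs3.mem 2 rfl]
      exact hpar.inv
  have hlt := hpar.two_pow_lt
  have hl2 := Nat.lt_two_pow_self (n := l)
  have hpl := hpar.prime_le
  -- Products of two residues, and below also the workspace of the convolution, must fit into a
  -- word; all these bounds are multiples of `N * N`, which explains the constant `2000` in `hw`.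
  have hp2 : p * p ≤ 8 * N * (8 * N) := Nat.mul_le_mul (by omega) (by omega)
  have hp3 : 8 * N * (8 * N) = 64 * (N * N) := by ring
  have hl3 : (2 * l + 1) * (8 * (2 * T + 2)) ≤ 4 * N * (16 * N) :=
    Nat.mul_le_mul (by omega) (by omega)
  have hl4 : 4 * N * (16 * N) = 64 * (N * N) := by ring
  have hK : (d + 2) * l ≤ (d + 2) * (2 * N) := Nat.mul_le_mul_left _ (by omega)
  have hK' : (d + 2) * (2 * N) = 2 * (d * N) + 4 * N := by ring
  have hdN' : 2 * (d * N) ≤ d * (N * N) := by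
    have : d * (N * 2) ≤ d * (N * N) := Nat.mul_le_mul_left _ (Nat.mul_le_mul_left _ (by omega))
    linarith
  have hit3 : ∀ j (h : j < L.length), s3.mem 5 j = L[j] := by
    rw [hs3.mem 5 rfl, hs2.mem 5 rfl]
    exact hit1.item
  have h0' : s3.reg 0 = T := by simp [hs3.reg 0 rfl, hs2.reg 0 rfl, hs1.reg 0 rfl, input]
  have h1' : s3.reg 1 = n := by simp [hs3.reg 1 rfl, hs2.reg 1 rfl, hs1.reg 1 rfl, input, hn]
  have h2' : s3.reg 2 = L.length := by rw [hs3.reg 2 rfl, hs2.reg 2 rfl, hit1.reg_m]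
  refine WP.seq (WP.call (runs_allBlocks (T := T) (n := n) (p := p) hpar3 (by omega) (by omega)
    (by omega) (by omega) hb hcount h0' h2' h3 h6 hit3 ?_ ?_ ?_) ?_)
  · intro x
    rw [hs3.mem 3 rfl, hs2.mem 3 rfl, hs1.mem 3 rfl]
    exact hzero 3 x (by omega)
  · intro x
    rw [hs3.mem 4 rfl, hs2.mem 4 rfl, hs1.mem 4 rfl]
    exact hzero 4 x (by omega)
  · rw [hs3.drawn rfl, hs2.drawn rfl, hs1.drawn rfl]
    rfl
  intro s4 t4 ht4 hs4 hlev
  refine WP.seq (WP.call (runs_table (L := L) (b := b') (nb := nb') (T := T)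
    (G := AllFound p (2 * 2 ^ l) T ((d + 2) * l) nb' (blockCount L b') ω) (by omega)
    (fun x hx => (hLT x hx).1) ?_ ?_ ?_ ?_ ?_
    fun hG t h1 ht => isLevel_of_firstHit hLT hb hG h1 ht (hlev t ht)) ?_)
  · rw [hs4.reg 0 rfl, h0']
  · rw [hs4.reg 2 rfl, h2']
  · rw [hs4.reg 3 rfl, h3]
  · rw [hs4.mem 5 rfl]
    exact hit3
  · intro t ht
    rcases hlev t ht with ⟨h, -⟩ | ⟨a, ha, -, -, h⟩
    · omega
    · rw [h]
      exact (Nat.div_lt_iff_lt_mul (Nat.pos_of_mul_pos_left (by omega : 0 < nb' * ((d + 2) * l)))).2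
        ha
  intro s5 t5 ht5 hs5 hfirst
  refine WP.call (runs_queries (T := T) (ops := ops) (by omega) hT ?_ ?_ ?_ ?_ hfirst ?_) ?_
  · rw [hs5.reg 1 rfl, hs4.reg 1 rfl, h1']
  · rw [hs5.mem 0 rfl, hs4.mem 0 rfl, hs3.mem 0 rfl, hs2.mem 0 rfl, hs1.mem 0 rfl]
    exact hkind
  · rw [hs5.mem 1 rfl, hs4.mem 1 rfl, hs3.mem 1 rfl, hs2.mem 1 rfl, hs1.mem 1 rfl]
    exact hval
  · rw [hs5.mem 6 rfl, hs4.mem 6 rfl, hs3.mem 6 rfl, hs2.mem 6 rfl]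
    exact hit1.kap
  · rw [hs5.out rfl, hs4.out rfl, hs3.out rfl, hs2.out rfl, hs1.out rfl]
    rfl
  intro s6 t6 ht6 _ hout
  refine ⟨?_, hout⟩
  have e1 : N ≤ N * (l + 1) := Nat.le_mul_of_pos_right _ (by omega)
  rw [← hN] at ht2
  rw [timeBound, ← hN]
  omega

end

end WordRAM


/-! ### Final estimates of time and failure probability -/

namespace WordRAM

open SubsetSumSeries DynSubsetSum

/-- Of the six logarithmic factors, four come from one run of the solver, one from the number of
repetitions, and one from bounding `√m` by `(l + 1) * min (√n) (√T)`. -/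
theorem timeBound_le {d T n m l b nb : ℕ} (hn : 1 ≤ n) (hmn : m ≤ n) (hmT : m ≤ l * T)
    (hb : Blocks m b nb) :
    (timeBound d T n l b nb : ℝ) ≤
      (20000 + 400000 * (d + 2)) * (l + 1) ^ 6 *
        (n + T * min (√(n : ℝ)) (√(T : ℝ))) := by
  have hn' : (1 : ℝ) ≤ n := by exact_mod_cast hn
  set M := min (√(n : ℝ)) (√(T : ℝ)) with hM
  set X : ℝ := T * M with hX
  have hM0 : 0 ≤ M := le_min (Real.sqrt_nonneg _) (Real.sqrt_nonneg _)
  have hX0 : 0 ≤ X := mul_nonneg (Nat.cast_nonneg _) hM0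
  have hTX : (T : ℝ) ≤ X := by
    rcases Nat.eq_zero_or_pos T with rfl | h
    · simp [hX]
    · have h' : (1 : ℝ) ≤ T := by exact_mod_cast h
      have : 1 ≤ M := le_min (Real.one_le_sqrt.2 hn') (Real.one_le_sqrt.2 h')
      exact le_mul_of_one_le_right (Nat.cast_nonneg _) this
  set u : ℝ := l + 1 with hu
  have hu1 : 1 ≤ u := by simp [hu]
  have hbm : (b : ℝ) ≤ 1 + u * M := by
    have hs : √(m : ℝ) ≤ u * M := by
      rw [hM, mul_min_of_nonneg _ _ (by linarith)]
      refine le_min ?_ ?_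
      · refine (Real.sqrt_le_sqrt (show (m : ℝ) ≤ n by exact_mod_cast hmn)).trans ?_
        exact le_mul_of_one_le_left (Real.sqrt_nonneg _) hu1
      · refine Real.sqrt_le_iff.2 ⟨by positivity, ?_⟩
        rw [mul_pow, Real.sq_sqrt (Nat.cast_nonneg _)]
        have h1 : (m : ℝ) ≤ l * T := by exact_mod_cast hmT
        refine h1.trans (mul_le_mul_of_nonneg_right ?_ (Nat.cast_nonneg _))
        nlinarith
    refine le_trans ?_ (add_le_add_right hs 1)
    rcases hb.small with h | h
    · rw [h]
      have := Real.sqrt_nonneg (m : ℝ)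
      push_cast
      linarith
    · have h1 : ((b - 1 : ℕ) : ℝ) ≤ √(m : ℝ) := by
        refine Real.le_sqrt_of_sq_le ?_
        rw [sq]
        exact_mod_cast h.le
      rw [Nat.cast_sub hb.pos] at h1
      push_cast at h1
      linarith
  have hTb : (T : ℝ) * b ≤ 2 * u * X := by
    have h1 : (T : ℝ) * b ≤ T * (1 + u * M) := mul_le_mul_of_nonneg_left hbm (Nat.cast_nonneg _)
    have h2 : (T : ℝ) * (1 + u * M) = T + u * X := by rw [hX]; ring
    have h3 : X ≤ u * X := le_mul_of_one_le_left hX0 hu1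
    linarith
  -- Without items there are no blocks. Otherwise `m ≤ l * T` forces `T ≥ 1`, so that `T + 1 ≤ 2 *
  -- T`; for `T = 0` the right side vanishes.
  have hnbT : (nb : ℝ) * (T + 1) ≤ 4 * u * X := by
    rcases Nat.eq_zero_or_pos m with h | h
    · have h1 := hb.mul_lt
      rw [h, zero_add] at h1
      have : nb = 0 := by
        by_contra h2
        have := Nat.le_mul_of_pos_left b (Nat.pos_of_ne_zero h2)
        omega
      rw [this, Nat.cast_zero, zero_mul]
      positivity
    · have hT1 : 1 ≤ T := Nat.pos_of_mul_pos_left (by omega : 0 < l * T)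
      have hT1' : (1 : ℝ) ≤ T := by exact_mod_cast hT1
      have h1 : (nb : ℝ) ≤ b := by exact_mod_cast hb.nb_le
      have h2 : (nb : ℝ) * (T + 1) ≤ b * (2 * T) := mul_le_mul h1 (by linarith) (by positivity)
        (by positivity)
      linarith
  have hnb : (nb : ℝ) * (40 * b + 20) ≤ 180 * n := by
    have h1 : nb * b ≤ 3 * n := by
      have := hb.mul_lt
      have := hb.length_le_add
      omega
    have h2 : nb ≤ nb * b := Nat.le_mul_of_pos_right _ hb.pos
    have h3 : nb * (40 * b + 20) ≤ 180 * n := by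
      rw [Nat.mul_add, Nat.mul_left_comm]
      omega
    exact_mod_cast h3
  have hu6 : u ≤ u ^ 6 := le_self_pow₀ hu1 (by norm_num)
  have h16 : 1 ≤ u ^ 6 := one_le_pow₀ hu1
  have e1 : (6000 : ℝ) * ((T + n + 2) * u) ≤ 18000 * (u ^ 6 * (n + X)) := by
    have h1 : (T + n + 2 : ℝ) * u ≤ 3 * (n + X) * u ^ 6 :=
      mul_le_mul (by linarith) hu6 (by linarith) (by linarith)
    linarith
  have e2 : (nb : ℝ) * (40 * b + 20) ≤ 180 * (u ^ 6 * (n + X)) := by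
    have : (n : ℝ) + X ≤ u ^ 6 * (n + X) := le_mul_of_one_le_left (by linarith) h16
    linarith
  have e3 : (nb : ℝ) * ((d + 2) * l * (80100 * ((T + 1) * u ^ 4))) ≤
      400000 * (d + 2) * (u ^ 6 * (n + X)) := by
    have hl : (l : ℝ) ≤ u := by simp [hu]
    calc (nb : ℝ) * ((d + 2) * l * (80100 * ((T + 1) * u ^ 4)))
        = (80100 * (d + 2)) * (l * (nb * (T + 1)) * u ^ 4) := by ring
      _ ≤ (80100 * (d + 2)) * (u * (4 * u * X) * u ^ 4) := by gcongr
      _ = 320400 * (d + 2) * (u ^ 6 * X) := by ring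
      _ ≤ 400000 * (d + 2) * (u ^ 6 * (n + X)) := by
        gcongr
        · norm_num
        · linarith
  have e4 : (T : ℝ) * (50 * b + 48) ≤ 148 * (u ^ 6 * (n + X)) := by
    have h1 : u * X ≤ u ^ 6 * (n + X) := mul_le_mul hu6 (by linarith) hX0 (by positivity)
    have h2 : X ≤ u * X := le_mul_of_one_le_left hX0 hu1
    linarith
  have h0 : 0 ≤ u ^ 6 * (n + X) := by positivity
  rw [timeBound]
  push_cast
  rw [← hu]
  linarith

/-- For `N ≥ 3 > e` the natural logarithm is at least `1` and absorbs the additive constants; `log 2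
> 1/2` accounts for the change of base. -/
theorem clog_add_one_le {N l : ℕ} (hN : 3 ≤ N) (hl : 2 ^ l < 2 * N) :
    (l : ℝ) + 1 ≤ 4 * Real.log N := by
  have hN' : (3 : ℝ) ≤ N := by exact_mod_cast hN
  have h1 : 1 ≤ Real.log N := by
    rw [Real.le_log_iff_exp_le (by linarith)]
    exact (Real.exp_one_lt_d9.le.trans (by norm_num)).trans hN'
  have h2 : (l : ℝ) * Real.log 2 ≤ Real.log 2 + Real.log N := by
    rw [← Real.log_pow, ← Real.log_mul (by norm_num) (by linarith)]
    refine Real.log_le_log (by positivity) ?_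
    exact_mod_cast hl.le
  have h3 := Real.log_two_gt_d9
  have h4 : (l - 1 : ℝ) * Real.log 2 ≤ Real.log N := by linarith
  rcases le_total (l : ℝ) 1 with h5 | h5
  · linarith
  · have : (l - 1 : ℝ) * (1 / 2) ≤ (l - 1) * Real.log 2 :=
      mul_le_mul_of_nonneg_left (by linarith) (by linarith)
    linarith

theorem two_pow_clog_lt {N : ℕ} (hN : 2 ≤ N) : 2 ^ Nat.clog 2 N < 2 * N := by
  have h1 := Nat.pow_pred_clog_lt_self (b := 2) (by omega) (x := N) (by omega)
  have h2 : 0 < Nat.clog 2 N := Nat.clog_pos (by omega) hN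
  obtain ⟨l, hl⟩ := Nat.exists_eq_succ_of_ne_zero h2.ne'
  rw [hl, Nat.pred_succ] at h1
  rw [hl, pow_succ]
  omega

theorem mul_square_le_pow {N : ℕ} (d : ℕ) (hN : 3 ≤ N) :
    (d + 2000) * (N * N) ≤ N ^ (d + 20) := by
  have h1 : d + 2000 ≤ N ^ (d + 18) := by
    refine le_trans ?_ (Nat.pow_le_pow_left hN _)
    have h3 : d < 3 ^ d := Nat.lt_pow_self (by omega)
    have h4 : 3 ^ (d + 18) = 3 ^ d * 387420489 := by rw [pow_add]; norm_num
    omega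
  calc (d + 2000) * (N * N) ≤ N ^ (d + 18) * (N * N) := Nat.mul_le_mul_right _ h1
    _ = N ^ (d + 20) := by ring

theorem div_timeBound_le {d T n m l b nb t : ℕ} (hn : 1 ≤ n) (hmn : m ≤ n) (hmT : m ≤ l * T)
    (hb : Blocks m b nb) (hl : 2 ^ l < 2 * (T + n + 2)) (ht : t ≤ timeBound d T n l b nb) :
    (t : ℝ) / n ≤ (20000 + 400000 * (d + 2)) * 4 ^ 6 *
      (1 + T * min (√(n : ℝ)) (√(T : ℝ)) / n) * Real.log ((T : ℝ) + n + 2) ^ 6 := by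
  have hn' : (1 : ℝ) ≤ n := by exact_mod_cast hn
  have h1 := timeBound_le (d := d) hn hmn hmT hb
  have h2 := clog_add_one_le (N := T + n + 2) (by omega) hl
  push_cast at h2
  have hM0 : 0 ≤ min (√(n : ℝ)) (√(T : ℝ)) := le_min (Real.sqrt_nonneg _) (Real.sqrt_nonneg _)
  generalize min (√(n : ℝ)) (√(T : ℝ)) = M at *
  have ht' : (t : ℝ) ≤ timeBound d T n l b nb := by exact_mod_cast ht
  rw [div_le_iff₀ (by linarith)]
  refine (ht'.trans h1).trans ?_
  have h3 : ((l : ℝ) + 1) ^ 6 ≤ (4 * Real.log ((T : ℝ) + n + 2)) ^ 6 := by gcongr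
  refine (mul_le_mul_of_nonneg_right (mul_le_mul_of_nonneg_left h3 (by positivity))
    (by positivity)).trans (le_of_eq ?_)
  field_simp

/-- Of the exponent `d + 2`, two units pay for the union bound over blocks and sums, and `d` remain
for the failure probability. -/
theorem failure_le {d T n l nb : ℕ} (hn : 1 ≤ n) (hnb : nb ≤ T + n + 2)
    (hl : T + n + 2 ≤ 2 ^ l) :
    (nb * (T + 1) : ℝ) / 2 ^ ((d + 2) * l) ≤ 1 / ((T : ℝ) + n) ^ d := by
  have hbase : (0 : ℝ) < (T : ℝ) + n := by
    have : (0 : ℝ) ≤ T := Nat.cast_nonneg _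
    have : (1 : ℝ) ≤ n := by exact_mod_cast hn
    linarith
  rw [div_le_div_iff₀ (by positivity) (by positivity), one_mul]
  have h2 : nb * (T + 1) * (T + n) ^ d ≤ 2 ^ ((d + 2) * l) := by
    calc nb * (T + 1) * (T + n) ^ d ≤ (T + n + 2) * (T + n + 2) * (T + n + 2) ^ d :=
          Nat.mul_le_mul (Nat.mul_le_mul hnb (by omega)) (Nat.pow_le_pow_left (by omega) _)
      _ = (T + n + 2) ^ (d + 2) := by ring
      _ ≤ (2 ^ l) ^ (d + 2) := Nat.pow_le_pow_left hl _
      _ = 2 ^ ((d + 2) * l) := by rw [← pow_mul, mul_comm]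
  exact_mod_cast h2

/-- The range `q = 2 * 2 ^ l` of the markers is a power of two so that it divides the number of
words and reduction keeps the uniform law. -/
theorem two_pow_succ_dvd {d N l w : ℕ} (hl : 2 ^ l < 2 * N)
    (hw : (d + 2000) * (N * N) ≤ 2 ^ w) : 2 * 2 ^ l ∣ 2 ^ w := by
  rw [← pow_succ']
  refine pow_dvd_pow 2 ((Nat.pow_le_pow_iff_right (a := 2) (by omega)).1 (le_trans ?_ hw))
  have h1 := Nat.le_mul_self N
  have h2 : (d + 2000) * (N * N) = d * (N * N) + 2000 * (N * N) := by ring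
  rw [pow_succ]
  omega

end WordRAM

/-- For every exponent `d` there is one randomized word-RAM program that, given the whole operation
sequence in advance, has amortized processing time
`Õ(1 + tmax * min (√oprs) (√tmax) / oprs)`, whatever the random words are, and outputs the correct
answers to all queries with probability at least `1 - (tmax + oprs)⁻ᵈ`.  The word length `w` may be
any number with `(tmax + oprs + 2) ^ c ≤ 2 ^ w` for which the weights fit into a word. -/
theorem mainTheorem3 (d : ℕ) :
    ∃ (P : WordRAM.Prog) (c k : ℕ) (C : ℝ),
      ∀ (tmax : ℕ) (ops : List DynSubsetSum.Op) (w : ℕ),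
        1 ≤ ops.length →
        (∀ t : ℕ, DynSubsetSum.Op.query t ∈ ops → t ≤ tmax) →
        (∀ x : ℕ, DynSubsetSum.Op.insert x ∈ ops → x < 2 ^ w) →
        (tmax + ops.length + 2) ^ c ≤ 2 ^ w →
        (∀ ω : ℕ → Fin (2 ^ w), ∃ (s : WordRAM.State) (T : ℕ),
          WordRAM.Exec w ω P (DynSubsetSum.input tmax ops) s T ∧
          (T : ℝ) / ops.length ≤
            C * (1 + tmax * min (√(ops.length : ℝ)) (√(tmax : ℝ)) / ops.length) *
              Real.log ((tmax : ℝ) + ops.length + 2) ^ k) ∧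
        1 - 1 / ((tmax : ℝ) + ops.length) ^ d ≤
          (WordRAM.coins w).real {ω | ∃ (s : WordRAM.State) (T : ℕ),
            WordRAM.Exec w ω P (DynSubsetSum.input tmax ops) s T ∧
            s.out = DynSubsetSum.answers ops} := by
  -- The exponent `d + 20` makes `(d + 2000) * N ^ 2` fit into a word for every `N ≥ 3`. The factor
  -- `4 ^ 6` comes from `l + 1 ≤ 4 * log N`.
  refine ⟨WordRAM.subsetSum d, d + 20, 6, (20000 + 400000 * (d + 2)) * 4 ^ 6, ?_⟩
  intro T ops w hn hT _ hw
  have hNN := (WordRAM.mul_square_le_pow d (show 3 ≤ T + ops.length + 2 by omega)).trans hw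
  clear hw
  -- The block length, the exponent and the prime depend on the input alone and are fixed before the
  -- random words.
  obtain ⟨b, nb, hb⟩ := WordRAM.exists_blocks (DynSubsetSum.kept T ops).length
  obtain ⟨l, hl⟩ : ∃ l, l = Nat.clog 2 (T + ops.length + 2) := ⟨_, rfl⟩
  have hl1 : T + ops.length + 2 ≤ 2 ^ l := hl ▸ Nat.le_pow_clog (by omega) _
  have hl2 : 2 ^ l < 2 * (T + ops.length + 2) := hl ▸ WordRAM.two_pow_clog_lt (by omega)
  have hTl : T < 2 ^ l := by omega
  obtain ⟨p, hp⟩ : ∃ p, p = WordRAM.bigPrime (2 * 2 ^ l) := ⟨_, rfl⟩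
  have hp' := WordRAM.bigPrime_spec (q := 2 * 2 ^ l) (by omega)
  rw [← hp] at hp'
  have : Fact p.Prime := ⟨hp'.1⟩
  have hmn := DynSubsetSum.length_kept_le T ops
  constructor
  · intro ω
    obtain ⟨s, t, hexec, ht, -⟩ := WordRAM.runs_subsetSum (ω := ω) hNN hT hl hp hb
    rw [zero_add] at ht
    exact ⟨s, t, hexec, WordRAM.div_timeBound_le hn hmn
      (DynSubsetSum.length_kept_le_mul hTl ops) hb hl2 ht⟩
  · have hnb : nb ≤ T + ops.length + 2 := by
      have := hb.nb_le
      have := hb.length_le_add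
      omega
    refine le_trans (sub_le_sub_left (WordRAM.failure_le hn hnb hl1) 1)
      (SubsetSumSeries.le_coins_of_allFound (p := p)
        (WordRAM.blockCount (DynSubsetSum.kept T ops) b) (by omega) (by omega) hp'.2.1.le
        (WordRAM.two_pow_succ_dvd hl2 hNN) fun ω hω => ?_)
    obtain ⟨s, t, hexec, -, hout⟩ := WordRAM.runs_subsetSum (ω := ω) hNN hT hl hp hb
    exact ⟨s, t, hexec, hout hω⟩
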